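/- **Proposition 2.2 (Properties of $\sigma$).** Let $0<s_*<s^*$ be fixed. For $n\ge 1$ let $S=(s_{ij})\in\mathbb R^{n\times n}$ be a (variance) matrix that is flat, i.e. $s_*/n\le s_{ij}\le s^*/n$ for all $i,j=1,\dots,n$, and let $\rho(S)=\max|\mathrm{spec}(S)|$ be its spectral radius. For every $\eta>0$ and $\tau\ge 0$ the system (all operations being componentwise) $$\frac1{v_1}=\eta+Sv_2+\frac{\tau}{\eta+S^{t}v_1},\qquad \frac1{v_2}=\eta+S^{t}v_1+\frac{\tau}{\eta+Sv_2}$$ has a unique solution $(v_1,v_2)=(v_1^\tau(\eta),v_2^\tau(\eta))$ with $v_1,v_2\in(0,\infty)^n$. Write $\langle w\rangle=\frac1n\sum_i w_i$ and $D(0,r)=\{z\in\mathbb C:|z|<r\}$ (empty if $r\le 0$), let $\Delta_z$ be the Laplacian on $\mathbb C\cong\mathbb R^2$, and define $\sigma\colon\mathbb C\to\mathbb R$ by $$\sigma(z)=-\frac1{2\pi}\int_0^\infty\Delta_z\big\langle v_1^\tau(\eta)|_{\tau=|z|^2}\big\rangle\,d\eta\quad\text{if }|z|^2<\rho(S),\qquad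 \sigma(z)=0\quad\text{if }|z|^2\ge\rho(S).$$ Then: (i) The function $(0,\infty)\times\mathbb C\to(0,\infty)^{2n}$, $(\eta,z)\mapsto(v_1^\tau(\eta),v_2^\tau(\eta))|_{\tau=|z|^2}$ is infinitely often (real) differentiable, and $\eta\mapsto\Delta_z\langle v_1^\tau(\eta)|_{\tau=|z|^2}\rangle$ is integrable on $(0,\infty)$ for each $z\in D(0,\sqrt{\rho(S)})$. (ii) The function $\sigma$ is a rotationally symmetric probability density on $\mathbb C$. (iii) The restriction $\sigma|_{D(0,\sqrt{\rho(S)})}$ is infinitely often differentiable. For every $\varepsilon>0$ and every order $k\ge 0$ there is a constant $C$, depending only on $\varepsilon,k,s_*,s^*$ (in particular not on $n$ or $S$), such that all derivatives of $\sigma$ of order $k$ are bounded by $C$ in absolute value on $D(0,\sqrt{\rho(S)}-\varepsilon)$. Moreover, there are constants $c_1>c_2>0$, depending only on $s_*$ and $s^*$, such that $c_1\ge\sigma(z)\ge c_2$ for all $z\in D(0,\sqrt{\rho(S)})$. In particular, the support of $\sigma$ is the closed disk of radius $\sqrt{\rho(S)}$ around zero. -/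

import Mathlib

open Set MeasureTheory Matrix
open scoped ContDiff

noncomputable section

/-- The variance matrix is flat: all entries lie between `sLow / n` and `sUp / n`. -/
def IsFlat {n : ℕ} (sLow sUp : ℝ) (S : Matrix (Fin n) (Fin n) ℝ) : Prop :=
  ∀ i j, sLow / n ≤ S i j ∧ S i j ≤ sUp / n

/-- The pair `v = (v₁, v₂)` is a positive solution of the vector Dyson equation
`1 / v₁ = η + S v₂ + τ / (η + Sᵗ v₁)`, `1 / v₂ = η + Sᵗ v₁ + τ / (η + S v₂)`
(all operations componentwise). -/
structure IsDysonSolution {n : ℕ} (S : Matrix (Fin n) (Fin n) ℝ) (η τ : ℝ)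
    (v : (Fin n → ℝ) × (Fin n → ℝ)) : Prop where
  pos_fst : ∀ i, 0 < v.1 i
  pos_snd : ∀ i, 0 < v.2 i
  eq_fst : ∀ i, 1 / v.1 i = η + (S *ᵥ v.2) i + τ / (η + (Sᵀ *ᵥ v.1) i)
  eq_snd : ∀ i, 1 / v.2 i = η + (Sᵀ *ᵥ v.1) i + τ / (η + (S *ᵥ v.2) i)

/-- The positive solution `(v₁, v₂)` of the vector Dyson equation at the parameters `η` and `τ`
(an arbitrary pair if there is none). -/
def dysonSolution {n : ℕ} (S : Matrix (Fin n) (Fin n) ℝ) (η τ : ℝ) :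
    (Fin n → ℝ) × (Fin n → ℝ) :=
  Classical.epsilon fun v => IsDysonSolution S η τ v

/-- The average `⟨w⟩ = n⁻¹ ∑ wᵢ`. -/
def vecAvg {n : ℕ} (w : Fin n → ℝ) : ℝ := (∑ i, w i) / n

/-- The spectral radius `max |spec S|`, the spectrum being that of the complex matrix. -/
def specRadius {n : ℕ} (S : Matrix (Fin n) (Fin n) ℝ) : ℝ :=
  (spectralRadius ℂ (S.map Complex.ofReal)).toReal

/-- `Δ_z ⟨v₁⟩`, where `v₁` is taken at `η` and `τ = |z|²`; the Laplacian is the one of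
`ℂ` viewed as a real Euclidean plane. -/
def laplacianAvg {n : ℕ} (S : Matrix (Fin n) (Fin n) ℝ) (η : ℝ) (z : ℂ) : ℝ :=
  Laplacian.laplacian (fun w : ℂ => vecAvg (dysonSolution S η (‖w‖ ^ 2)).1) z

/-- The density of states `σ`. -/
def densityOfStates {n : ℕ} (S : Matrix (Fin n) (Fin n) ℝ) (z : ℂ) : ℝ :=
  if ‖z‖ ^ 2 < specRadius S then
    -(1 / (2 * Real.pi)) * ∫ η in Ioi (0 : ℝ), laplacianAvg S η z
  else 0

/-- `f` is a rotationally symmetric probability density on `ℂ`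
with respect to Lebesgue measure. -/
structure IsRotSymmProbDensity (f : ℂ → ℝ) : Prop where
  measurable : Measurable f
  nonneg : ∀ z, 0 ≤ f z
  integrable : Integrable f volume
  integral_eq_one : ∫ z, f z ∂volume = 1
  rot_symm : ∀ u z : ℂ, ‖u‖ = 1 → f (u * z) = f z

end

/-! Put a = η + S v₂, b = η + Sᵗ v₁ and u = 1/(τ + ab). Then v₁ = bu and v₂ = au, and all quantities
are read off from the triple (a, b, u). For η > 0 the system is monotone in (a, -b) and strictly
subhomogeneous in (a, 1/b), which yields existence by a lattice fixed point and uniqueness by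
comparison.

The formula for σ rests on one identity. Testing the linearised system in τ against the one in η
gives ∂_τ⟨v₁ + v₂⟩ = ∂_η⟨u⟩ (`vecAvg_deriv_symm`). Since ⟨v₁⟩ = ⟨v₂⟩, this says ∇_z⟨v₁⟩ = z ∂_η⟨u⟩,
so Δ_z⟨v₁⟩ = ∂_η(2⟨u⟩ + z·∇⟨u⟩). The primitive is O(η⁻²) at infinity, and below the spectral edge it
extends smoothly to η = 0. With u₀ the value at η = 0+, it follows that 2πσ = 2⟨u₀⟩ + z·∇⟨u₀⟩ =
div(z⟨u₀⟩) (`IsFlat.densityOfStates_eq`). The total mass is therefore a flux: |z|²⟨u₀⟩ = 1 - ⟨abu⟩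
rises from 0 at the origin to 1 at the edge, where the Perron eigenvector and flatness force abu →
0.

The difficulty is the stability at η = 0, where (a, b) ↦ (λa, b/λ) is a symmetry and the
linearisation is singular. The normalization ⟨au⟩ = ⟨bu⟩ breaks it; a multiple of g = ⟨bu⟩ - ⟨au⟩ is
built into the equations and vanishes on positive solutions. In the logarithmic variables x/a and
-y/b the linearisation averages with nonnegative weights, so a maximum principle and flatness bound
its inverse in the sup norm, uniformly in the dimension (`exists_stability_bound`).

Uniform derivative bounds come without tracking constants. The implicit function theorem is applied
once, in the Banach algebra of bounded families indexed by all admissible (n, S, z)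
(`BddFamily.exists_smooth_branch`); the k-th derivative at a single point of that one function
bounds the k-th derivative of every density.

The two-sided bound on σ comes from an L² contraction estimate at η = 0
(`IsDysonTriple.energy_estimate`) followed by Cauchy–Schwarz with two different weights. -/

noncomputable section

/-! ### Averages over the components -/

section Averages

variable {n : ℕ}

lemma vecAvg_add (f g : Fin n → ℝ) : vecAvg (f + g) = vecAvg f + vecAvg g := by
  simp [vecAvg, Finset.sum_add_distrib, add_div]

lemma vecAvg_sub (f g : Fin n → ℝ) : vecAvg (f - g) = vecAvg f - vecAvg g := by
  simp [vecAvg, Finset.sum_sub_distrib, sub_div]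

lemma vecAvg_smul (c : ℝ) (f : Fin n → ℝ) : vecAvg (c • f) = c * vecAvg f := by
  simp [vecAvg, ← Finset.mul_sum, mul_div_assoc]

lemma vecAvg_neg (f : Fin n → ℝ) : vecAvg (-f) = -vecAvg f := by
  simp [vecAvg, neg_div]

lemma vecAvg_mono {f g : Fin n → ℝ} (h : ∀ i, f i ≤ g i) : vecAvg f ≤ vecAvg g :=
  div_le_div_of_nonneg_right (Finset.sum_le_sum fun i _ => h i) (Nat.cast_nonneg n)

lemma vecAvg_nonneg {f : Fin n → ℝ} (h : ∀ i, 0 ≤ f i) : 0 ≤ vecAvg f :=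
  div_nonneg (Finset.sum_nonneg fun i _ => h i) (Nat.cast_nonneg n)

lemma vecAvg_const (hn : 0 < n) (c : ℝ) : vecAvg (fun _ : Fin n => c) = c := by
  have : (n : ℝ) ≠ 0 := by positivity
  simp [vecAvg]; field_simp

lemma vecAvg_le (hn : 0 < n) {f : Fin n → ℝ} {c : ℝ} (h : ∀ i, f i ≤ c) : vecAvg f ≤ c :=
  (vecAvg_mono h).trans_eq (vecAvg_const hn c)

lemma le_vecAvg (hn : 0 < n) {f : Fin n → ℝ} {c : ℝ} (h : ∀ i, c ≤ f i) : c ≤ vecAvg f :=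
  (vecAvg_const hn c).symm.trans_le (vecAvg_mono h)

lemma vecAvg_pos (hn : 0 < n) {f : Fin n → ℝ} (h : ∀ i, 0 < f i) : 0 < vecAvg f := by
  have : Nonempty (Fin n) := ⟨⟨0, hn⟩⟩
  exact div_pos (Finset.sum_pos (fun i _ => h i) Finset.univ_nonempty) (by positivity)

lemma abs_vecAvg_le (hn : 0 < n) {f : Fin n → ℝ} {c : ℝ} (h : ∀ i, |f i| ≤ c) :
    |vecAvg f| ≤ c :=
  abs_le.2 ⟨le_vecAvg hn fun i => (abs_le.1 (h i)).1, vecAvg_le hn fun i => (abs_le.1 (h i)).2⟩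

/-- Duality of `S` and its transpose for the averaged scalar product. -/
lemma vecAvg_mul_mulVec (S : Matrix (Fin n) (Fin n) ℝ) (f g : Fin n → ℝ) :
    vecAvg (f * (S *ᵥ g)) = vecAvg (g * (Sᵀ *ᵥ f)) := by
  have h := Matrix.dotProduct_mulVec f S g
  rw [← Matrix.mulVec_transpose, dotProduct_comm (Sᵀ *ᵥ f)] at h
  simp only [dotProduct] at h
  simp only [vecAvg, Pi.mul_apply, h]

lemma vecAvg_sq_le (f g : Fin n → ℝ) (hg : ∀ i, 0 < g i) :
    vecAvg f ^ 2 ≤ vecAvg (fun i => f i ^ 2 / g i) * vecAvg g := by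
  have := Finset.sum_sq_le_sum_mul_sum_of_sq_le_mul (Finset.univ : Finset (Fin n))
    (r := f) (f := fun i => f i ^ 2 / g i) (g := g)
    (fun i _ => div_nonneg (sq_nonneg _) (hg i).le) (fun i _ => (hg i).le)
    (fun i _ => by have := (hg i).ne'; field_simp; exact le_rfl)
  simp only [vecAvg]
  rw [div_pow, div_mul_div_comm, ← sq]
  gcongr

end Averages

/-! ### Flat matrices -/

section Flat

variable {n : ℕ} {sLow sUp : ℝ} {S : Matrix (Fin n) (Fin n) ℝ}

lemma IsFlat.transpose (h : IsFlat sLow sUp S) : IsFlat sLow sUp Sᵀ := fun i j => h j i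

lemma IsFlat.entry_nonneg (h : IsFlat sLow sUp S) (hL : 0 < sLow) (i j : Fin n) : 0 ≤ S i j :=
  (by positivity : 0 ≤ sLow / n).trans (h i j).1

/-- On nonnegative vectors a flat matrix is comparable with the averaging functional. This is what
keeps later constants independent of the dimension. -/
lemma IsFlat.mul_vecAvg_le (h : IsFlat sLow sUp S) {f : Fin n → ℝ} (hf : ∀ i, 0 ≤ f i)
    (i : Fin n) : sLow * vecAvg f ≤ (S *ᵥ f) i := by
  have : sLow * vecAvg f = ∑ j, sLow / n * f j := by
    rw [← Finset.mul_sum, vecAvg]; ring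
  rw [this]
  simp only [mulVec, dotProduct]
  exact Finset.sum_le_sum fun j _ => mul_le_mul_of_nonneg_right (h i j).1 (hf j)

lemma IsFlat.le_mul_vecAvg (h : IsFlat sLow sUp S) {f : Fin n → ℝ} (hf : ∀ i, 0 ≤ f i)
    (i : Fin n) : (S *ᵥ f) i ≤ sUp * vecAvg f := by
  have : sUp * vecAvg f = ∑ j, sUp / n * f j := by
    rw [← Finset.mul_sum, vecAvg]; ring
  rw [this]
  simp only [mulVec, dotProduct]
  exact Finset.sum_le_sum fun j _ => mul_le_mul_of_nonneg_right (h i j).2 (hf j)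

lemma mulVec_mono_of_nonneg (hS : ∀ i j, 0 ≤ S i j) {f g : Fin n → ℝ} (h : ∀ i, f i ≤ g i)
    (i : Fin n) : (S *ᵥ f) i ≤ (S *ᵥ g) i := by
  simp only [mulVec, dotProduct]
  exact Finset.sum_le_sum fun j _ => mul_le_mul_of_nonneg_left (h j) (hS i j)

lemma mulVec_nonneg_of_nonneg (hS : ∀ i j, 0 ≤ S i j) {f : Fin n → ℝ} (h : ∀ i, 0 ≤ f i)
    (i : Fin n) : 0 ≤ (S *ᵥ f) i := by
  simp only [mulVec, dotProduct]
  exact Finset.sum_nonneg fun j _ => mul_nonneg (hS i j) (h j)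

end Flat

/-- The Dyson equation in the variables `a = η + S v₂`, `b = η + Sᵗ v₁`, `u = 1 / (τ + a b)`,
with the normalization `⟨v₁⟩ = ⟨v₂⟩`, where `v₁ = b u` and `v₂ = a u`. -/
structure IsDysonTriple {n : ℕ} (S : Matrix (Fin n) (Fin n) ℝ) (η τ : ℝ)
    (a b u : Fin n → ℝ) : Prop where
  pos_a : ∀ i, 0 < a i
  pos_b : ∀ i, 0 < b i
  pos_u : ∀ i, 0 < u i
  eq_a : ∀ i, a i = η + (S *ᵥ (a * u)) i
  eq_b : ∀ i, b i = η + (Sᵀ *ᵥ (b * u)) i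
  eq_u : ∀ i, u i * (τ + a i * b i) = 1
  avg_eq : vecAvg (a * u) = vecAvg (b * u)

/-! ### Existence and uniqueness for positive η -/

section Existence

variable {n : ℕ} {S : Matrix (Fin n) (Fin n) ℝ} {η τ : ℝ} {a b u : Fin n → ℝ}

/-- Without the normalization, the averages agree automatically for `η > 0`. -/
lemma vecAvg_eq_of_equations (hη : η ≠ 0) (ha : ∀ i, a i = η + (S *ᵥ (a * u)) i)
    (hb : ∀ i, b i = η + (Sᵀ *ᵥ (b * u)) i) : vecAvg (a * u) = vecAvg (b * u) := by
  have h1 : vecAvg (b * u * a) = η * vecAvg (b * u) + vecAvg (b * u * (S *ᵥ (a * u))) := by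
    rw [← vecAvg_smul, ← vecAvg_add]; congr 1; ext i
    simp only [Pi.mul_apply, Pi.add_apply, Pi.smul_apply, smul_eq_mul]
    have := ha i
    linear_combination b i * u i * this
  have h2 : vecAvg (a * u * b) = η * vecAvg (a * u) + vecAvg (a * u * (Sᵀ *ᵥ (b * u))) := by
    rw [← vecAvg_smul, ← vecAvg_add]; congr 1; ext i
    simp only [Pi.mul_apply, Pi.add_apply, Pi.smul_apply, smul_eq_mul]
    have := hb i
    linear_combination a i * u i * this
  rw [vecAvg_mul_mulVec] at h1
  have h3 : b * u * a = a * u * b := by ring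
  rw [h3] at h1
  exact mul_left_cancel₀ hη (by linarith)

lemma IsDysonTriple.of_pos (hη : 0 < η) (ha0 : ∀ i, 0 < a i) (hb0 : ∀ i, 0 < b i)
    (hu0 : ∀ i, 0 < u i) (ha : ∀ i, a i = η + (S *ᵥ (a * u)) i)
    (hb : ∀ i, b i = η + (Sᵀ *ᵥ (b * u)) i) (hu : ∀ i, u i * (τ + a i * b i) = 1) :
    IsDysonTriple S η τ a b u :=
  ⟨ha0, hb0, hu0, ha, hb, hu, vecAvg_eq_of_equations hη.ne' ha hb⟩

lemma IsDysonTriple.isDysonSolution (h : IsDysonTriple S η τ a b u) :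
    IsDysonSolution S η τ (b * u, a * u) where
  pos_fst i := mul_pos (h.pos_b i) (h.pos_u i)
  pos_snd i := mul_pos (h.pos_a i) (h.pos_u i)
  eq_fst i := by
    have h1 := (h.pos_a i).ne'
    have h2 := (h.pos_b i).ne'
    have h3 := (h.pos_u i).ne'
    have h4 := h.eq_u i
    simp only
    rw [← h.eq_a i, ← h.eq_b i, Pi.mul_apply]
    field_simp
    linear_combination -h4
  eq_snd i := by
    have h1 := (h.pos_a i).ne'
    have h2 := (h.pos_b i).ne'
    have h3 := (h.pos_u i).ne'
    have h4 := h.eq_u i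
    simp only
    rw [← h.eq_a i, ← h.eq_b i, Pi.mul_apply]
    field_simp
    linear_combination -h4

lemma IsDysonSolution.isDysonTriple (hS : ∀ i j, 0 ≤ S i j) (hη : 0 < η) (hτ : 0 ≤ τ)
    {v : (Fin n → ℝ) × (Fin n → ℝ)} (h : IsDysonSolution S η τ v) :
    IsDysonTriple S η τ (fun i => η + (S *ᵥ v.2) i) (fun i => η + (Sᵀ *ᵥ v.1) i)
      (fun i => v.1 i / (η + (Sᵀ *ᵥ v.1) i)) ∧
    v = ((fun i => η + (Sᵀ *ᵥ v.1) i) * (fun i => v.1 i / (η + (Sᵀ *ᵥ v.1) i)),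
      (fun i => η + (S *ᵥ v.2) i) * (fun i => v.1 i / (η + (Sᵀ *ᵥ v.1) i))) := by
  have hA : ∀ i, 0 < η + (S *ᵥ v.2) i := fun i => by
    have := mulVec_nonneg_of_nonneg hS (fun j => (h.pos_snd j).le) i
    linarith
  have hB : ∀ i, 0 < η + (Sᵀ *ᵥ v.1) i := fun i => by
    have := mulVec_nonneg_of_nonneg (S := Sᵀ) (fun i j => hS j i) (fun j => (h.pos_fst j).le) i
    linarith
  have e1 : (fun i => η + (Sᵀ *ᵥ v.1) i) * (fun i => v.1 i / (η + (Sᵀ *ᵥ v.1) i)) = v.1 := by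
    ext i
    simp only [Pi.mul_apply]
    exact mul_div_cancel₀ _ (hB i).ne'
  have hu : ∀ i, v.1 i / (η + (Sᵀ *ᵥ v.1) i) *
      (τ + (η + (S *ᵥ v.2) i) * (η + (Sᵀ *ᵥ v.1) i)) = 1 := fun i => by
    have h1 := h.eq_fst i
    have hA' := (hA i).ne'
    have hB' := (hB i).ne'
    have hv := (h.pos_fst i).ne'
    field_simp at h1 ⊢
    linarith
  -- The second equation forces v₂ = A/(τ + AB), which is also Au; hence one vector u serves both
  -- components.
  have e2 : (fun i => η + (S *ᵥ v.2) i) * (fun i => v.1 i / (η + (Sᵀ *ᵥ v.1) i)) = v.2 := by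
    ext i
    have h1 := hu i
    have h2 := h.eq_snd i
    have hA' := hA i
    have hB' := hB i
    have hv := h.pos_fst i
    have hw := h.pos_snd i
    simp only [Pi.mul_apply]
    set A := η + (S *ᵥ v.2) i
    set B := η + (Sᵀ *ᵥ v.1) i
    have hD : 0 < τ + A * B := by positivity
    have hw2 : v.2 i * (τ + A * B) = A := by
      have := hD.ne'
      field_simp at h2
      linarith
    have : (A * (v.1 i / B) - v.2 i) * (τ + A * B) = 0 := by
      linear_combination A * h1 - hw2
    rcases mul_eq_zero.1 this with h | h
    · linarith
    · exact absurd h hD.ne'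
  refine ⟨IsDysonTriple.of_pos hη hA hB (fun i => div_pos (h.pos_fst i) (hB i)) ?_ ?_ hu, ?_⟩
  · intro i; rw [e2]
  · intro i; rw [e1]
  · rw [e1, e2]

/-- One half of uniqueness, by strict subhomogeneity in the variables `(a, b⁻¹)`. -/
lemma IsDysonTriple.le_of_pos (hS : ∀ i j, 0 ≤ S i j) (hη : 0 < η) (hτ : 0 ≤ τ)
    {a' b' u' : Fin n → ℝ} (h : IsDysonTriple S η τ a b u) (h' : IsDysonTriple S η τ a' b' u') :
    (∀ i, a i ≤ a' i) ∧ ∀ i, b' i ≤ b i := by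
  rcases isEmpty_or_nonempty (Fin n) with hn | hn
  · exact ⟨fun i => isEmptyElim i, fun i => isEmptyElim i⟩
  obtain ⟨i₀, -, hi₀⟩ := Finset.exists_max_image Finset.univ
    (fun i => max (a i / a' i) (b' i / b i)) Finset.univ_nonempty
  -- The least common factor with a ≤ l a' and b' ≤ l b. The bounds on au and b'u' then scale with
  -- the same l, while the summand η does not scale; for l > 1 both inequalities at i₀ become
  -- strict, contradicting minimality.
  set l := max (a i₀ / a' i₀) (b' i₀ / b i₀) with hl
  have ha : ∀ i, a i ≤ l * a' i := fun i =>
    (div_le_iff₀ (h'.pos_a i)).1 ((le_max_left _ _).trans (hi₀ i (Finset.mem_univ i)))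
  have hb : ∀ i, b' i ≤ l * b i := fun i =>
    (div_le_iff₀ (h.pos_b i)).1 ((le_max_right _ _).trans (hi₀ i (Finset.mem_univ i)))
  suffices hl1 : l ≤ 1 by
    exact ⟨fun i => (ha i).trans (mul_le_of_le_one_left (h'.pos_a i).le hl1),
      fun i => (hb i).trans (mul_le_of_le_one_left (h.pos_b i).le hl1)⟩
  by_contra! hl1
  have hl0 : 0 < l := by linarith
  have key1 : ∀ i, (a * u) i ≤ (l • (a' * u')) i := fun i => by
    have h1 := h.eq_u i
    have h2 := h'.eq_u i
    simp only [Pi.mul_apply, Pi.smul_apply, smul_eq_mul]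
    have p1 := h.pos_a i; have p2 := h.pos_b i; have p3 := h.pos_u i
    have q1 := h'.pos_a i; have q2 := h'.pos_b i; have q3 := h'.pos_u i
    have : l * a' i * u' i - a i * u i =
        u i * u' i * (τ * (l * a' i - a i) + a i * a' i * (l * b i - b' i)) := by
      linear_combination a i * u i * h2 - l * a' i * u' i * h1
    have : 0 ≤ u i * u' i * (τ * (l * a' i - a i) + a i * a' i * (l * b i - b' i)) := by
      have := ha i; have := hb i
      refine mul_nonneg (by positivity) (add_nonneg (mul_nonneg hτ (by linarith))
        (mul_nonneg (by positivity) (by linarith)))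
    linarith
  have key2 : ∀ i, (b' * u') i ≤ (l • (b * u)) i := fun i => by
    have h1 := h.eq_u i
    have h2 := h'.eq_u i
    simp only [Pi.mul_apply, Pi.smul_apply, smul_eq_mul]
    have p1 := h.pos_a i; have p2 := h.pos_b i; have p3 := h.pos_u i
    have q1 := h'.pos_a i; have q2 := h'.pos_b i; have q3 := h'.pos_u i
    have : l * b i * u i - b' i * u' i =
        u i * u' i * (τ * (l * b i - b' i) + b i * b' i * (l * a' i - a i)) := by
      linear_combination b' i * u' i * h1 - l * b i * u i * h2
    have : 0 ≤ u i * u' i * (τ * (l * b i - b' i) + b i * b' i * (l * a' i - a i)) := by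
      have := ha i; have := hb i
      refine mul_nonneg (by positivity) (add_nonneg (mul_nonneg hτ (by linarith))
        (mul_nonneg (by positivity) (by linarith)))
    linarith
  have lt1 : a i₀ < l * a' i₀ := by
    have := mulVec_mono_of_nonneg hS key1 i₀
    rw [mulVec_smul, Pi.smul_apply, smul_eq_mul] at this
    have e1 := h.eq_a i₀
    have e2 := h'.eq_a i₀
    nlinarith [mul_pos hη (sub_pos.2 hl1)]
  have lt2 : b' i₀ < l * b i₀ := by
    have := mulVec_mono_of_nonneg (S := Sᵀ) (fun i j => hS j i) key2 i₀
    rw [mulVec_smul, Pi.smul_apply, smul_eq_mul] at this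
    have e1 := h.eq_b i₀
    have e2 := h'.eq_b i₀
    nlinarith [mul_pos hη (sub_pos.2 hl1)]
  exact lt_irrefl l (max_lt ((div_lt_iff₀ (h'.pos_a i₀)).2 lt1) ((div_lt_iff₀ (h.pos_b i₀)).2 lt2))

lemma IsDysonTriple.unique (hS : ∀ i j, 0 ≤ S i j) (hη : 0 < η) (hτ : 0 ≤ τ)
    {a' b' u' : Fin n → ℝ} (h : IsDysonTriple S η τ a b u) (h' : IsDysonTriple S η τ a' b' u') :
    a = a' ∧ b = b' ∧ u = u' := by
  have h1 := h.le_of_pos hS hη hτ h'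
  have h2 := h'.le_of_pos hS hη hτ h
  have ha : a = a' := funext fun i => le_antisymm (h1.1 i) (h2.1 i)
  have hb : b = b' := funext fun i => le_antisymm (h2.2 i) (h1.2 i)
  refine ⟨ha, hb, funext fun i => ?_⟩
  have e1 := h.eq_u i
  have e2 := h'.eq_u i
  rw [ha, hb] at e1
  exact mul_right_cancel₀ (right_ne_zero_of_mul_eq_one e1) (e1.trans e2.symm)

/-- Existence, as a fixed point of a map that is monotone in `(a, -b)`. -/
lemma exists_isDysonTriple (hS : ∀ i j, 0 ≤ S i j) (hη : 0 < η) (hτ : 0 ≤ τ) :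
    ∃ a b u, IsDysonTriple S η τ a b u := by
  obtain ⟨M, hM0, hM1, hM2⟩ : ∃ M : ℝ, 0 ≤ M ∧ (∀ i, ∑ j, S i j ≤ M) ∧ ∀ i, ∑ j, Sᵀ i j ≤ M := by
    refine ⟨∑ i, ∑ j, S i j, Finset.sum_nonneg fun i _ => Finset.sum_nonneg fun j _ => hS i j,
      fun i => ?_, fun j => ?_⟩
    · exact Finset.single_le_sum (f := fun i => ∑ j, S i j)
        (fun i _ => Finset.sum_nonneg fun j _ => hS i j) (Finset.mem_univ i)
    · exact (Finset.single_le_sum (f := fun j => ∑ i, S i j)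
        (fun j _ => Finset.sum_nonneg fun i _ => hS i j) (Finset.mem_univ j)).trans_eq
        Finset.sum_comm
  -- For arguments at least η one has x/(τ + xy) ≤ 1/η, so the box [η, B] is mapped into itself.
  set B : ℝ := η + M / η with hB
  have hηB : η ≤ B := by have : 0 ≤ M / η := by positivity
                         linarith
  have : Fact (η ≤ B) := ⟨hηB⟩
  let w (x y : Set.Icc η B) : ℝ := x / (τ + x * y)
  have hpos (x : Set.Icc η B) : 0 < (x : ℝ) := hη.trans_le x.2.1
  have hw0 (x y) : 0 ≤ w x y := by have := hpos x; have := hpos y; positivity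
  have hw1 (x y) : w x y ≤ 1 / η := by
    have hx := hpos x
    have hy := hpos y
    simp only [w]
    rw [div_le_div_iff₀ (by positivity) hη]
    nlinarith [y.2.1, mul_le_mul_of_nonneg_left y.2.1 hx.le]
  have hwm {x x' y y' : Set.Icc η B} (hx : x ≤ x') (hy : y' ≤ y) : w x y ≤ w x' y' := by
    have p1 := hpos x; have p2 := hpos x'; have p3 := hpos y; have p4 := hpos y'
    have hx' : (x : ℝ) ≤ x' := hx
    have hy' : (y' : ℝ) ≤ y := hy
    simp only [w]
    rw [div_le_div_iff₀ (by positivity) (by positivity)]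
    nlinarith [mul_le_mul_of_nonneg_left hx' hτ,
      mul_le_mul_of_nonneg_left hy' (mul_pos p1 p2).le]
  have hmem (T : Matrix (Fin n) (Fin n) ℝ) (hT : ∀ i j, 0 ≤ T i j) (hTM : ∀ i, ∑ j, T i j ≤ M)
      (x y : Fin n → Set.Icc η B) (i : Fin n) :
      η + (T *ᵥ fun j => w (x j) (y j)) i ∈ Set.Icc η B := by
    refine ⟨by linarith [mulVec_nonneg_of_nonneg hT (fun j => hw0 (x j) (y j)) i], ?_⟩
    have h1 := mulVec_mono_of_nonneg hT (fun j => hw1 (x j) (y j)) i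
    have h2 : (T *ᵥ fun _ => 1 / η) i = (∑ j, T i j) / η := by
      simp only [mulVec, dotProduct, ← Finset.sum_mul]; ring
    have h3 := div_le_div_of_nonneg_right (hTM i) hη.le
    rw [hB]; linarith
  -- The weight x/(τ + xy) increases in x and decreases in y. Reversing the order on the second
  -- factor makes the map monotone on a complete lattice.
  let Φ : (Fin n → Set.Icc η B) × (Fin n → Set.Icc η B)ᵒᵈ →o
      (Fin n → Set.Icc η B) × (Fin n → Set.Icc η B)ᵒᵈ :=
    { toFun := fun x => (fun i => ⟨_, hmem S hS hM1 x.1 (OrderDual.ofDual x.2) i⟩,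
        OrderDual.toDual fun i =>
          ⟨_, hmem Sᵀ (fun i j => hS j i) hM2 (OrderDual.ofDual x.2) x.1 i⟩)
      monotone' := by
        rintro ⟨x, y⟩ ⟨x', y'⟩ ⟨hx, hy⟩
        refine ⟨fun i => ?_, fun i => ?_⟩
        · exact add_le_add le_rfl (mulVec_mono_of_nonneg hS (fun j => hwm (hx j) (hy j)) i)
        · exact add_le_add le_rfl (mulVec_mono_of_nonneg (S := Sᵀ) (fun i j => hS j i)
            (fun j => hwm (hy j) (hx j)) i) }
  obtain ⟨⟨x, y⟩, hxy⟩ : ∃ x, Φ x = x := ⟨Φ.lfp, Φ.map_lfp⟩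
  have hx : ∀ i, (x i : ℝ) = η + (S *ᵥ fun j => w (x j) (OrderDual.ofDual y j)) i := fun i => by
    have := congrFun (congrArg Prod.fst hxy) i
    exact (congrArg Subtype.val this).symm
  have hy : ∀ i, (OrderDual.ofDual y i : ℝ) =
      η + (Sᵀ *ᵥ fun j => w (OrderDual.ofDual y j) (x j)) i := fun i => by
    have := congrFun (congrArg OrderDual.ofDual (congrArg Prod.snd hxy)) i
    exact (congrArg Subtype.val this).symm
  have hD (i) : 0 < τ + (x i : ℝ) * (OrderDual.ofDual y i : ℝ) := by
    have := hpos (x i); have := hpos (OrderDual.ofDual y i); positivity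
  refine ⟨fun i => x i, fun i => OrderDual.ofDual y i,
    fun i => 1 / (τ + (x i : ℝ) * (OrderDual.ofDual y i : ℝ)), IsDysonTriple.of_pos hη
      (fun i => hpos _) (fun i => hpos _) (fun i => one_div_pos.2 (hD i)) ?_ ?_
      fun i => one_div_mul_cancel (hD i).ne'⟩
  · intro i
    rw [hx i]
    congr 2
    ext j
    simp [w, div_eq_mul_inv]
  · intro i
    rw [hy i]
    congr 2
    ext j
    simp [w, div_eq_mul_inv, mul_comm (x j : ℝ)]

end Existence

/-! ### The chosen solution -/

section Solution

variable {n : ℕ} {S : Matrix (Fin n) (Fin n) ℝ} {η τ : ℝ}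

lemma isDysonSolution_dysonSolution (hS : ∀ i j, 0 ≤ S i j) (hη : 0 < η) (hτ : 0 ≤ τ) :
    IsDysonSolution S η τ (dysonSolution S η τ) := by
  obtain ⟨a, b, u, h⟩ := exists_isDysonTriple hS hη hτ
  exact Classical.epsilon_spec (p := fun v => IsDysonSolution S η τ v) ⟨_, h.isDysonSolution⟩

lemma IsDysonSolution.unique (hS : ∀ i j, 0 ≤ S i j) (hη : 0 < η) (hτ : 0 ≤ τ)
    {v w : (Fin n → ℝ) × (Fin n → ℝ)} (hv : IsDysonSolution S η τ v)
    (hw : IsDysonSolution S η τ w) : v = w := by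
  obtain ⟨h1, e1⟩ := hv.isDysonTriple hS hη hτ
  obtain ⟨h2, e2⟩ := hw.isDysonTriple hS hη hτ
  obtain ⟨ea, eb, eu⟩ := h1.unique hS hη hτ h2
  rw [e1, e2, ea, eb, eu]

/-- The vector `u = 1 / (τ + (η + S v₂) (η + Sᵗ v₁))` of the Dyson equation. -/
def dysonU {n : ℕ} (S : Matrix (Fin n) (Fin n) ℝ) (η τ : ℝ) : Fin n → ℝ :=
  fun i => (dysonSolution S η τ).1 i / (η + (Sᵀ *ᵥ (dysonSolution S η τ).1) i)

/-- Uniqueness for η > 0 identifies any triple, however constructed, with the chosen solution; this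
transfers the regularity of local branches to `dysonSolution`. -/
lemma IsDysonTriple.eq_dyson (hS : ∀ i j, 0 ≤ S i j) (hη : 0 < η) (hτ : 0 ≤ τ)
    {a b u : Fin n → ℝ} (h : IsDysonTriple S η τ a b u) :
    dysonSolution S η τ = (b * u, a * u) ∧ dysonU S η τ = u := by
  have h1 := (isDysonSolution_dysonSolution hS hη hτ).unique hS hη hτ h.isDysonSolution
  refine ⟨h1, funext fun i => ?_⟩
  simp only [dysonU, h1]
  rw [← h.eq_b i, Pi.mul_apply, mul_div_cancel_left₀ _ (h.pos_b i).ne']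

end Solution

/-! ### Perron eigenvectors and the spectral radius -/

section Perron

variable {n : ℕ}

/-- A positive matrix has a positive eigenvector (Collatz–Wielandt). -/
lemma exists_pos_eigenvector (hn : 0 < n) {T : Matrix (Fin n) (Fin n) ℝ} (hT : ∀ i j, 0 < T i j) :
    ∃ (r : ℝ) (x : Fin n → ℝ), 0 < r ∧ (∀ i, 0 < x i) ∧ ∀ i, (T *ᵥ x) i = r * x i := by
  have : Nonempty (Fin n) := ⟨⟨0, hn⟩⟩
  have hT0 : ∀ i j, 0 ≤ T i j := fun i j => (hT i j).le
  have hTpos : ∀ x : Fin n → ℝ, (∀ i, 0 ≤ x i) → (∃ j, x j ≠ 0) → ∀ i, 0 < (T *ᵥ x) i := by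
    rintro x hx ⟨j, hj⟩ i
    simp only [mulVec, dotProduct]
    exact Finset.sum_pos' (fun k _ => mul_nonneg (hT0 i k) (hx k))
      ⟨j, Finset.mem_univ j, mul_pos (hT i j) ((hx j).lt_of_ne' hj)⟩
  set M : ℝ := ∑ i, ∑ j, T i j
  let K : Set ((Fin n → ℝ) × ℝ) :=
    (stdSimplex ℝ (Fin n) ×ˢ Set.Icc 0 M) ∩ {q | ∀ i, q.2 * q.1 i ≤ (T *ᵥ q.1) i}
  have hclosed : IsClosed {q : (Fin n → ℝ) × ℝ | ∀ i, q.2 * q.1 i ≤ (T *ᵥ q.1) i} := by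
    rw [Set.ofPred_forall]
    refine isClosed_iInter fun i => isClosed_le (by fun_prop) ?_
    simp only [mulVec, dotProduct]
    fun_prop
  have hK : IsCompact K := ((isCompact_stdSimplex ℝ (Fin n)).prod isCompact_Icc).inter_right hclosed
  have hM : 0 ≤ M := Finset.sum_nonneg fun i _ => Finset.sum_nonneg fun j _ => hT0 i j
  have hKne : K.Nonempty := by
    refine ⟨(Pi.single ⟨0, hn⟩ 1, 0), ⟨single_mem_stdSimplex ℝ _, le_rfl, hM⟩, fun i => ?_⟩
    simpa using mulVec_nonneg_of_nonneg hT0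
      (fun j => (single_mem_stdSimplex ℝ (⟨0, hn⟩ : Fin n)).1 j) i
  obtain ⟨⟨x, r⟩, ⟨⟨hx, hr0, hrM⟩, hxr⟩, hmax⟩ := hK.exists_isMaxOn hKne continuous_snd.continuousOn
  have hxne : ∃ j, x j ≠ 0 := by
    by_contra! h
    have := hx.2
    simp [h] at this
  have hTx := hTpos x hx.1 hxne
  have heig : ∀ i, (T *ᵥ x) i = r * x i := by
    by_contra! hne
    obtain ⟨j, hj⟩ := hne
    -- The defect y is nonnegative and nonzero, so T y > 0 everywhere. Replacing x by T x makes the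
    -- inequality strict in every component and leaves room for some r' > r.
    set y : Fin n → ℝ := T *ᵥ x - r • x
    have hTy := hTpos y (fun i => sub_nonneg.2 (hxr i)) ⟨j, sub_ne_zero.2 hj⟩
    obtain ⟨i₀, -, hi₀⟩ := Finset.exists_min_image Finset.univ
      (fun i => (T *ᵥ (T *ᵥ x)) i / (T *ᵥ x) i) Finset.univ_nonempty
    set r' := (T *ᵥ (T *ᵥ x)) i₀ / (T *ᵥ x) i₀ with hr'
    have hrr' : r < r' := by
      rw [hr', lt_div_iff₀ (hTx i₀)]
      have := hTy i₀
      simp only [y, mulVec_sub, mulVec_smul, Pi.sub_apply, Pi.smul_apply, smul_eq_mul] at this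
      linarith
    set s := ∑ i, (T *ᵥ x) i
    have hs : 0 < s := Finset.sum_pos (fun i _ => hTx i) Finset.univ_nonempty
    set x' : Fin n → ℝ := s⁻¹ • (T *ᵥ x)
    have hx' : x' ∈ stdSimplex ℝ (Fin n) := by
      refine ⟨fun i => mul_nonneg (inv_nonneg.2 hs.le) (hTx i).le, ?_⟩
      simp only [x', Pi.smul_apply, smul_eq_mul, ← Finset.mul_sum]
      exact inv_mul_cancel₀ hs.ne'
    have hx'r : ∀ i, r' * x' i ≤ (T *ᵥ x') i := fun i => by
      simp only [x', mulVec_smul, Pi.smul_apply, smul_eq_mul]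
      have := (le_div_iff₀ (hTx i)).1 (hi₀ i (Finset.mem_univ i))
      calc r' * (s⁻¹ * (T *ᵥ x) i) = s⁻¹ * (r' * (T *ᵥ x) i) := by ring
        _ ≤ _ := mul_le_mul_of_nonneg_left this (inv_nonneg.2 hs.le)
    -- Summing over the simplex shows that the cap M in the definition of `K` is never an actual
    -- constraint.
    have hr'M : r' ≤ M := by
      have h1 : ∑ i, r' * x' i ≤ ∑ i, (T *ᵥ x') i := Finset.sum_le_sum fun i _ => hx'r i
      rw [← Finset.mul_sum, hx'.2, mul_one] at h1
      simp only [mulVec, dotProduct] at h1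
      refine h1.trans (Finset.sum_le_sum fun i _ => Finset.sum_le_sum fun j _ => ?_)
      refine mul_le_of_le_one_right (hT0 i j) ?_
      rw [← hx'.2]
      exact Finset.single_le_sum (fun k _ => hx'.1 k) (Finset.mem_univ j)
    have := hmax (show (x', r') ∈ K from ⟨⟨hx', by linarith, hr'M⟩, hx'r⟩)
    simp only [Set.mem_ofPred_eq] at this
    linarith
  obtain ⟨j, hj⟩ := hxne
  have hr : 0 < r := by
    refine hr0.lt_of_ne fun h => ?_
    have h1 := hTx j
    rw [heig j, show r = 0 from h.symm] at h1
    simp at h1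
  exact ⟨r, x, hr, fun i => pos_of_mul_pos_right ((heig i).symm ▸ hTx i) hr.le, heig⟩

/-- The eigenvalue of a positive left eigenvector of a nonnegative matrix is the spectral radius. -/
lemma specRadius_eq_of_pos_eigenvector (hn : 0 < n) {S : Matrix (Fin n) (Fin n) ℝ}
    (hS : ∀ i j, 0 ≤ S i j) {r : ℝ} {l : Fin n → ℝ} (hr : 0 ≤ r) (hl : ∀ i, 0 < l i)
    (h : ∀ i, (Sᵀ *ᵥ l) i = r * l i) : specRadius S = r := by
  have hspec : ∀ k : ℂ, k ∈ spectrum ℂ (S.map Complex.ofReal) ↔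
      (algebraMap ℂ (Matrix (Fin n) (Fin n) ℂ) k - S.map Complex.ofReal).det = 0 := fun k => by
    rw [spectrum.mem_iff, Matrix.isUnit_iff_isUnit_det, isUnit_iff_ne_zero, not_not]
  have hle : ∀ k ∈ spectrum ℂ (S.map Complex.ofReal), ‖k‖ ≤ r := fun k hk => by
    obtain ⟨x, hx0, hx⟩ := Matrix.exists_mulVec_eq_zero_iff.2 ((hspec k).1 hk)
    have hxi : ∀ i, k * x i = ∑ j, (S i j : ℂ) * x j := fun i => by
      have := congrFun hx i
      rw [sub_mulVec, Pi.sub_apply, Pi.zero_apply, sub_eq_zero, Matrix.algebraMap_eq_diagonal] at this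
      simpa [mulVec_diagonal, mulVec, dotProduct, diagonal_apply] using this
    have h1 : ∀ i, ‖k‖ * ‖x i‖ ≤ (S *ᵥ fun j => ‖x j‖) i := fun i => by
      rw [← norm_mul, hxi i]
      refine (norm_sum_le _ _).trans_eq ?_
      simp only [mulVec, dotProduct]
      refine Finset.sum_congr rfl fun j _ => ?_
      rw [norm_mul, Complex.norm_real, Real.norm_of_nonneg (hS i j)]
    -- Pairing |k||x| ≤ S|x| with the positive left eigenvector turns S into the factor r.
    have h2 : ‖k‖ * vecAvg (l * fun j => ‖x j‖) ≤ r * vecAvg (l * fun j => ‖x j‖) := by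
      calc ‖k‖ * vecAvg (l * fun j => ‖x j‖)
          = vecAvg (fun i => l i * (‖k‖ * ‖x i‖)) := by
            rw [← vecAvg_smul]; congr 1; ext i; simp; ring
        _ ≤ vecAvg (l * (S *ᵥ fun j => ‖x j‖)) :=
            vecAvg_mono fun i => mul_le_mul_of_nonneg_left (h1 i) (hl i).le
        _ = vecAvg ((fun j => ‖x j‖) * (Sᵀ *ᵥ l)) := vecAvg_mul_mulVec _ _ _
        _ = r * vecAvg (l * fun j => ‖x j‖) := by
            rw [← vecAvg_smul]; congr 1; ext i; simp [h i]; ring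
    have h3 : 0 < vecAvg (l * fun j => ‖x j‖) := by
      obtain ⟨j, hj⟩ := Function.ne_iff.1 hx0
      refine div_pos (Finset.sum_pos' (fun i _ => mul_nonneg (hl i).le (norm_nonneg _))
        ⟨j, Finset.mem_univ j, mul_pos (hl j) (norm_pos_iff.2 hj)⟩) (by positivity)
    exact le_of_mul_le_mul_right h2 h3
  have hmem : (r : ℂ) ∈ spectrum ℂ (S.map Complex.ofReal) := by
    refine (hspec _).2 (Matrix.exists_vecMul_eq_zero_iff.1 ⟨fun i => (l i : ℂ), ?_, ?_⟩)
    · intro h0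
      have := congrFun h0 ⟨0, hn⟩
      exact (hl ⟨0, hn⟩).ne' (by simpa using this)
    · ext i
      have := h i
      rw [vecMul_sub, Pi.sub_apply, Pi.zero_apply, sub_eq_zero, Matrix.algebraMap_eq_diagonal]
      simp only [mulVec, dotProduct, transpose_apply] at this
      rw [vecMul_diagonal]
      simp only [vecMul, dotProduct, map_apply, Pi.algebraMap_apply,
        Algebra.algebraMap_self, RingHom.id_apply]
      norm_cast
      rw [mul_comm, ← this]
      exact Finset.sum_congr rfl fun j _ => mul_comm _ _
  have : spectralRadius ℂ (S.map Complex.ofReal) = ENNReal.ofReal r := by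
    refine le_antisymm (iSup₂_le fun k hk => ?_) ?_
    · rw [← enorm_eq_nnnorm, ← ofReal_norm]
      exact ENNReal.ofReal_le_ofReal (hle k hk)
    · refine le_trans ?_ (le_iSup₂ (α := ENNReal) (r : ℂ) hmem)
      rw [← enorm_eq_nnnorm, ← ofReal_norm, Complex.norm_real, Real.norm_of_nonneg hr]
  rw [specRadius, this, ENNReal.toReal_ofReal hr]

variable {sLow sUp : ℝ} {S : Matrix (Fin n) (Fin n) ℝ}

lemma IsFlat.exists_left_eigenvector (h : IsFlat sLow sUp S) (hL : 0 < sLow) (hn : 0 < n) :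
    ∃ l : Fin n → ℝ, (∀ i, 0 < l i) ∧ ∀ i, (Sᵀ *ᵥ l) i = specRadius S * l i := by
  obtain ⟨r, l, hr, hl, hrl⟩ := exists_pos_eigenvector hn (T := Sᵀ)
    (fun i j => (by positivity : 0 < sLow / n).trans_le (h j i).1)
  exact ⟨l, hl, (specRadius_eq_of_pos_eigenvector hn (h.entry_nonneg hL) hr.le hl hrl).symm ▸ hrl⟩

lemma IsFlat.specRadius_mem (h : IsFlat sLow sUp S) (hL : 0 < sLow) (hn : 0 < n) :
    specRadius S ∈ Set.Icc sLow sUp := by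
  obtain ⟨l, hl, hrl⟩ := h.exists_left_eigenvector hL hn
  have hl' := vecAvg_pos hn hl
  have e : vecAvg (Sᵀ *ᵥ l) = specRadius S * vecAvg l := by
    rw [← vecAvg_smul]; congr 1; ext i; simp [hrl i]
  have h1 := le_vecAvg hn (h.transpose.mul_vecAvg_le fun i => (hl i).le)
  have h2 := vecAvg_le hn (h.transpose.le_mul_vecAvg fun i => (hl i).le)
  rw [e] at h1 h2
  exact ⟨le_of_mul_le_mul_right h1 hl', le_of_mul_le_mul_right h2 hl'⟩

end Perron

/-! ### A priori bounds and solvability at η = 0 -/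

section TripleBounds

variable {n : ℕ} {sLow sUp : ℝ} {S : Matrix (Fin n) (Fin n) ℝ} {η τ : ℝ} {a b u : Fin n → ℝ}

/-- Pairing the equation for a with the left Perron eigenvector l gives ⟨l a (1 - ρu)⟩ = η⟨l⟩ ≥ 0,
so 1 - ρu cannot be negative everywhere. Since 1/u = τ + ab, this yields ab ≥ ρ - τ at one index. -/
lemma IsDysonTriple.exists_specRadius_mul_u_le (h : IsDysonTriple S η τ a b u)
    (hS : IsFlat sLow sUp S) (hL : 0 < sLow) (hn : 0 < n) (hη : 0 ≤ η) :
    ∃ i, specRadius S * u i ≤ 1 := by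
  obtain ⟨l, hl, hrl⟩ := hS.exists_left_eigenvector hL hn
  by_contra! hlt
  have e1 : vecAvg (l * a) = η * vecAvg l + vecAvg (l * (S *ᵥ (a * u))) := by
    rw [← vecAvg_smul, ← vecAvg_add]; congr 1; ext i
    have := h.eq_a i
    simp only [Pi.mul_apply, Pi.add_apply, Pi.smul_apply, smul_eq_mul] at this ⊢
    linear_combination l i * this
  rw [vecAvg_mul_mulVec] at e1
  have h1 : 0 < vecAvg (a * u * (Sᵀ *ᵥ l) - l * a) := by
    refine vecAvg_pos hn fun i => ?_
    simp only [Pi.sub_apply, Pi.mul_apply, hrl i]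
    have := mul_pos (mul_pos (hl i) (h.pos_a i)) (sub_pos.2 (hlt i))
    linarith
  rw [vecAvg_sub] at h1
  have := mul_nonneg hη (vecAvg_nonneg fun i => (hl i).le)
  linarith

/-- At η = 0 the average ⟨l a (1 - ρu)⟩ vanishes, so 1 - ρu cannot be positive everywhere either.
This controls abu near the spectral edge. -/
lemma IsDysonTriple.exists_le_specRadius_mul_u (h : IsDysonTriple S 0 τ a b u)
    (hS : IsFlat sLow sUp S) (hL : 0 < sLow) (hn : 0 < n) :
    ∃ i, 1 ≤ specRadius S * u i := by
  obtain ⟨l, hl, hrl⟩ := hS.exists_left_eigenvector hL hn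
  by_contra! hlt
  have e1 : vecAvg (l * a) = vecAvg (l * (S *ᵥ (a * u))) := by
    congr 1; ext i
    have := h.eq_a i
    simp only [Pi.mul_apply] at this ⊢
    linear_combination l i * this
  rw [vecAvg_mul_mulVec] at e1
  have h1 : 0 < vecAvg (l * a - a * u * (Sᵀ *ᵥ l)) := by
    refine vecAvg_pos hn fun i => ?_
    simp only [Pi.sub_apply, Pi.mul_apply, hrl i]
    have := mul_pos (mul_pos (hl i) (h.pos_a i)) (sub_pos.2 (hlt i))
    linarith
  rw [vecAvg_sub] at h1
  linarith

lemma IsDysonTriple.avg_pos (h : IsDysonTriple S η τ a b u) (hn : 0 < n) :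
    0 < vecAvg (a * u) :=
  vecAvg_pos hn fun i => mul_pos (h.pos_a i) (h.pos_u i)

/-- The whole vector is governed by the scalar ⟨au⟩; by the normalization the same scalar governs b.
-/
lemma IsDysonTriple.a_mem (h : IsDysonTriple S η τ a b u) (hS : IsFlat sLow sUp S) (i : Fin n) :
    η + sLow * vecAvg (a * u) ≤ a i ∧ a i ≤ η + sUp * vecAvg (a * u) := by
  rw [h.eq_a i]
  have h0 : ∀ i, 0 ≤ (a * u) i := fun i => (mul_pos (h.pos_a i) (h.pos_u i)).le
  exact ⟨by have := hS.mul_vecAvg_le h0 i; linarith, by have := hS.le_mul_vecAvg h0 i; linarith⟩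

lemma IsDysonTriple.b_mem (h : IsDysonTriple S η τ a b u) (hS : IsFlat sLow sUp S) (i : Fin n) :
    η + sLow * vecAvg (a * u) ≤ b i ∧ b i ≤ η + sUp * vecAvg (a * u) := by
  rw [h.eq_b i, h.avg_eq]
  have h0 : ∀ i, 0 ≤ (b * u) i := fun i => (mul_pos (h.pos_b i) (h.pos_u i)).le
  exact ⟨by have := hS.transpose.mul_vecAvg_le h0 i; linarith,
    by have := hS.transpose.le_mul_vecAvg h0 i; linarith⟩

/-- Bounds on the solution, uniform in the dimension, away from the spectral edge. -/
lemma exists_uniform_bounds (hL : 0 < sLow) (hU : sLow < sUp) {γ : ℝ} (hγ : 0 < γ) :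
    ∃ c C η₁ : ℝ, 0 < c ∧ 0 < η₁ ∧ ∀ (n : ℕ) (S : Matrix (Fin n) (Fin n) ℝ), 0 < n →
      IsFlat sLow sUp S → ∀ (η τ : ℝ) (a b u : Fin n → ℝ), 0 ≤ η → η ≤ η₁ → 0 ≤ τ →
      τ + γ ≤ specRadius S → IsDysonTriple S η τ a b u →
      ∀ i, a i ∈ Set.Icc c C ∧ b i ∈ Set.Icc c C ∧ u i ∈ Set.Icc c C := by
  have hU0 : 0 < sUp := hL.trans hU
  set g := Real.sqrt γ with hg
  have hg0 : 0 < g := Real.sqrt_pos.2 hγ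
  have hg2 : g ^ 2 = γ := Real.sq_sqrt hγ.le
  -- At the index where ρu ≤ 1 one has γ ≤ ab ≤ (η + sUp m)². With η ≤ √γ/2 this leaves m ≥ √γ/(2
  -- sUp).
  set m₀ := g / (2 * sUp) with hm₀
  have hm₀p : 0 < m₀ := by positivity
  set c₁ := sLow * m₀
  have hc₁ : 0 < c₁ := by positivity
  set A := g / 2 + sUp / (sLow * m₀) with hA
  have hA0 : 0 < A := by positivity
  set c₂ := 1 / (sUp + A * A) with hc₂
  have hc₂p : 0 < c₂ := by positivity
  refine ⟨min c₁ c₂, max A (1 / (c₁ * c₁)), g / 2, lt_min hc₁ hc₂p, by positivity, ?_⟩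
  intro n S hn hS η τ a b u hη hη₁ hτ hτγ h
  set m := vecAvg (a * u) with hm
  have hmpos : 0 < m := h.avg_pos hn
  have ha := h.a_mem hS
  have hb := h.b_mem hS
  rw [← hm] at ha hb
  have hρ := hS.specRadius_mem hL hn
  have hm₁ : m₀ ≤ m := by
    obtain ⟨i, hi⟩ := h.exists_specRadius_mul_u_le hS hL hn hη
    have hui := h.pos_u i
    have e := h.eq_u i
    have h1 : γ ≤ a i * b i := by
      have : u i * (specRadius S) ≤ u i * (τ + a i * b i) := by linarith
      have := le_of_mul_le_mul_left this hui
      linarith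
    have h2 : γ ≤ (η + sUp * m) ^ 2 := by
      have := mul_le_mul (ha i).2 (hb i).2 (h.pos_b i).le (by positivity)
      nlinarith
    have h3 : g ≤ η + sUp * m := by
      rw [← hg2] at h2
      exact (pow_le_pow_iff_left₀ hg0.le (by positivity) two_ne_zero).1 h2
    rw [hm₀, div_le_iff₀ (by positivity)]
    linarith
  have hal : ∀ i, c₁ ≤ a i := fun i => by
    have := (ha i).1
    have := mul_le_mul_of_nonneg_left hm₁ hL.le
    linarith
  have hbl : ∀ i, c₁ ≤ b i := fun i => by
    have := (hb i).1
    have := mul_le_mul_of_nonneg_left hm₁ hL.le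
    linarith
  -- Since abu ≤ 1 and b ≥ c₁, every component of au is at most 1/c₁.
  have hm₂ : m ≤ 1 / (sLow * m₀) := by
    refine vecAvg_le hn fun i => ?_
    have e := h.eq_u i
    have h1 := h.pos_a i
    have h2 := h.pos_b i
    have h3 := h.pos_u i
    have : a i * u i * b i ≤ 1 := by nlinarith [mul_nonneg h3.le hτ]
    rw [Pi.mul_apply, le_div_iff₀ hc₁]
    exact (mul_le_mul_of_nonneg_left (hbl i) (by positivity)).trans this
  have hup : η + sUp * m ≤ A := by
    have := mul_le_mul_of_nonneg_left hm₂ hU0.le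
    rw [hA]
    have e : sUp * (1 / (sLow * m₀)) = sUp / (sLow * m₀) := by ring
    linarith
  intro i
  have hai := (ha i).2.trans hup
  have hbi := (hb i).2.trans hup
  have e := h.eq_u i
  have hui := h.pos_u i
  have hapos := h.pos_a i
  have hbpos := h.pos_b i
  have hu : u i = 1 / (τ + a i * b i) := by
    rw [eq_div_iff (by positivity)]; exact e
  refine ⟨⟨(min_le_left _ _).trans (hal i), hai.trans (le_max_left _ _)⟩,
    ⟨(min_le_left _ _).trans (hbl i), hbi.trans (le_max_left _ _)⟩,
    (min_le_right _ _).trans ?_, le_trans ?_ (le_max_right _ _)⟩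
  · rw [hu, hc₂]
    refine one_div_le_one_div_of_le (by positivity) (add_le_add (by linarith [hρ.2]) ?_)
    exact mul_le_mul hai hbi hbpos.le hA0.le
  · rw [hu]
    refine one_div_le_one_div_of_le (by positivity) ?_
    have := mul_le_mul (hal i) (hbl i) hc₁.le hapos.le
    linarith

/-- Solvability at `η = 0` below the spectral edge. -/
lemma exists_isDysonTriple_zero (hL : 0 < sLow) (hU : sLow < sUp) (hS : IsFlat sLow sUp S)
    (hn : 0 < n) (hτ : 0 ≤ τ) (hτρ : τ < specRadius S) : ∃ a b u, IsDysonTriple S 0 τ a b u := by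
  obtain ⟨c, C, η₁, hc, hη₁, hbd⟩ := exists_uniform_bounds hL hU (sub_pos.2 hτρ)
  let B : Set (Fin n → ℝ) := Set.univ.pi fun _ => Set.Icc c C
  have hB : IsCompact B := isCompact_univ_pi fun _ => isCompact_Icc
  -- The normalization is imposed as a closed condition of its own: it is automatic only for η ≠ 0
  -- and has to survive the limit. Projecting the compact set of solutions to η gives a closed set
  -- containing (0, η₁), hence 0.
  let E : Set (ℝ × (Fin n → ℝ) × (Fin n → ℝ) × (Fin n → ℝ)) := {q |
    (∀ i, q.2.1 i = q.1 + (S *ᵥ (q.2.1 * q.2.2.2)) i) ∧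
    (∀ i, q.2.2.1 i = q.1 + (Sᵀ *ᵥ (q.2.2.1 * q.2.2.2)) i) ∧
    (∀ i, q.2.2.2 i * (τ + q.2.1 i * q.2.2.1 i) = 1) ∧
    vecAvg (q.2.1 * q.2.2.2) = vecAvg (q.2.2.1 * q.2.2.2)}
  have hE : IsClosed E := by
    simp only [E, vecAvg, mulVec, dotProduct, Pi.mul_apply, Set.ofPred_and, Set.ofPred_forall]
    refine IsClosed.inter (isClosed_iInter fun i => isClosed_eq (by fun_prop) (by fun_prop))
      (IsClosed.inter (isClosed_iInter fun i => isClosed_eq (by fun_prop) (by fun_prop))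
      (IsClosed.inter (isClosed_iInter fun i => isClosed_eq (by fun_prop) (by fun_prop))
      (isClosed_eq (by fun_prop) (by fun_prop))))
  have hK : IsCompact ((Set.Icc 0 η₁ ×ˢ B ×ˢ B ×ˢ B) ∩ E) :=
    (isCompact_Icc.prod (hB.prod (hB.prod hB))).inter_right hE
  have hcl := (hK.image continuous_fst).isClosed
  have h0 : (0 : ℝ) ∈ Prod.fst '' ((Set.Icc 0 η₁ ×ˢ B ×ˢ B ×ˢ B) ∩ E) := by
    have hsub : Set.Ioo 0 η₁ ⊆ Prod.fst '' ((Set.Icc 0 η₁ ×ˢ B ×ˢ B ×ˢ B) ∩ E) := by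
      intro η hη
      obtain ⟨a, b, u, h⟩ := exists_isDysonTriple (hS.entry_nonneg hL) hη.1 hτ
      have hb := hbd n S hn hS η τ a b u hη.1.le hη.2.le hτ (by linarith) h
      exact ⟨(η, a, b, u), ⟨⟨⟨hη.1.le, hη.2.le⟩, fun i _ => (hb i).1, fun i _ => (hb i).2.1,
        fun i _ => (hb i).2.2⟩, h.eq_a, h.eq_b, h.eq_u, h.avg_eq⟩, rfl⟩
    have := closure_minimal hsub hcl
    rw [closure_Ioo hη₁.ne] at this
    exact this ⟨le_rfl, hη₁.le⟩
  obtain ⟨⟨η, a, b, u⟩, ⟨⟨-, h1, h2, h3⟩, h4, h5, h6, h7⟩, rfl⟩ := h0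
  exact ⟨a, b, u, fun i => hc.trans_le (h1 i trivial).1, fun i => hc.trans_le (h2 i trivial).1,
    fun i => hc.trans_le (h3 i trivial).1, h4, h5, h6, h7⟩

end TripleBounds

/-! ### Dimension-free stability of the linearised equation -/

section Stability

variable {n : ℕ} {sLow sUp : ℝ} {S : Matrix (Fin n) (Fin n) ℝ} {η τ : ℝ} {a b u : Fin n → ℝ}

lemma IsDysonTriple.swap (h : IsDysonTriple S η τ a b u) : IsDysonTriple Sᵀ η τ b a u :=
  ⟨h.pos_b, h.pos_a, h.pos_u, h.eq_b, by simpa using h.eq_a,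
    fun i => by rw [mul_comm (b i)]; exact h.eq_u i, h.avg_eq.symm⟩

lemma IsDysonTriple.abu_le_one (h : IsDysonTriple S η τ a b u) (hτ : 0 ≤ τ) (i : Fin n) :
    a i * b i * u i ≤ 1 := by
  have := h.eq_u i
  nlinarith [mul_nonneg (h.pos_u i).le hτ]

/-- Maximum principle for the linearized Dyson equation in logarithmic variables. -/
lemma IsDysonTriple.max_le (h : IsDysonTriple S η τ a b u) (hn : 0 < n)
    (hS : IsFlat sLow sUp S) (hL : 0 < sLow) (hη : 0 ≤ η) (hτ : 0 ≤ τ) {c C : ℝ} (hc : 0 < c)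
    (ha : ∀ i, a i ∈ Set.Icc c C) (hb : ∀ i, b i ∈ Set.Icc c C) (hu : ∀ i, u i ∈ Set.Icc c C)
    {X Y r₁ r₂ r₃ : Fin n → ℝ} {g G R M : ℝ} (hg : |g| ≤ G)
    (hr₁ : ∀ i, |r₁ i| ≤ R) (hr₂ : ∀ i, |r₂ i| ≤ R) (hr₃ : ∀ i, |r₃ i| ≤ R)
    (hX : ∀ i, a i * X i = (S *ᵥ fun j => a j * u j *
      ((1 - a j * b j * u j) * X j + a j * b j * u j * Y j + r₃ j)) i + g + r₁ i)
    (hY : ∀ i, b i * Y i = (Sᵀ *ᵥ fun j => b j * u j *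
      ((1 - a j * b j * u j) * Y j + a j * b j * u j * X j - r₃ j)) i + g + r₂ i)
    (hgeq : g = -vecAvg (fun j => a j * u j *
      ((1 - a j * b j * u j) * X j + a j * b j * u j * Y j + r₃ j)) -
      vecAvg (fun j => b j * u j *
      ((1 - a j * b j * u j) * Y j + a j * b j * u j * X j - r₃ j)))
    (hM : 0 ≤ M) (hXM : ∀ i, X i ≤ M) (hYM : ∀ i, Y i ≤ M) {i₀ : Fin n} (hi₀ : X i₀ = M) :
    2 * c ^ 2 * M ≤ (sUp * C ^ 2 * R + G + R) / sLow + (sUp * C ^ 2 * R + G + R +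
      C * ((sUp * C ^ 2 * R + G + R) / sLow) / c ^ 5) / sLow + G + 2 * C ^ 2 * R := by
  have hC : 0 < C := hc.trans_le ((ha i₀).1.trans (ha i₀).2)
  have hR : 0 ≤ R := (abs_nonneg _).trans (hr₁ i₀)
  have hG : 0 ≤ G := (abs_nonneg _).trans hg
  set E := sUp * C ^ 2 * R + G + R with hE
  have hp1 := h.abu_le_one hτ
  have hp0 : ∀ i, 0 ≤ a i * b i * u i := fun i =>
    (mul_pos (mul_pos (h.pos_a i) (h.pos_b i)) (h.pos_u i)).le
  have hau : ∀ i, 0 < a i * u i := fun i => mul_pos (h.pos_a i) (h.pos_u i)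
  have hbu : ∀ i, 0 < b i * u i := fun i => mul_pos (h.pos_b i) (h.pos_u i)
  have hauC : ∀ i, a i * u i ≤ C ^ 2 := fun i => by
    rw [sq]; exact mul_le_mul (ha i).2 (hu i).2 (h.pos_u i).le hC.le
  have hbuC : ∀ i, b i * u i ≤ C ^ 2 := fun i => by
    rw [sq]; exact mul_le_mul (hb i).2 (hu i).2 (h.pos_u i).le hC.le
  have habs : ∀ {x y K : ℝ}, 0 < y → y ≤ K → |x| ≤ R → |y * x| ≤ K * R := by
    intro x y K hy hyK hx
    rw [abs_mul, abs_of_pos hy]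
    exact mul_le_mul hyK hx (abs_nonneg _) (hy.le.trans hyK)
  -- With p = abu in [0, 1], the unperturbed arguments of S and Sᵗ are au and bu times convex
  -- combinations of X and Y; D₁ and D₂ measure how far these fall short of the maximum M.
  set D₁ : Fin n → ℝ := fun j => a j * u j *
    ((1 - a j * b j * u j) * (M - X j) + a j * b j * u j * (M - Y j)) with hD₁
  set D₂ : Fin n → ℝ := fun j => b j * u j *
    ((1 - a j * b j * u j) * (M - Y j) + a j * b j * u j * (M - X j)) with hD₂
  have hD₁0 : ∀ j, 0 ≤ D₁ j := fun j => mul_nonneg (hau j).le (add_nonneg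
    (mul_nonneg (by linarith [hp1 j]) (by linarith [hXM j]))
    (mul_nonneg (hp0 j) (by linarith [hYM j])))
  have hD₂0 : ∀ j, 0 ≤ D₂ j := fun j => mul_nonneg (hbu j).le (add_nonneg
    (mul_nonneg (by linarith [hp1 j]) (by linarith [hYM j]))
    (mul_nonneg (hp0 j) (by linarith [hXM j])))
  have e₁ : (fun j => a j * u j *
      ((1 - a j * b j * u j) * X j + a j * b j * u j * Y j + r₃ j)) =
      M • (a * u) - D₁ + fun j => a j * u j * r₃ j := by
    ext j; simp [hD₁]; ring
  have e₂ : (fun j => b j * u j *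
      ((1 - a j * b j * u j) * Y j + a j * b j * u j * X j - r₃ j)) =
      M • (b * u) - D₂ - fun j => b j * u j * r₃ j := by
    ext j; simp [hD₂]; ring
  have abs_mulVec : ∀ (T : Matrix (Fin n) (Fin n) ℝ), IsFlat sLow sUp T → ∀ (f : Fin n → ℝ),
      (∀ j, |f j| ≤ C ^ 2 * R) → ∀ i, |(T *ᵥ f) i| ≤ sUp * C ^ 2 * R := by
    intro T hT f hf i
    have h1 : ∀ i, 0 ≤ (fun _ : Fin n => C ^ 2 * R) i := fun i => by positivity
    have h2 := hT.le_mul_vecAvg h1 i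
    rw [vecAvg_const hn] at h2
    have hT0 := hT.entry_nonneg hL
    have h3 := mulVec_mono_of_nonneg hT0 (fun j => (abs_le.1 (hf j)).2) i
    have h4 := mulVec_mono_of_nonneg hT0 (f := fun _ => -(C ^ 2 * R)) (fun j => (abs_le.1 (hf j)).1) i
    have h5 : (T *ᵥ fun _ => -(C ^ 2 * R)) i = -(T *ᵥ fun _ => C ^ 2 * R) i := by
      rw [show (fun _ : Fin n => -(C ^ 2 * R)) = -fun _ => C ^ 2 * R from rfl, mulVec_neg]; rfl
    rw [abs_le]
    constructor <;> linarith
  -- Here M S(au) = M(a - η) ≤ M a, and flatness bounds S D₁ below by sLow⟨D₁⟩. At i₀ the term a(M -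
  -- X) vanishes, so ⟨D₁⟩ is controlled by the error alone.
  have hI : ∀ i, sLow * vecAvg D₁ ≤ a i * (M - X i) + E := fun i => by
    have h1 := hX i
    rw [e₁, mulVec_add, mulVec_sub, mulVec_smul] at h1
    simp only [Pi.add_apply, Pi.sub_apply, Pi.smul_apply, smul_eq_mul] at h1
    have h2 := h.eq_a i
    have h3 := hS.mul_vecAvg_le hD₁0 i
    have h4 := abs_le.1 (abs_mulVec S hS (fun j => a j * u j * r₃ j)
      (fun j => habs (hau j) (hauC j) (hr₃ j)) i)
    have h5 := abs_le.1 hg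
    have h6 := abs_le.1 (hr₁ i)
    have h7 : M * (S *ᵥ (a * u)) i = M * a i - M * η := by rw [h2]; ring
    have h8 := mul_nonneg hM hη
    rw [hE]
    linarith
  have hII : ∀ i, sLow * vecAvg D₂ ≤ b i * (M - Y i) + E := fun i => by
    have h1 := hY i
    rw [e₂, mulVec_sub, mulVec_sub, mulVec_smul] at h1
    simp only [Pi.sub_apply, Pi.smul_apply, smul_eq_mul] at h1
    have h2 := h.eq_b i
    have h3 := hS.transpose.mul_vecAvg_le hD₂0 i
    have h4 := abs_le.1 (abs_mulVec Sᵀ hS.transpose (fun j => b j * u j * r₃ j)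
      (fun j => habs (hbu j) (hbuC j) (hr₃ j)) i)
    have h5 := abs_le.1 hg
    have h6 := abs_le.1 (hr₂ i)
    have h7 : M * (Sᵀ *ᵥ (b * u)) i = M * b i - M * η := by rw [h2]; ring
    have h8 := mul_nonneg hM hη
    rw [hE]
    linarith
  have hE0 : 0 ≤ E := by
    have hUp : 0 ≤ sUp := by
      have := hS i₀ i₀
      have h2 : 0 ≤ sUp / n := ((by positivity : 0 ≤ sLow / n).trans this.1).trans this.2
      by_contra! h3
      have : sUp / n < 0 := div_neg_of_neg_of_pos h3 (by positivity)
      linarith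
    positivity
  have hA₁ : vecAvg D₁ ≤ E / sLow := by
    rw [le_div_iff₀ hL, mul_comm]
    have := hI i₀
    rw [hi₀] at this
    linarith
  -- If ⟨D₂⟩ were large, `hII` would keep M - Y large at every index. But D₁ contains au·abu·(M -
  -- Y), whose prefactor is at least c⁵, and ⟨D₁⟩ is already bounded.
  have hA₂ : vecAvg D₂ ≤ (E + C * (E / sLow) / c ^ 5) / sLow := by
    rw [le_div_iff₀ hL, mul_comm]
    by_cases hcase : sLow * vecAvg D₂ ≤ E
    · have : 0 ≤ C * (E / sLow) / c ^ 5 := by positivity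
      linarith
    · push Not at hcase
      have h1 : ∀ j, c ^ 5 * (sLow * vecAvg D₂ - E) / C ≤ D₁ j := fun j => by
        rw [div_le_iff₀ hC]
        have haup : c ^ 5 ≤ a j * u j * (a j * b j * u j) := by
          have h1 : c * c ≤ a j * u j := mul_le_mul (ha j).1 (hu j).1 hc.le (h.pos_a j).le
          have h2 : c * c * c ≤ a j * b j * u j :=
            mul_le_mul (mul_le_mul (ha j).1 (hb j).1 hc.le (h.pos_a j).le) (hu j).1 hc.le
              (mul_pos (h.pos_a j) (h.pos_b j)).le
          calc c ^ 5 = c * c * (c * c * c) := by ring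
            _ ≤ _ := mul_le_mul h1 h2 (by positivity) (hau j).le
        have h2 : c ^ 5 * (sLow * vecAvg D₂ - E) ≤
            a j * u j * (a j * b j * u j) * (b j * (M - Y j)) :=
          mul_le_mul haup (by linarith [hII j]) (by linarith)
            (mul_nonneg (hau j).le (hp0 j))
        have h3 : a j * u j * (a j * b j * u j) * (M - Y j) ≤ D₁ j := by
          have := mul_nonneg (hau j).le (mul_nonneg (sub_nonneg.2 (hp1 j))
            (sub_nonneg.2 (hXM j)))
          simp only [hD₁]
          linarith
        calc c ^ 5 * (sLow * vecAvg D₂ - E)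
            ≤ a j * u j * (a j * b j * u j) * (b j * (M - Y j)) := h2
          _ = a j * u j * (a j * b j * u j) * (M - Y j) * b j := by ring
          _ ≤ D₁ j * b j := mul_le_mul_of_nonneg_right h3 (h.pos_b j).le
          _ ≤ D₁ j * C := mul_le_mul_of_nonneg_left (hb j).2 (hD₁0 j)
      have h2 := (le_vecAvg hn h1).trans hA₁
      rw [div_le_iff₀ hC] at h2
      have h3 : sLow * vecAvg D₂ - E ≤ C * (E / sLow) / c ^ 5 := by
        rw [le_div_iff₀ (by positivity)]
        linarith
      linarith
  -- Up to the r₃ terms the gauge relation reads g = ⟨D₁⟩ + ⟨D₂⟩ - 2⟨au⟩M. It excludes large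
  -- constant vectors X = Y, which the other equations do not detect at η = 0.
  have hsum : 2 * vecAvg (a * u) * M ≤ vecAvg D₁ + vecAvg D₂ + G + 2 * C ^ 2 * R := by
    rw [e₁, e₂, vecAvg_add, vecAvg_sub, vecAvg_sub, vecAvg_sub, vecAvg_smul, vecAvg_smul,
      ← h.avg_eq] at hgeq
    have h1 := abs_le.1 (abs_vecAvg_le hn fun j => habs (hau j) (hauC j) (hr₃ j))
    have h2 := abs_le.1 (abs_vecAvg_le hn fun j => habs (hbu j) (hbuC j) (hr₃ j))
    have h3 := abs_le.1 hg
    linarith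
  have hm : c ^ 2 ≤ vecAvg (a * u) := le_vecAvg hn fun i => by
    rw [sq]; exact mul_le_mul (ha i).1 (hu i).1 hc.le (h.pos_a i).le
  have := mul_le_mul_of_nonneg_right hm hM
  linarith

/-- The linearization of the normalized Dyson equation is bounded below in the maximum norm,
uniformly in the dimension. -/
lemma exists_stability_bound (hL : 0 < sLow) (hU : sLow < sUp) {c C : ℝ} (hc : 0 < c)
    (hC : 0 < C) :
    ∃ K : ℝ, 0 ≤ K ∧ ∀ (n : ℕ) (S : Matrix (Fin n) (Fin n) ℝ), 0 < n →
      IsFlat sLow sUp S → ∀ (η τ : ℝ) (a b u : Fin n → ℝ), 0 ≤ η → 0 ≤ τ →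
      IsDysonTriple S η τ a b u →
      (∀ i, a i ∈ Set.Icc c C ∧ b i ∈ Set.Icc c C ∧ u i ∈ Set.Icc c C) →
      ∀ (x y w r₁ r₂ r₃ : Fin n → ℝ) (R : ℝ),
      (∀ i, |r₁ i| ≤ R) → (∀ i, |r₂ i| ≤ R) → (∀ i, |r₃ i| ≤ R) →
      (∀ i, x i - ((S *ᵥ (x * u + a * w)) i +
        (vecAvg (y * u + b * w) - vecAvg (x * u + a * w))) = r₁ i) →
      (∀ i, y i - ((Sᵀ *ᵥ (y * u + b * w)) i -
        (vecAvg (y * u + b * w) - vecAvg (x * u + a * w))) = r₂ i) →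
      (∀ i, w i * (τ + a i * b i) + u i * (x i * b i + a i * y i) = r₃ i) →
      ∀ i, |x i| ≤ K * R ∧ |y i| ≤ K * R ∧ |w i| ≤ K * R := by
  have hUp : 0 < sUp := hL.trans hU
  -- Per unit of residual: G bounds the gauge quantity, E the error in the maximum principle, and K₁
  -- the logarithmic variables.
  set G : ℝ := C ^ 2 / c ^ 2 with hG
  set E : ℝ := sUp * C ^ 2 + G + 1 with hE
  set K₁ : ℝ := (E / sLow + (E + C * (E / sLow) / c ^ 5) / sLow + G + 2 * C ^ 2) / (2 * c ^ 2)
    with hK₁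
  have hG0 : 0 ≤ G := by positivity
  have hE0 : 0 ≤ E := by positivity
  have hK₁0 : 0 ≤ K₁ := by positivity
  refine ⟨max (C * K₁) (C * (1 + 2 * K₁)), by positivity, ?_⟩
  intro n S hn hS η τ a b u hη hτ h hbd x y w r₁ r₂ r₃ R hr₁ hr₂ hr₃ h₁ h₂ h₃
  have : Nonempty (Fin n) := ⟨⟨0, hn⟩⟩
  have ha := fun i => (hbd i).1
  have hb := fun i => (hbd i).2.1
  have hu := fun i => (hbd i).2.2
  have hR : 0 ≤ R := (abs_nonneg _).trans (hr₁ ⟨0, hn⟩)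
  set f := x * u + a * w with hf
  set k := y * u + b * w with hk
  set g := vecAvg k - vecAvg f with hg
  set m := vecAvg (a * u) with hm
  have hm2 : c ^ 2 ≤ m := le_vecAvg hn fun i => by
    rw [sq]; exact mul_le_mul (ha i).1 (hu i).1 hc.le (h.pos_a i).le
  -- At η = 0 the pair (bu, -au) spans a left null direction of the ungauged linearisation. Testing
  -- the residuals with it cancels x, y, w and isolates g, which is thereby bounded before the
  -- maximum principle is invoked.
  have hgid : vecAvg (b * u * r₁) - vecAvg (a * u * r₂) = -(η + 2 * m) * g := by
    have t₁ : vecAvg (b * u * r₁) =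
        vecAvg (b * u * x) - vecAvg (f * b) + η * vecAvg f - g * m := by
      have : b * u * r₁ = b * u * x - b * u * (S *ᵥ f) - g • (b * u) := by
        ext i; simp only [Pi.mul_apply, Pi.sub_apply, Pi.smul_apply, smul_eq_mul, ← h₁ i]; ring
      rw [this, vecAvg_sub, vecAvg_sub, vecAvg_smul, vecAvg_mul_mulVec, ← h.avg_eq]
      have : f * (Sᵀ *ᵥ (b * u)) = f * b - η • f := by
        ext i
        simp only [Pi.mul_apply, Pi.sub_apply, Pi.smul_apply, smul_eq_mul]
        linear_combination -f i * h.eq_b i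
      rw [this, vecAvg_sub, vecAvg_smul]
      ring
    have t₂ : vecAvg (a * u * r₂) =
        vecAvg (a * u * y) - vecAvg (k * a) + η * vecAvg k + g * m := by
      have : a * u * r₂ = a * u * y - a * u * (Sᵀ *ᵥ k) + g • (a * u) := by
        ext i; simp only [Pi.mul_apply, Pi.sub_apply, Pi.add_apply, Pi.smul_apply, smul_eq_mul,
          ← h₂ i]; ring
      rw [this, vecAvg_add, vecAvg_sub, vecAvg_smul, vecAvg_mul_mulVec, transpose_transpose]
      have : k * (S *ᵥ (a * u)) = k * a - η • k := by
        ext i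
        simp only [Pi.mul_apply, Pi.sub_apply, Pi.smul_apply, smul_eq_mul]
        linear_combination -k i * h.eq_a i
      rw [this, vecAvg_sub, vecAvg_smul]
      ring
    have t₃ : b * u * x - f * b = a * u * y - k * a := by
      rw [hf, hk]; ring
    have t₄ : vecAvg (b * u * x) - vecAvg (f * b) = vecAvg (a * u * y) - vecAvg (k * a) := by
      rw [← vecAvg_sub, ← vecAvg_sub, t₃]
    rw [t₁, t₂]
    linear_combination t₄ - η * hg
  have hgR : |g| ≤ G * R := by
    have b₁ : |vecAvg (b * u * r₁)| ≤ C ^ 2 * R := abs_vecAvg_le hn fun i => by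
      rw [Pi.mul_apply, Pi.mul_apply, abs_mul, abs_of_pos (mul_pos (h.pos_b i) (h.pos_u i)), sq]
      exact mul_le_mul (mul_le_mul (hb i).2 (hu i).2 (h.pos_u i).le hC.le) (hr₁ i)
        (abs_nonneg _) (by positivity)
    have b₂ : |vecAvg (a * u * r₂)| ≤ C ^ 2 * R := abs_vecAvg_le hn fun i => by
      rw [Pi.mul_apply, Pi.mul_apply, abs_mul, abs_of_pos (mul_pos (h.pos_a i) (h.pos_u i)), sq]
      exact mul_le_mul (mul_le_mul (ha i).2 (hu i).2 (h.pos_u i).le hC.le) (hr₂ i)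
        (abs_nonneg _) (by positivity)
    have b₃ : (η + 2 * m) * |g| ≤ 2 * (C ^ 2 * R) := by
      have : |-(η + 2 * m) * g| = (η + 2 * m) * |g| := by
        rw [abs_mul, abs_neg, abs_of_nonneg (by nlinarith [sq_nonneg c] : 0 ≤ η + 2 * m)]
      rw [← this, ← hgid]
      exact (abs_sub _ _).trans (by linarith)
    have b₄ : c ^ 2 * |g| ≤ C ^ 2 * R := by
      have := mul_le_mul_of_nonneg_right hm2 (abs_nonneg g)
      have := mul_nonneg hη (abs_nonneg g)
      linarith
    rw [hG, div_mul_eq_mul_div, le_div_iff₀ (by positivity)]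
    linarith
  -- With this sign for Y, the scaling a ↦ λa, b ↦ b/λ corresponds to X and Y being the same
  -- constant, and all weights below become nonnegative.
  set X : Fin n → ℝ := fun i => x i / a i with hX
  set Y : Fin n → ℝ := fun i => -(y i / b i) with hY
  have hx : ∀ i, x i = a i * X i := fun i => (mul_div_cancel₀ _ (h.pos_a i).ne').symm
  have hy : ∀ i, y i = -(b i * Y i) := fun i => by
    simp only [hY, mul_neg, neg_neg]; exact (mul_div_cancel₀ _ (h.pos_b i).ne').symm
  have hw : ∀ i, w i = u i * (r₃ i - a i * b i * u i * (X i - Y i)) := fun i => by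
    have e := h₃ i
    rw [hx i, hy i] at e
    linear_combination u i * e - w i * h.eq_u i
  have ef : f = fun j => a j * u j *
      ((1 - a j * b j * u j) * X j + a j * b j * u j * Y j + r₃ j) := by
    ext j
    simp only [hf, Pi.add_apply, Pi.mul_apply]
    rw [hw j, hx j]; ring
  have ek : k = -fun j => b j * u j *
      ((1 - a j * b j * u j) * Y j + a j * b j * u j * X j - r₃ j) := by
    ext j
    simp only [hk, Pi.add_apply, Pi.mul_apply, Pi.neg_apply]
    rw [hw j, hy j]; ring
  have eX : ∀ i, a i * X i = (S *ᵥ fun j => a j * u j *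
      ((1 - a j * b j * u j) * X j + a j * b j * u j * Y j + r₃ j)) i + g + r₁ i := fun i => by
    rw [← ef, ← hx i, ← h₁ i]; ring
  have eY : ∀ i, b i * Y i = (Sᵀ *ᵥ fun j => b j * u j *
      ((1 - a j * b j * u j) * Y j + a j * b j * u j * X j - r₃ j)) i + g + (-r₂) i := fun i => by
    have e := h₂ i
    rw [ek, mulVec_neg, hy i] at e
    simp only [Pi.neg_apply] at e ⊢
    linarith
  have eg : g = -vecAvg (fun j => a j * u j *
      ((1 - a j * b j * u j) * X j + a j * b j * u j * Y j + r₃ j)) -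
      vecAvg (fun j => b j * u j *
      ((1 - a j * b j * u j) * Y j + a j * b j * u j * X j - r₃ j)) := by
    rw [← ef, hg, ek, vecAvg_neg]; ring
  have upper : ∀ (X Y r₁ r₂ r₃ : Fin n → ℝ) (g : ℝ), |g| ≤ G * R →
      (∀ i, |r₁ i| ≤ R) → (∀ i, |r₂ i| ≤ R) → (∀ i, |r₃ i| ≤ R) →
      (∀ i, a i * X i = (S *ᵥ fun j => a j * u j *
      ((1 - a j * b j * u j) * X j + a j * b j * u j * Y j + r₃ j)) i + g + r₁ i) →
      (∀ i, b i * Y i = (Sᵀ *ᵥ fun j => b j * u j *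
      ((1 - a j * b j * u j) * Y j + a j * b j * u j * X j - r₃ j)) i + g + r₂ i) →
      (g = -vecAvg (fun j => a j * u j *
      ((1 - a j * b j * u j) * X j + a j * b j * u j * Y j + r₃ j)) -
      vecAvg (fun j => b j * u j *
      ((1 - a j * b j * u j) * Y j + a j * b j * u j * X j - r₃ j))) →
      ∀ i, X i ≤ K₁ * R ∧ Y i ≤ K₁ * R := by
    clear_value g
    intro X Y r₁ r₂ r₃ g hgR hr₁ hr₂ hr₃ eX eY eg
    obtain ⟨i₀, -, hi₀⟩ := Finset.exists_max_image Finset.univ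
      (fun i => max (X i) (Y i)) Finset.univ_nonempty
    set M := max (X i₀) (Y i₀) with hM
    have hXM : ∀ i, X i ≤ M := fun i => (le_max_left _ _).trans (hi₀ i (Finset.mem_univ i))
    have hYM : ∀ i, Y i ≤ M := fun i => (le_max_right _ _).trans (hi₀ i (Finset.mem_univ i))
    suffices hMK : M ≤ K₁ * R from fun i => ⟨(hXM i).trans hMK, (hYM i).trans hMK⟩
    rcases le_total M 0 with hM0 | hM0
    · exact hM0.trans (by positivity)
    have hfin : 2 * c ^ 2 * M ≤ (sUp * C ^ 2 * R + G * R + R) / sLow + (sUp * C ^ 2 * R + G * R + R +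
        C * ((sUp * C ^ 2 * R + G * R + R) / sLow) / c ^ 5) / sLow + G * R + 2 * C ^ 2 * R := by
      rcases max_choice (X i₀) (Y i₀) with hc' | hc'
      · exact h.max_le hn hS hL hη hτ hc ha hb hu hgR hr₁ hr₂ hr₃ eX eY eg hM0 hXM hYM
          (hc'.symm.trans hM.symm)
      -- If Y attains the maximum, transposition exchanges X with Y and r₁ with r₂, and reverses the
      -- sign of r₃.
      · refine h.swap.max_le hn hS.transpose hL hη hτ hc hb ha hu (X := Y) (Y := X)
          (r₃ := -r₃) hgR hr₂ hr₁ (fun i => by simpa using hr₃ i) ?_ ?_ ?_ hM0 hYM hXM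
          (hc'.symm.trans hM.symm)
        · intro i
          rw [eY i]
          simp only [mul_comm (b _) (a _), Pi.neg_apply, ← sub_eq_add_neg]
        · intro i
          rw [eX i]
          simp only [mul_comm (b _) (a _), Pi.neg_apply, sub_neg_eq_add, transpose_transpose]
        · rw [eg]
          simp only [mul_comm (b _) (a _), Pi.neg_apply, sub_neg_eq_add, ← sub_eq_add_neg]
          ring
    rw [hK₁, div_mul_eq_mul_div, le_div_iff₀ (by positivity)]
    calc M * (2 * c ^ 2) = 2 * c ^ 2 * M := by ring
      _ ≤ _ := hfin
      _ = _ := by rw [hE]; ring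
  have hXY := upper X Y r₁ (-r₂) r₃ g hgR hr₁ (fun i => by simpa using hr₂ i) hr₃ eX eY eg
  have hneg₁ : (fun j => a j * u j * ((1 - a j * b j * u j) * (-X) j +
      a j * b j * u j * (-Y) j + (-r₃) j)) = -fun j => a j * u j *
      ((1 - a j * b j * u j) * X j + a j * b j * u j * Y j + r₃ j) := by
    ext j; simp only [Pi.neg_apply]; ring
  have hneg₂ : (fun j => b j * u j * ((1 - a j * b j * u j) * (-Y) j +
      a j * b j * u j * (-X) j - (-r₃) j)) = -fun j => b j * u j *
      ((1 - a j * b j * u j) * Y j + a j * b j * u j * X j - r₃ j) := by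
    ext j; simp only [Pi.neg_apply]; ring
  have hXY' := upper (-X) (-Y) (-r₁) r₂ (-r₃) (-g) (by simpa using hgR)
    (fun i => by simpa using hr₁ i) hr₂ (fun i => by simpa using hr₃ i)
    (fun i => by
      rw [hneg₁, mulVec_neg]
      have := eX i
      simp only [Pi.neg_apply]; linarith)
    (fun i => by
      rw [hneg₂, mulVec_neg]
      have := eY i
      simp only [Pi.neg_apply] at this ⊢; linarith)
    (by rw [hneg₁, hneg₂, vecAvg_neg, vecAvg_neg]; linarith)
  intro i
  have hXi : |X i| ≤ K₁ * R := abs_le.2 ⟨by have := (hXY' i).1; simp only [Pi.neg_apply] at this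
                                            linarith, (hXY i).1⟩
  have hYi : |Y i| ≤ K₁ * R := abs_le.2 ⟨by have := (hXY' i).2; simp only [Pi.neg_apply] at this
                                            linarith, (hXY i).2⟩
  have hmax₁ := mul_le_mul_of_nonneg_right (le_max_left (C * K₁) (C * (1 + 2 * K₁))) hR
  have hmax₂ := mul_le_mul_of_nonneg_right (le_max_right (C * K₁) (C * (1 + 2 * K₁))) hR
  refine ⟨?_, ?_, ?_⟩
  · rw [hx i, abs_mul, abs_of_pos (h.pos_a i)]
    refine (mul_le_mul (ha i).2 hXi (abs_nonneg _) hC.le).trans ?_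
    linarith
  · rw [hy i, abs_neg, abs_mul, abs_of_pos (h.pos_b i)]
    refine (mul_le_mul (hb i).2 hYi (abs_nonneg _) hC.le).trans ?_
    linarith
  · rw [hw i, abs_mul, abs_of_pos (h.pos_u i)]
    have hin : |r₃ i - a i * b i * u i * (X i - Y i)| ≤ R + 2 * (K₁ * R) := by
      refine (abs_sub _ _).trans (add_le_add (hr₃ i) ?_)
      rw [abs_mul, abs_of_pos (mul_pos (mul_pos (h.pos_a i) (h.pos_b i)) (h.pos_u i))]
      have := (abs_sub (X i) (Y i)).trans (add_le_add hXi hYi)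
      calc a i * b i * u i * |X i - Y i| ≤ 1 * |X i - Y i| :=
            mul_le_mul_of_nonneg_right (h.abu_le_one hτ i) (abs_nonneg _)
        _ ≤ 2 * (K₁ * R) := by linarith
    refine (mul_le_mul (hu i).2 hin (abs_nonneg _) hC.le).trans ?_
    linarith

end Stability

open scoped BoundedContinuousFunction

/-! ### The gauged equation in a commutative Banach algebra -/

section Residual

variable {A : Type*} [NormedCommRing A] [NormedAlgebra ℝ A]

/-- The residual of the normalized Dyson equation `a = e + d (S (a u) + g)`,
`b = e + d (Sᵗ (b u) - g)`, `u (d |z + h|² + a b) = 1`, where `g = ⟨b u⟩ - ⟨a u⟩`. -/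
def dysonResidual (T T' J : A →L[ℝ] A) (x₀ y₀ : A)
    (q : (ℝ × ℝ × ℂ) × A × A × A) :
    A × A × A :=
  (q.2.1 - q.1.1 • 1 - q.1.2.1 • (T (q.2.1 * q.2.2.2) +
      (J (q.2.2.1 * q.2.2.2) - J (q.2.1 * q.2.2.2))),
   q.2.2.1 - q.1.1 • 1 - q.1.2.1 • (T' (q.2.2.1 * q.2.2.2) -
      (J (q.2.2.1 * q.2.2.2) - J (q.2.1 * q.2.2.2))),
   q.2.2.2 * (q.1.2.1 • ((x₀ + Complex.reCLM q.1.2.2 • 1) * (x₀ + Complex.reCLM q.1.2.2 • 1) +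
      (y₀ + Complex.imCLM q.1.2.2 • 1) * (y₀ + Complex.imCLM q.1.2.2 • 1)) +
      q.2.1 * q.2.2.1) - 1)

lemma contDiff_dysonResidual (T T' J : A →L[ℝ] A) (x₀ y₀ : A) :
    ContDiff ℝ ω (dysonResidual T T' J x₀ y₀) := by
  unfold dysonResidual
  fun_prop

lemma exists_hasFDerivAt_dysonResidual (T T' J : A →L[ℝ] A) (x₀ y₀ : A)
    (p : ℝ × ℝ × ℂ) (a b u : A) :
    ∃ L : (A × A × A) →L[ℝ]
        (A × A × A),
      HasFDerivAt (fun v => dysonResidual T T' J x₀ y₀ (p, v)) L (a, b, u) ∧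
      ∀ x y w, L (x, y, w) =
        (x - p.2.1 • (T (x * u + a * w) + (J (y * u + b * w) - J (x * u + a * w))),
         y - p.2.1 • (T' (y * u + b * w) - (J (y * u + b * w) - J (x * u + a * w))),
         w * (p.2.1 • ((x₀ + p.2.2.re • 1) * (x₀ + p.2.2.re • 1) +
          (y₀ + p.2.2.im • 1) * (y₀ + p.2.2.im • 1)) + a * b) + u * (x * b + a * y)) := by
  unfold dysonResidual
  have hA : HasFDerivAt (fun v : A × A × A => v.1)
    (ContinuousLinearMap.fst ℝ _ _) (a, b, u) := hasFDerivAt_fst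
  have hB : HasFDerivAt (fun v : A × A × A => v.2.1)
    ((ContinuousLinearMap.fst ℝ _ _).comp (ContinuousLinearMap.snd ℝ _ _)) (a, b, u) :=
    hasFDerivAt_fst.comp _ hasFDerivAt_snd
  have hU : HasFDerivAt (fun v : A × A × A => v.2.2)
    ((ContinuousLinearMap.snd ℝ _ _).comp (ContinuousLinearMap.snd ℝ _ _)) (a, b, u) :=
    hasFDerivAt_snd.comp _ hasFDerivAt_snd
  have hAU := hA.mul hU
  have hBU := hB.mul hU
  have hJ := (J.hasFDerivAt.comp _ hBU).sub (J.hasFDerivAt.comp _ hAU)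
  have key := ((hA.sub_const (p.1 • 1)).sub
    (((T.hasFDerivAt.comp _ hAU).add hJ).const_smul p.2.1)).prodMk
    (((hB.sub_const (p.1 • 1)).sub (((T'.hasFDerivAt.comp _ hBU).sub hJ).const_smul p.2.1)).prodMk
    ((hU.mul ((hA.mul hB).const_add (p.2.1 •
      ((x₀ + Complex.reCLM p.2.2 • 1) * (x₀ + Complex.reCLM p.2.2 • 1) +
      (y₀ + Complex.imCLM p.2.2 • 1) * (y₀ + Complex.imCLM p.2.2 • 1))))).sub_const 1))
  refine ⟨_, key, fun x y w => ?_⟩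
  simp only [ContinuousLinearMap.prod_apply, _root_.sub_apply, _root_.add_apply, _root_.smul_apply,
    ContinuousLinearMap.comp_apply, ContinuousLinearMap.coe_fst', ContinuousLinearMap.coe_snd',
    map_add, smul_eq_mul, Pi.mul_apply, mul_comm u x, mul_comm u y, Complex.reCLM_apply, Complex.imCLM_apply]
  refine Prod.ext ?_ (Prod.ext ?_ ?_)
  · dsimp only; module
  · dsimp only; module
  · dsimp only; ring

end Residual

/-- The Banach algebra of bounded families of vectors, with one component for each index. -/
abbrev BddFamily {ι : Type} (N : ι → ℕ) : Type := (Σ i, Fin (N i)) →ᵇ ℝ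

/-! ### Bounded families of vectors and fibrewise operators -/

namespace BddFamily

variable {ι : Type} {N : ι → ℕ}

/-- A uniformly bounded family of vectors as an element of `BddFamily N`. -/
def mk (f : ∀ i, Fin (N i) → ℝ) (C : ℝ) (h : ∀ i k, |f i k| ≤ C) : BddFamily N :=
  BoundedContinuousFunction.ofNormedAddCommGroupDiscrete (fun j => f j.1 j.2) C fun j => h j.1 j.2

@[simp] lemma mk_apply (f : ∀ i, Fin (N i) → ℝ) (C : ℝ) (h : ∀ i k, |f i k| ≤ C) (i : ι)
    (k : Fin (N i)) : mk f C h ⟨i, k⟩ = f i k := rfl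

/-- The component of a family at an index. -/
def fiber (i : ι) (f : BddFamily N) : Fin (N i) → ℝ := fun k => f ⟨i, k⟩

@[simp] lemma fiber_apply (i : ι) (f : BddFamily N) (k : Fin (N i)) : fiber i f k = f ⟨i, k⟩ := rfl
lemma fiber_add (i : ι) (f g : BddFamily N) : fiber i (f + g) = fiber i f + fiber i g := rfl
lemma fiber_mul (i : ι) (f g : BddFamily N) : fiber i (f * g) = fiber i f * fiber i g := rfl
lemma fiber_smul (i : ι) (c : ℝ) (f : BddFamily N) : fiber i (c • f) = c • fiber i f := rfl

lemma ext_fiber {f g : BddFamily N} (h : ∀ i, fiber i f = fiber i g) : f = g :=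
  BoundedContinuousFunction.ext fun ⟨i, k⟩ => congrFun (h i) k

lemma norm_fiber_le (i : ι) (f : BddFamily N) : ‖fiber i f‖ ≤ ‖f‖ :=
  (pi_norm_le_iff_of_nonneg (norm_nonneg f)).2 fun k => f.norm_coe_le_norm ⟨i, k⟩

/-- A uniformly bounded family of matrices acts on bounded families of vectors. -/
def blockOp (M : ∀ i, Matrix (Fin (N i)) (Fin (N i)) ℝ) (K : ℝ) (hK : 0 ≤ K)
    (hM : ∀ i k, ∑ l, |M i k l| ≤ K) : BddFamily N →L[ℝ] BddFamily N :=
  have bound : ∀ (f : BddFamily N) i k, |(M i *ᵥ fiber i f) k| ≤ K * ‖f‖ := fun f i k => by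
    simp only [mulVec, dotProduct]
    refine (Finset.abs_sum_le_sum_abs _ _).trans ?_
    calc ∑ l, |M i k l * fiber i f l| ≤ ∑ l, |M i k l| * ‖f‖ :=
          Finset.sum_le_sum fun l _ => by
            rw [abs_mul]
            exact mul_le_mul_of_nonneg_left (f.norm_coe_le_norm ⟨i, l⟩) (abs_nonneg _)
      _ ≤ K * ‖f‖ := by
          rw [← Finset.sum_mul]
          exact mul_le_mul_of_nonneg_right (hM i k) (norm_nonneg f)
  LinearMap.mkContinuous
    { toFun := fun f => mk (fun i => M i *ᵥ fiber i f) (K * ‖f‖) (bound f)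
      map_add' := fun f g => ext_fiber fun i =>
        funext fun k => congrFun (mulVec_add (M i) (fiber i f) (fiber i g)) k
      map_smul' := fun c f => ext_fiber fun i =>
        funext fun k => congrFun (mulVec_smul (M i) c (fiber i f)) k }
    K fun f => (BoundedContinuousFunction.norm_le (by positivity)).2 fun j => bound f j.1 j.2

@[simp] lemma fiber_blockOp (M : ∀ i, Matrix (Fin (N i)) (Fin (N i)) ℝ) (K : ℝ) (hK : 0 ≤ K)
    (hM : ∀ i k, ∑ l, |M i k l| ≤ K) (f : BddFamily N) (i : ι) :
    fiber i (blockOp M K hK hM f) = M i *ᵥ fiber i f := rfl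

/-- The componentwise average. -/
def avgOp (N : ι → ℕ) : BddFamily N →L[ℝ] BddFamily N :=
  blockOp (fun i => Matrix.of fun _ _ => 1 / (N i : ℝ)) 1 zero_le_one fun i k => by
    have : 0 < N i := k.pos
    simp [this.ne']

lemma fiber_avgOp (f : BddFamily N) (i : ι) :
    fiber i (avgOp N f) = fun _ => vecAvg (fiber i f) := by
  ext k
  rw [avgOp, fiber_blockOp]
  simp [mulVec, dotProduct, vecAvg, ← Finset.mul_sum]
  ring

/-- The average of the component at an index. -/
def avgAt (i : ι) : BddFamily N →L[ℝ] ℝ :=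
  LinearMap.mkContinuous
    { toFun := fun f => vecAvg (fiber i f)
      map_add' := fun f g => vecAvg_add (fiber i f) (fiber i g)
      map_smul' := fun c f => vecAvg_smul c (fiber i f) } 1 fun f => by
    rw [one_mul]
    rcases Nat.eq_zero_or_pos (N i) with h | h
    · have : vecAvg (fiber i f) = 0 := by simp [vecAvg, h]
      change |vecAvg (fiber i f)| ≤ ‖f‖
      rw [this, abs_zero]
      exact norm_nonneg f
    · exact abs_vecAvg_le h fun k => f.norm_coe_le_norm ⟨i, k⟩

@[simp] lemma avgAt_apply (i : ι) (f : BddFamily N) : avgAt i f = vecAvg (fiber i f) := rfl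

lemma norm_avgAt_le (i : ι) : ‖avgAt (N := N) i‖ ≤ 1 :=
  LinearMap.mkContinuous_norm_le _ zero_le_one _

/-- The component at an index, as a continuous linear map. -/
def fiberL (i : ι) : BddFamily N →L[ℝ] (Fin (N i) → ℝ) :=
  LinearMap.mkContinuous
    { toFun := fiber i, map_add' := fiber_add i, map_smul' := fiber_smul i } 1 fun f => by
    rw [one_mul]; exact norm_fiber_le i f

@[simp] lemma fiberL_apply (i : ι) (f : BddFamily N) : fiberL i f = fiber i f := rfl

end BddFamily

/-! ### The gauged equation in a single fibre -/

section Fiberwise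

variable {n : ℕ}

/-- The linearization of the normalized Dyson equation in one fiber. -/
def linDyson (T : Matrix (Fin n) (Fin n) ℝ) (d τ : ℝ) (a b u : Fin n → ℝ) :
    ((Fin n → ℝ) × (Fin n → ℝ) × (Fin n → ℝ)) →ₗ[ℝ]
      ((Fin n → ℝ) × (Fin n → ℝ) × (Fin n → ℝ)) where
  toFun q :=
    (fun i => q.1 i - ((T *ᵥ (q.1 * u + a * q.2.2)) i +
        d * (vecAvg (q.2.1 * u + b * q.2.2) - vecAvg (q.1 * u + a * q.2.2))),
     fun i => q.2.1 i - ((Tᵀ *ᵥ (q.2.1 * u + b * q.2.2)) i -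
        d * (vecAvg (q.2.1 * u + b * q.2.2) - vecAvg (q.1 * u + a * q.2.2))),
     fun i => q.2.2 i * (τ + a i * b i) + u i * (q.1 i * b i + a i * q.2.1 i))
  map_add' := by
    rintro ⟨x, y, w⟩ ⟨x', y', w'⟩
    have e₁ : (x + x') * u + a * (w + w') = (x * u + a * w) + (x' * u + a * w') := by ring
    have e₂ : (y + y') * u + b * (w + w') = (y * u + b * w) + (y' * u + b * w') := by ring
    simp only [Prod.mk_add_mk]
    rw [e₁, e₂]
    simp only [mulVec_add, vecAvg_add]
    refine Prod.ext (funext fun i => ?_) (Prod.ext (funext fun i => ?_) (funext fun i => ?_)) <;>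
    · simp only [Pi.add_apply]; ring
  map_smul' := by
    rintro c ⟨x, y, w⟩
    have e₁ : (c • x) * u + a * (c • w) = c • (x * u + a * w) := by
      ext i; simp; ring
    have e₂ : (c • y) * u + b * (c • w) = c • (y * u + b * w) := by
      ext i; simp; ring
    simp only [Prod.smul_mk]
    rw [e₁, e₂]
    simp only [mulVec_smul, vecAvg_smul, RingHom.id_apply]
    refine Prod.ext (funext fun i => ?_) (Prod.ext (funext fun i => ?_) (funext fun i => ?_)) <;>
    · simp only [Pi.smul_apply, smul_eq_mul]; ring

/-- Testing the two equations with bu and au and using duality gives g(e + d(⟨bu⟩ + ⟨au⟩)) = 0. The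
second factor is positive, so the added gauge term vanishes and creates no spurious positive
solutions. -/
lemma IsDysonTriple.of_augmented {T : Matrix (Fin n) (Fin n) ℝ} {e d τ : ℝ} {a b u : Fin n → ℝ}
    (hn : 0 < n) (he : 0 ≤ e) (hd : 0 < d) (ha0 : ∀ i, 0 < a i) (hb0 : ∀ i, 0 < b i)
    (hu0 : ∀ i, 0 < u i)
    (ha : ∀ i, a i = e + ((T *ᵥ (a * u)) i + d * (vecAvg (b * u) - vecAvg (a * u))))
    (hb : ∀ i, b i = e + ((Tᵀ *ᵥ (b * u)) i - d * (vecAvg (b * u) - vecAvg (a * u))))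
    (hu : ∀ i, u i * (τ + a i * b i) = 1) : IsDysonTriple T e τ a b u := by
  set g := vecAvg (b * u) - vecAvg (a * u) with hg
  have h1 : vecAvg (b * u * a) = (e + d * g) * vecAvg (b * u) + vecAvg (b * u * (T *ᵥ (a * u))) := by
    rw [← vecAvg_smul, ← vecAvg_add]; congr 1; ext i
    simp only [Pi.mul_apply, Pi.add_apply, Pi.smul_apply, smul_eq_mul]
    linear_combination b i * u i * ha i
  have h2 : vecAvg (a * u * b) = (e - d * g) * vecAvg (a * u) +
      vecAvg (a * u * (Tᵀ *ᵥ (b * u))) := by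
    rw [← vecAvg_smul, ← vecAvg_add]; congr 1; ext i
    simp only [Pi.mul_apply, Pi.add_apply, Pi.smul_apply, smul_eq_mul]
    linear_combination a i * u i * hb i
  rw [vecAvg_mul_mulVec, show b * u * a = a * u * b by ring] at h1
  have h3 : g * (e + d * (vecAvg (b * u) + vecAvg (a * u))) = 0 := by
    linear_combination h2 - h1 + e * hg
  have p1 : 0 < vecAvg (b * u) := vecAvg_pos hn fun i => mul_pos (hb0 i) (hu0 i)
  have p2 : 0 < vecAvg (a * u) := vecAvg_pos hn fun i => mul_pos (ha0 i) (hu0 i)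
  have hg0 : g = 0 := (mul_eq_zero.1 h3).resolve_right (by positivity)
  rw [hg0] at ha hb
  exact ⟨ha0, hb0, hu0, by simpa using ha, by simpa using hb, hu, by linarith⟩

end Fiberwise

/-! ### Implicit function theorem for all fibres at once -/

namespace BddFamily

variable {ι : Type} {N : ι → ℕ}

/-- The action of `S i` on the fiber over `i`. -/
def flatOp (S : ∀ i, Matrix (Fin (N i)) (Fin (N i)) ℝ) {sLow sUp : ℝ} (hL : 0 < sLow)
    (hU : sLow < sUp) (hS : ∀ i, IsFlat sLow sUp (S i)) : BddFamily N →L[ℝ] BddFamily N :=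
  blockOp S sUp (hL.trans hU).le fun i k => by
    have hN : 0 < N i := k.pos
    calc ∑ l, |S i k l| ≤ ∑ _l : Fin (N i), sUp / N i := Finset.sum_le_sum fun l _ => by
          rw [abs_of_nonneg ((hS i).entry_nonneg hL k l)]
          exact (hS i k l).2
      _ = sUp := by
          have : (N i : ℝ) ≠ 0 := by positivity
          simp; field_simp

/-- Implicit function theorem for families of Dyson equations, uniformly in the dimension. -/
theorem exists_smooth_branch {sLow sUp : ℝ} (hL : 0 < sLow) (hU : sLow < sUp)
    (hN : ∀ i, 0 < N i) (S : ∀ i, Matrix (Fin (N i)) (Fin (N i)) ℝ)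
    (hS : ∀ i, IsFlat sLow sUp (S i)) (z : ι → ℂ) {Z c C K e₀ d₀ : ℝ} (hZ : ∀ i, ‖z i‖ ≤ Z)
    (hc : 0 < c) (a b u : ∀ i, Fin (N i) → ℝ)
    (hbase : ∀ i, IsDysonTriple (d₀ • S i) e₀ (d₀ * ‖z i‖ ^ 2) (a i) (b i) (u i))
    (hbd : ∀ i k, a i k ∈ Set.Icc c C ∧ b i k ∈ Set.Icc c C ∧ u i k ∈ Set.Icc c C)
    (hK : 0 ≤ K) (hstab : ∀ i q, ‖q‖ ≤
      K * ‖linDyson (d₀ • S i) d₀ (d₀ * ‖z i‖ ^ 2) (a i) (b i) (u i) q‖) :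
    ∃ φ : ℝ × ℝ × ℂ → BddFamily N × BddFamily N × BddFamily N,
      ContDiffAt ℝ ω φ (e₀, d₀, 0) ∧
      (∀ i, fiber i (φ (e₀, d₀, 0)).1 = a i ∧ fiber i (φ (e₀, d₀, 0)).2.1 = b i ∧
        fiber i (φ (e₀, d₀, 0)).2.2 = u i) ∧
      ∀ᶠ p in nhds ((e₀, d₀, 0) : ℝ × ℝ × ℂ), 0 ≤ p.1 → 0 < p.2.1 → ∀ i,
        IsDysonTriple (p.2.1 • S i) p.1 (p.2.1 * ‖z i + p.2.2‖ ^ 2)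
          (fiber i (φ p).1) (fiber i (φ p).2.1) (fiber i (φ p).2.2) := by
  have habs : ∀ {x : ℝ}, x ∈ Set.Icc c C → |x| ≤ C := fun hx => by
    rw [abs_of_pos (hc.trans_le hx.1)]; exact hx.2
  set A₀ : BddFamily N := mk a C fun i k => habs (hbd i k).1 with hA₀
  set B₀ : BddFamily N := mk b C fun i k => habs (hbd i k).2.1 with hB₀
  set U₀ : BddFamily N := mk u C fun i k => habs (hbd i k).2.2 with hU₀
  set x₀ : BddFamily N := mk (fun i _ => (z i).re) Z
    fun i _ => (Complex.abs_re_le_norm _).trans (hZ i) with hx₀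
  set y₀ : BddFamily N := mk (fun i _ => (z i).im) Z
    fun i _ => (Complex.abs_im_le_norm _).trans (hZ i) with hy₀
  set T := flatOp S hL hU hS with hT
  set T' := flatOp (fun i => (S i)ᵀ) hL hU (fun i => (hS i).transpose) with hT'
  set J := avgOp N with hJ
  set F := dysonResidual T T' J x₀ y₀ with hF
  set p₀ : ℝ × ℝ × ℂ := (e₀, d₀, 0) with hp₀
  have fτ : ∀ (d : ℝ) (h : ℂ) i k, (d • ((x₀ + h.re • (1 : BddFamily N)) * (x₀ + h.re • 1) +
      (y₀ + h.im • 1) * (y₀ + h.im • 1))) ⟨i, k⟩ = d * ‖z i + h‖ ^ 2 := fun d h i k => by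
    rw [Complex.sq_norm, Complex.normSq_apply]
    simp [hx₀, hy₀]
    ring
  have hF0 : F (p₀, A₀, B₀, U₀) = 0 := by
    refine Prod.ext (ext_fiber fun i => funext fun k => ?_) (Prod.ext
      (ext_fiber fun i => funext fun k => ?_) (ext_fiber fun i => funext fun k => ?_))
    · have h1 := (hbase i).eq_a k
      have h2 := (hbase i).avg_eq
      have : fiber i (F (p₀, A₀, B₀, U₀)).1 k = a i k - e₀ * 1 - d₀ * ((S i *ᵥ (a i * u i)) k +
          (fiber i (J (B₀ * U₀)) k - fiber i (J (A₀ * U₀)) k)) := rfl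
      rw [this, fiber_avgOp, fiber_avgOp]
      have h3 : vecAvg (fiber i (B₀ * U₀)) = vecAvg (fiber i (A₀ * U₀)) := h2.symm
      rw [smul_mulVec, Pi.smul_apply, smul_eq_mul] at h1
      rw [h3, h1]
      change _ = (0 : ℝ)
      ring
    · have h1 := (hbase i).eq_b k
      have h2 := (hbase i).avg_eq
      have : fiber i (F (p₀, A₀, B₀, U₀)).2.1 k = b i k - e₀ * 1 -
          d₀ * (((S i)ᵀ *ᵥ (b i * u i)) k -
          (fiber i (J (B₀ * U₀)) k - fiber i (J (A₀ * U₀)) k)) := rfl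
      rw [this, fiber_avgOp, fiber_avgOp]
      have h3 : vecAvg (fiber i (B₀ * U₀)) = vecAvg (fiber i (A₀ * U₀)) := h2.symm
      rw [transpose_smul, smul_mulVec, Pi.smul_apply, smul_eq_mul] at h1
      rw [h3, h1]
      change _ = (0 : ℝ)
      ring
    · have h1 := (hbase i).eq_u k
      have h2 := fτ d₀ 0 i k
      rw [add_zero] at h2
      rw [← h2] at h1
      exact sub_eq_zero.2 h1
  obtain ⟨L, hLd, hLeq⟩ := exists_hasFDerivAt_dysonResidual T T' J x₀ y₀ p₀ A₀ B₀ U₀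
  -- The Fréchet derivative acts fibre by fibre, so the stability bound with common K applies to it
  -- directly.
  have hLfib : ∀ (v : BddFamily N × BddFamily N × BddFamily N) i,
      (fiber i (L v).1, fiber i (L v).2.1, fiber i (L v).2.2) =
      linDyson (d₀ • S i) d₀ (d₀ * ‖z i‖ ^ 2) (a i) (b i) (u i)
        (fiber i v.1, fiber i v.2.1, fiber i v.2.2) := by
    rintro ⟨x, y, w⟩ i
    rw [hLeq]
    refine Prod.ext (funext fun k => ?_) (Prod.ext (funext fun k => ?_) (funext fun k => ?_))
    · change fiber i x k - d₀ * ((S i *ᵥ (fiber i x * u i + a i * fiber i w)) k +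
        (fiber i (J (y * U₀ + B₀ * w)) k - fiber i (J (x * U₀ + A₀ * w)) k)) = _
      rw [fiber_avgOp, fiber_avgOp]
      simp only [linDyson, LinearMap.coe_mk, AddHom.coe_mk, smul_mulVec, Pi.smul_apply, smul_eq_mul]
      rw [mul_add]
      rfl
    · change fiber i y k - d₀ * (((S i)ᵀ *ᵥ (fiber i y * u i + b i * fiber i w)) k -
        (fiber i (J (y * U₀ + B₀ * w)) k - fiber i (J (x * U₀ + A₀ * w)) k)) = _
      rw [fiber_avgOp, fiber_avgOp]
      simp only [linDyson, LinearMap.coe_mk, AddHom.coe_mk, transpose_smul, smul_mulVec,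
        Pi.smul_apply, smul_eq_mul]
      rw [mul_sub]
      rfl
    · have h2 := fτ d₀ 0 i k
      rw [add_zero] at h2
      simp only [linDyson, LinearMap.coe_mk, AddHom.coe_mk]
      rw [← h2]
      rfl
  have hinj : Function.Injective L := by
    rw [injective_iff_map_eq_zero]
    intro v hv
    have : ∀ i, (fiber i v.1, fiber i v.2.1, fiber i v.2.2) = 0 := fun i => by
      have h1 := hstab i (fiber i v.1, fiber i v.2.1, fiber i v.2.2)
      rw [← hLfib v i, hv] at h1
      have h2 : ((fiber i (0 : BddFamily N × BddFamily N × BddFamily N).1,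
        fiber i (0 : BddFamily N × BddFamily N × BddFamily N).2.1,
        fiber i (0 : BddFamily N × BddFamily N × BddFamily N).2.2) :
        (Fin (N i) → ℝ) × (Fin (N i) → ℝ) × (Fin (N i) → ℝ)) = 0 := rfl
      rw [h2, norm_zero, mul_zero] at h1
      exact norm_le_zero_iff.1 h1
    refine Prod.ext (ext_fiber fun i => ?_) (Prod.ext (ext_fiber fun i => ?_)
      (ext_fiber fun i => ?_))
    · exact congrArg Prod.fst (this i)
    · exact congrArg (fun q => q.2.1) (this i)
    · exact congrArg (fun q => q.2.2) (this i)
  -- Each fibre is finite-dimensional, so injectivity provides a preimage there; the common constant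
  -- K makes these preimages a bounded family.
  have hsurj : Function.Surjective L := by
    intro r
    have hex : ∀ i, ∃ q, linDyson (d₀ • S i) d₀ (d₀ * ‖z i‖ ^ 2) (a i) (b i) (u i) q =
        (fiber i r.1, fiber i r.2.1, fiber i r.2.2) := fun i => by
      refine (LinearMap.injective_iff_surjective.1 ?_) _
      rw [injective_iff_map_eq_zero]
      intro q hq
      have := hstab i q
      rw [hq, norm_zero, mul_zero] at this
      exact norm_le_zero_iff.1 this
    choose q hq using hex
    have hqn : ∀ i, ‖q i‖ ≤ K * ‖r‖ := fun i => by
      refine (hstab i (q i)).trans (mul_le_mul_of_nonneg_left ?_ hK)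
      rw [hq i]
      refine norm_prod_le_iff.2 ⟨(norm_fiber_le i _).trans (norm_fst_le r),
        norm_prod_le_iff.2 ⟨(norm_fiber_le i _).trans ((norm_fst_le r.2).trans (norm_snd_le r)),
        (norm_fiber_le i _).trans ((norm_snd_le r.2).trans (norm_snd_le r))⟩⟩
    set v : BddFamily N × BddFamily N × BddFamily N := (mk (fun i => (q i).1) (K * ‖r‖) fun i k => ((norm_le_pi_norm _ k).trans
      (norm_fst_le _)).trans (hqn i), mk (fun i => (q i).2.1) (K * ‖r‖) fun i k =>
      ((norm_le_pi_norm _ k).trans ((norm_fst_le _).trans (norm_snd_le _))).trans (hqn i),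
      mk (fun i => (q i).2.2) (K * ‖r‖) fun i k =>
      ((norm_le_pi_norm _ k).trans ((norm_snd_le _).trans (norm_snd_le _))).trans (hqn i))
    have hv : ∀ i, (fiber i v.1, fiber i v.2.1, fiber i v.2.2) = q i := fun i => rfl
    have := fun i => (hLfib v i).trans ((congrArg _ (hv i)).trans (hq i))
    refine ⟨v, ?_⟩
    refine Prod.ext (ext_fiber fun i => ?_) (Prod.ext (ext_fiber fun i => ?_)
      (ext_fiber fun i => ?_))
    · exact congrArg Prod.fst (this i)
    · exact congrArg (fun q => q.2.1) (this i)
    · exact congrArg (fun q => q.2.2) (this i)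
  have hcd : ContDiffAt ℝ ω F (p₀, A₀, B₀, U₀) := (contDiff_dysonResidual T T' J x₀ y₀).contDiffAt
  have hω : (ω : WithTop ℕ∞) ≠ 0 := by simp
  have hinv : (fderiv ℝ F (p₀, A₀, B₀, U₀) ∘L .inr ℝ (ℝ × ℝ × ℂ)
      (BddFamily N × BddFamily N × BddFamily N)).IsInvertible := by
    have h1 : HasFDerivAt (fun v => F (p₀, v)) (fderiv ℝ F (p₀, A₀, B₀, U₀) ∘L
        .inr ℝ (ℝ × ℝ × ℂ) (BddFamily N × BddFamily N × BddFamily N)) (A₀, B₀, U₀) :=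
      ((hcd.differentiableAt hω).hasFDerivAt).comp (A₀, B₀, U₀) (hasFDerivAt_prodMk_right p₀ _)
    rw [h1.unique hLd]
    exact ⟨ContinuousLinearEquiv.ofBijective L (LinearMap.ker_eq_bot.2 hinj)
      (LinearMap.range_eq_top.2 hsurj), ContinuousLinearEquiv.coe_ofBijective _ _ _⟩
  set φ := hcd.implicitFunction hω hinv with hφ
  have hφ0 : φ p₀ = (A₀, B₀, U₀) := hcd.implicitFunction_apply_self hω hinv
  have hφc : ContDiffAt ℝ ω φ p₀ := hcd.contDiffAt_implicitFunction hω hinv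
  refine ⟨φ, hφc, fun i => ?_, ?_⟩
  · rw [hφ0]
    exact ⟨rfl, rfl, rfl⟩
  -- All base components are at least c, so a sup-norm displacement below c preserves positivity in
  -- every fibre simultaneously.
  have hnear : ∀ᶠ p in nhds p₀, ‖φ p - (A₀, B₀, U₀)‖ < c := by
    have : Filter.Tendsto (fun p => ‖φ p - (A₀, B₀, U₀)‖) (nhds p₀) (nhds 0) := by
      have h := (hφc.continuousAt.sub (continuousAt_const (y := (A₀, B₀, U₀)))).norm
      simpa [ContinuousAt, hφ0] using h
    exact this.eventually (gt_mem_nhds hc)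
  have hzero := hcd.eventually_apply_implicitFunction hω hinv
  filter_upwards [hnear, hzero] with p hp1 hp2 hpe hpd i
  have hp2' : F (p, φ p) = 0 := hp2.trans hF0
  have hpos : ∀ (f g : BddFamily N), ‖f - g‖ ≤ ‖φ p - (A₀, B₀, U₀)‖ → ∀ k,
      g ⟨i, k⟩ ∈ Set.Icc c C → 0 < fiber i f k := fun f g hfg k hk => by
    have h1 := ((f - g).norm_coe_le_norm ⟨i, k⟩).trans_lt (hfg.trans_lt hp1)
    have h2 := (abs_lt.1 h1).1
    change -c < f ⟨i, k⟩ - g ⟨i, k⟩ at h2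
    have := hk.1
    rw [fiber_apply]
    linarith
  have hF₁ : ∀ k, fiber i (F (p, φ p)).1 k = 0 := fun k => by rw [hp2']; rfl
  have hF₂ : ∀ k, fiber i (F (p, φ p)).2.1 k = 0 := fun k => by rw [hp2']; rfl
  have hF₃ : ∀ k, fiber i (F (p, φ p)).2.2 k = 0 := fun k => by rw [hp2']; rfl
  refine IsDysonTriple.of_augmented (hN i) hpe hpd
    (fun k => hpos _ A₀ (norm_fst_le (φ p - (A₀, B₀, U₀))) k (hbd i k).1)
    (fun k => hpos _ B₀ ((norm_fst_le (φ p - (A₀, B₀, U₀)).2).trans (norm_snd_le _)) k (hbd i k).2.1)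
    (fun k => hpos _ U₀ ((norm_snd_le (φ p - (A₀, B₀, U₀)).2).trans (norm_snd_le _)) k (hbd i k).2.2)
    (fun k => ?_) (fun k => ?_) (fun k => ?_)
  · have h1 := hF₁ k
    have : fiber i (F (p, φ p)).1 k = fiber i (φ p).1 k - p.1 * 1 - p.2.1 *
        ((S i *ᵥ (fiber i (φ p).1 * fiber i (φ p).2.2)) k +
          (fiber i (J ((φ p).2.1 * (φ p).2.2)) k - fiber i (J ((φ p).1 * (φ p).2.2)) k)) := rfl
    rw [this, fiber_avgOp, fiber_avgOp, fiber_mul, fiber_mul] at h1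
    rw [smul_mulVec, Pi.smul_apply, smul_eq_mul]
    linarith
  · have h1 := hF₂ k
    have : fiber i (F (p, φ p)).2.1 k = fiber i (φ p).2.1 k - p.1 * 1 - p.2.1 *
        (((S i)ᵀ *ᵥ (fiber i (φ p).2.1 * fiber i (φ p).2.2)) k -
          (fiber i (J ((φ p).2.1 * (φ p).2.2)) k - fiber i (J ((φ p).1 * (φ p).2.2)) k)) := rfl
    rw [this, fiber_avgOp, fiber_avgOp, fiber_mul, fiber_mul] at h1
    rw [transpose_smul, smul_mulVec, Pi.smul_apply, smul_eq_mul]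
    linarith
  · have h1 := hF₃ k
    have h2 := fτ p.2.1 p.2.2 i k
    rw [← h2]
    exact sub_eq_zero.1 h1

end BddFamily

open scoped BoundedContinuousFunction

/-! ### Smooth branches of solutions -/

section Branches

variable {sLow sUp : ℝ}

lemma exists_linDyson_bound (hL : 0 < sLow) (hU : sLow < sUp) {c C : ℝ} (hc : 0 < c)
    (hC : 0 < C) :
    ∃ K : ℝ, 0 ≤ K ∧ ∀ (n : ℕ) (S : Matrix (Fin n) (Fin n) ℝ), 0 < n →
      IsFlat sLow sUp S → ∀ (η τ : ℝ) (a b u : Fin n → ℝ), 0 ≤ η → 0 ≤ τ →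
      IsDysonTriple S η τ a b u →
      (∀ i, a i ∈ Set.Icc c C ∧ b i ∈ Set.Icc c C ∧ u i ∈ Set.Icc c C) →
      ∀ q, ‖q‖ ≤ K * ‖linDyson S 1 τ a b u q‖ := by
  obtain ⟨K, hK, h⟩ := exists_stability_bound hL hU hc hC
  refine ⟨K, hK, fun n S hn hS η τ a b u hη hτ ht hbd q => ?_⟩
  have h0 : 0 ≤ K * ‖linDyson S 1 τ a b u q‖ := by positivity
  set r := linDyson S 1 τ a b u q with hr
  have key := h n S hn hS η τ a b u hη hτ ht hbd q.1 q.2.1 q.2.2 r.1 r.2.1 r.2.2 ‖r‖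
    (fun i => (norm_le_pi_norm r.1 i).trans (norm_fst_le r))
    (fun i => (norm_le_pi_norm r.2.1 i).trans ((norm_fst_le r.2).trans (norm_snd_le r)))
    (fun i => (norm_le_pi_norm r.2.2 i).trans ((norm_snd_le r.2).trans (norm_snd_le r)))
    (fun i => by simp [hr, linDyson]) (fun i => by simp [hr, linDyson]) (fun i => rfl)
  refine norm_prod_le_iff.2 ⟨?_, norm_prod_le_iff.2 ⟨?_, ?_⟩⟩
  · exact (pi_norm_le_iff_of_nonneg h0).2 fun i => (key i).1
  · exact (pi_norm_le_iff_of_nonneg h0).2 fun i => (key i).2.1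
  · exact (pi_norm_le_iff_of_nonneg h0).2 fun i => (key i).2.2

/-- The value d = 0 represents η = ∞ after rescaling. The linearisation is triangular there, and w =
r₃ - x - y accounts for the factor 3. -/
lemma norm_le_linDyson_zero {n : ℕ} (S : Matrix (Fin n) (Fin n) ℝ) (τ : ℝ)
    (q : (Fin n → ℝ) × (Fin n → ℝ) × (Fin n → ℝ)) :
    ‖q‖ ≤ 3 * ‖linDyson ((0 : ℝ) • S) 0 (0 * τ) 1 1 1 q‖ := by
  obtain ⟨x, y, w⟩ := q
  set r := linDyson ((0 : ℝ) • S) 0 (0 * τ) 1 1 1 (x, y, w) with hr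
  have e₁ : r.1 = x := by ext i; simp [hr, linDyson]
  have e₂ : r.2.1 = y := by ext i; simp [hr, linDyson]
  have e₃ : w = r.2.2 - x - y := by ext i; simp [hr, linDyson]; ring
  have h₁ : ‖x‖ ≤ ‖r‖ := e₁ ▸ norm_fst_le r
  have h₂ : ‖y‖ ≤ ‖r‖ := e₂ ▸ (norm_fst_le r.2).trans (norm_snd_le r)
  have h₃ : ‖r.2.2‖ ≤ ‖r‖ := (norm_snd_le r.2).trans (norm_snd_le r)
  have h₄ : ‖w‖ ≤ 3 * ‖r‖ := by
    calc ‖w‖ ≤ ‖r.2.2‖ + ‖x‖ + ‖y‖ := by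
          rw [e₃]; exact (norm_sub_le _ _).trans (add_le_add_left (norm_sub_le _ _) _)
      _ ≤ 3 * ‖r‖ := by linarith
  have h0 := norm_nonneg r
  exact norm_prod_le_iff.2 ⟨by dsimp only; linarith, norm_prod_le_iff.2
    ⟨by dsimp only; linarith, h₄⟩⟩

variable {n : ℕ} {S : Matrix (Fin n) (Fin n) ℝ}

lemma exists_Icc_bounds (f g h : Fin n → ℝ) (hf : ∀ i, 0 < f i) (hg : ∀ i, 0 < g i)
    (hh : ∀ i, 0 < h i) : ∃ c C : ℝ, 0 < c ∧ 0 < C ∧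
      ∀ i, f i ∈ Set.Icc c C ∧ g i ∈ Set.Icc c C ∧ h i ∈ Set.Icc c C := by
  have low : ∀ f : Fin n → ℝ, (∀ i, 0 < f i) → ∃ c, 0 < c ∧ ∀ i, c ≤ f i := by
    intro f hf
    rcases isEmpty_or_nonempty (Fin n) with hn | hn
    · exact ⟨1, one_pos, fun i => isEmptyElim i⟩
    · obtain ⟨i, hi⟩ := Finite.exists_min f
      exact ⟨f i, hf i, hi⟩
  obtain ⟨c₁, h₁, l₁⟩ := low f hf
  obtain ⟨c₂, h₂, l₂⟩ := low g hg
  obtain ⟨c₃, h₃, l₃⟩ := low h hh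
  refine ⟨min c₁ (min c₂ c₃), max 1 (max ‖f‖ (max ‖g‖ ‖h‖)), by positivity, by positivity,
    fun i => ⟨⟨(min_le_left _ _).trans (l₁ i), ?_⟩,
      ⟨(min_le_right _ _).trans ((min_le_left _ _).trans (l₂ i)), ?_⟩,
      ⟨(min_le_right _ _).trans ((min_le_right _ _).trans (l₃ i)), ?_⟩⟩⟩
  · exact (le_abs_self _).trans ((norm_le_pi_norm f i).trans (by simp))
  · exact (le_abs_self _).trans ((norm_le_pi_norm g i).trans (by simp))
  · exact (le_abs_self _).trans ((norm_le_pi_norm h i).trans (by simp))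

/-- The solution of the Dyson equation extends to a smooth branch near any solution. -/
lemma IsDysonTriple.exists_branch (hL : 0 < sLow) (hU : sLow < sUp) (hn : 0 < n)
    (hS : IsFlat sLow sUp S) {η : ℝ} {z : ℂ} {a b u : Fin n → ℝ} (hη : 0 ≤ η)
    (h : IsDysonTriple S η (‖z‖ ^ 2) a b u) :
    ∃ A B U : ℝ × ℂ → Fin n → ℝ, ContDiffAt ℝ ω A (η, z) ∧ ContDiffAt ℝ ω B (η, z) ∧
      ContDiffAt ℝ ω U (η, z) ∧
      (A (η, z) = a ∧ B (η, z) = b ∧ U (η, z) = u) ∧ ∀ᶠ p in nhds (η, z),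
        0 ≤ p.1 → IsDysonTriple S p.1 (‖p.2‖ ^ 2) (A p) (B p) (U p) := by
  obtain ⟨c, C, hc, hC, hbd⟩ := exists_Icc_bounds a b u h.pos_a h.pos_b h.pos_u
  obtain ⟨K, hK, hstab⟩ := exists_linDyson_bound hL hU hc hC
  obtain ⟨φ, h₁, h₂, h₃⟩ := BddFamily.exists_smooth_branch (ι := Unit) (N := fun _ => n) hL hU
    (fun _ => hn) (fun _ => S) (fun _ => hS) (fun _ => z) (Z := ‖z‖) (e₀ := η) (d₀ := 1)
    (fun _ => le_rfl) hc (fun _ => a) (fun _ => b) (fun _ => u) (fun _ => by simpa using h)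
    (fun _ => hbd) hK (fun _ q => by
      simpa using hstab n S hn hS η (‖z‖ ^ 2) a b u hη (by positivity) h hbd q)
  let g : ℝ × ℂ → ℝ × ℝ × ℂ := fun p => (p.1, 1, p.2 - z)
  have hg : ContDiff ℝ ω g := by fun_prop
  have hg0 : g (η, z) = (η, 1, 0) := by simp [g]
  have hφ : ContDiffAt ℝ ω (φ ∘ g) (η, z) := by
    refine ContDiffAt.comp _ ?_ hg.contDiffAt
    rw [hg0]; exact h₁
  refine ⟨fun p => BddFamily.fiberL () (φ (g p)).1, fun p => BddFamily.fiberL () (φ (g p)).2.1,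
    fun p => BddFamily.fiberL () (φ (g p)).2.2,
    (BddFamily.fiberL ()).contDiff.contDiffAt.comp _ hφ.fst,
    (BddFamily.fiberL ()).contDiff.contDiffAt.comp _ hφ.snd.fst,
    (BddFamily.fiberL ()).contDiff.contDiffAt.comp _ hφ.snd.snd, ?_, ?_⟩
  · dsimp only; rw [hg0]; exact h₂ ()
  · have ht : Filter.Tendsto g (nhds (η, z)) (nhds (η, 1, 0)) := by
      have := hg.continuous.tendsto (η, z)
      rwa [hg0] at this
    filter_upwards [ht.eventually h₃] with p hp hp0
    simpa [g] using hp hp0 one_pos ()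

lemma IsFlat.exists_branch_of_pos (hL : 0 < sLow) (hU : sLow < sUp) (hn : 0 < n)
    (hS : IsFlat sLow sUp S) {η : ℝ} (hη : 0 < η) (z : ℂ) :
    ∃ A B U : ℝ × ℂ → Fin n → ℝ, ContDiffAt ℝ ω A (η, z) ∧ ContDiffAt ℝ ω B (η, z) ∧
      ContDiffAt ℝ ω U (η, z) ∧ ∀ᶠ p in nhds (η, z),
        IsDysonTriple S p.1 (‖p.2‖ ^ 2) (A p) (B p) (U p) ∧
        dysonSolution S p.1 (‖p.2‖ ^ 2) = (B p * U p, A p * U p) ∧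
        dysonU S p.1 (‖p.2‖ ^ 2) = U p := by
  obtain ⟨a, b, u, h⟩ := exists_isDysonTriple (hS.entry_nonneg hL) hη (sq_nonneg ‖z‖)
  obtain ⟨A, B, U, hA, hB, hU', -, hev⟩ := h.exists_branch hL hU hn hS hη.le
  refine ⟨A, B, U, hA, hB, hU', ?_⟩
  have hpos : ∀ᶠ p : ℝ × ℂ in nhds (η, z), 0 < p.1 :=
    continuous_fst.continuousAt.eventually (lt_mem_nhds hη)
  filter_upwards [hev, hpos] with p hp hp0
  have := hp hp0.le
  exact ⟨this, this.eq_dyson (hS.entry_nonneg hL) hp0 (by positivity)⟩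

lemma IsFlat.contDiffAt_dysonSolution (hL : 0 < sLow) (hU : sLow < sUp) (hn : 0 < n)
    (hS : IsFlat sLow sUp S) {η : ℝ} (hη : 0 < η) (z : ℂ) :
    ContDiffAt ℝ ω (fun p : ℝ × ℂ => dysonSolution S p.1 (‖p.2‖ ^ 2)) (η, z) := by
  obtain ⟨A, B, U, hA, hB, hU', hev⟩ := hS.exists_branch_of_pos hL hU hn hη z
  have : ContDiffAt ℝ ω (fun p => (B p * U p, A p * U p)) (η, z) :=
    (hB.mul hU').prodMk (hA.mul hU')
  exact this.congr_of_eventuallyEq (hev.mono fun p hp => hp.2.1)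

/-- `⟨u⟩` as a function of `η` and `z`. -/
def avgU (S : Matrix (Fin n) (Fin n) ℝ) (p : ℝ × ℂ) : ℝ := vecAvg (dysonU S p.1 (‖p.2‖ ^ 2))

/-- The limit of `⟨u⟩` as `η → 0`. -/
def avgUZero (S : Matrix (Fin n) (Fin n) ℝ) (z : ℂ) : ℝ :=
  Filter.limUnder (nhdsWithin 0 (Set.Ioi 0)) fun η : ℝ => avgU S (η, z)

lemma contDiff_vecAvg {m : WithTop ℕ∞} : ContDiff ℝ m (vecAvg : (Fin n → ℝ) → ℝ) := by
  unfold vecAvg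
  fun_prop

lemma IsFlat.contDiffAt_avgU (hL : 0 < sLow) (hU : sLow < sUp) (hn : 0 < n)
    (hS : IsFlat sLow sUp S) {η : ℝ} (hη : 0 < η) (z : ℂ) :
    ContDiffAt ℝ ω (avgU S) (η, z) := by
  obtain ⟨A, B, U, hA, hB, hU', hev⟩ := hS.exists_branch_of_pos hL hU hn hη z
  have : ContDiffAt ℝ ω (fun p => vecAvg (U p)) (η, z) := contDiff_vecAvg.contDiffAt.comp _ hU'
  exact this.congr_of_eventuallyEq (hev.mono fun p hp => by rw [avgU, hp.2.2])

/-- Uniqueness at η = 0 is never needed: `avgUZero` is a limit from η > 0, where solutions are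
unique, so any convergent branch of triples computes it. -/
lemma tendsto_avgU_of_triple (hS : ∀ i j, 0 ≤ S i j) {z : ℂ} {Φ : ℝ → Fin n → ℝ} {u : Fin n → ℝ}
    (h : ∀ᶠ η in nhdsWithin 0 (Set.Ioi 0), ∃ a b, IsDysonTriple S η (‖z‖ ^ 2) a b (Φ η))
    (hΦ : Filter.Tendsto Φ (nhdsWithin 0 (Set.Ioi 0)) (nhds u)) :
    avgUZero S z = vecAvg u := by
  refine Filter.Tendsto.limUnder_eq ?_
  have h1 : Filter.Tendsto (fun η => vecAvg (Φ η)) (nhdsWithin 0 (Set.Ioi 0)) (nhds (vecAvg u)) :=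
    ((contDiff_vecAvg (m := 0)).continuous.tendsto u).comp hΦ
  refine h1.congr' ?_
  filter_upwards [h, self_mem_nhdsWithin] with η ⟨a, b, hη⟩ hη0
  rw [avgU, (hη.eq_dyson hS hη0 (by positivity)).2]

lemma mem_ball_sqrt_iff {ρ : ℝ} {z : ℂ} :
    z ∈ Metric.ball (0 : ℂ) (Real.sqrt ρ) ↔ ‖z‖ ^ 2 < ρ := by
  rw [mem_ball_zero_iff, Real.lt_sqrt (norm_nonneg z)]

/-- Below the spectral edge the solution extends smoothly to `η = 0`. -/
lemma IsFlat.exists_branch_zero (hL : 0 < sLow) (hU : sLow < sUp) (hn : 0 < n)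
    (hS : IsFlat sLow sUp S) {z : ℂ} (hz : ‖z‖ ^ 2 < specRadius S) :
    ∃ A B U : ℝ × ℂ → Fin n → ℝ, ContDiffAt ℝ ω A (0, z) ∧ ContDiffAt ℝ ω B (0, z) ∧
      ContDiffAt ℝ ω U (0, z) ∧ (∀ᶠ p in nhds ((0, z) : ℝ × ℂ),
        0 ≤ p.1 → IsDysonTriple S p.1 (‖p.2‖ ^ 2) (A p) (B p) (U p)) ∧
      (∀ᶠ p in nhds ((0, z) : ℝ × ℂ), 0 < p.1 → avgU S p = vecAvg (U p)) ∧
      ∀ᶠ w in nhds z, IsDysonTriple S 0 (‖w‖ ^ 2) (A (0, w)) (B (0, w)) (U (0, w)) ∧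
        avgUZero S w = vecAvg (U (0, w)) := by
  obtain ⟨a, b, u, h⟩ := exists_isDysonTriple_zero hL hU hS hn (sq_nonneg ‖z‖) hz
  obtain ⟨A, B, U, hA, hB, hU', -, hev⟩ := h.exists_branch hL hU hn hS le_rfl
  refine ⟨A, B, U, hA, hB, hU', hev, ?_, ?_⟩
  · filter_upwards [hev] with p hp hp0
    rw [avgU, ((hp hp0.le).eq_dyson (hS.entry_nonneg hL) hp0 (by positivity)).2]
  · have hc : ∀ᶠ p in nhds ((0, z) : ℝ × ℂ), ContinuousAt U p :=
      (hU'.eventually (by simp)).mono fun p hp => hp.continuousAt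
    have hin : Filter.Tendsto (fun w : ℂ => ((0, w) : ℝ × ℂ)) (nhds z) (nhds (0, z)) :=
      (Continuous.prodMk_right (0 : ℝ)).tendsto z
    filter_upwards [hin.eventually (eventually_eventually_nhds.2 hev), hin.eventually hc]
      with w hw1 hw2
    refine ⟨hw1.self_of_nhds le_rfl, tendsto_avgU_of_triple (hS.entry_nonneg hL)
      (Φ := fun η => U (η, w)) ?_ ?_⟩
    · have : Filter.Tendsto (fun η : ℝ => ((η, w) : ℝ × ℂ)) (nhdsWithin 0 (Set.Ioi 0))
          (nhds (0, w)) := ((Continuous.prodMk_left w).tendsto 0).mono_left nhdsWithin_le_nhds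
      filter_upwards [this.eventually hw1, self_mem_nhdsWithin] with η h1 h2
      exact ⟨_, _, h1 (le_of_lt h2)⟩
    · exact (hw2.tendsto.comp ((Continuous.prodMk_left w).tendsto 0)).mono_left nhdsWithin_le_nhds

end Branches

/-! ### The Laplacian as an η-derivative -/

section Differentiation

variable {n : ℕ} {S : Matrix (Fin n) (Fin n) ℝ}

lemma hasDerivAt_mulVec (T : Matrix (Fin n) (Fin n) ℝ) {f : ℝ → Fin n → ℝ} {f' : Fin n → ℝ}
    {t : ℝ} (hf : HasDerivAt f f' t) : HasDerivAt (fun t => T *ᵥ f t) (T *ᵥ f') t :=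
  (LinearMap.toContinuousLinearMap (Matrix.mulVecLin T)).hasFDerivAt.comp_hasDerivAt t hf

lemma hasDerivAt_vecAvg {f : ℝ → Fin n → ℝ} {f' : Fin n → ℝ}
    {t : ℝ} (hf : HasDerivAt f f' t) : HasDerivAt (fun t => vecAvg (f t)) (vecAvg f') t := by
  unfold vecAvg
  exact (HasDerivAt.fun_sum fun i _ => hasDerivAt_pi.1 hf i).div_const _

/-- The Dyson equation differentiated along a curve. -/
lemma IsDysonTriple.deriv_eq {A B U : ℝ → Fin n → ℝ} {e τ : ℝ → ℝ} {α β υ : Fin n → ℝ}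
    {e' τ' : ℝ} (hA : HasDerivAt A α 0) (hB : HasDerivAt B β 0) (hU : HasDerivAt U υ 0)
    (he : HasDerivAt e e' 0) (hτ : HasDerivAt τ τ' 0)
    (h : ∀ᶠ t in nhds 0, IsDysonTriple S (e t) (τ t) (A t) (B t) (U t)) :
    (∀ i, α i = e' + (S *ᵥ (α * U 0 + A 0 * υ)) i) ∧
    (∀ i, β i = e' + (Sᵀ *ᵥ (β * U 0 + B 0 * υ)) i) ∧
    (∀ i, υ i * (τ 0 + A 0 i * B 0 i) + U 0 i * (τ' + (α i * B 0 i + A 0 i * β i)) = 0) ∧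
    vecAvg (α * U 0 + A 0 * υ) = vecAvg (β * U 0 + B 0 * υ) := by
  have hAU : HasDerivAt (fun t => A t * U t) (α * U 0 + A 0 * υ) 0 := hA.mul hU
  have hBU : HasDerivAt (fun t => B t * U t) (β * U 0 + B 0 * υ) 0 := hB.mul hU
  refine ⟨fun i => ?_, fun i => ?_, fun i => ?_, ?_⟩
  · have h1 := hasDerivAt_pi.1 hA i
    have h2 := he.add (hasDerivAt_pi.1 (hasDerivAt_mulVec S hAU) i)
    exact h1.unique (h2.congr_of_eventuallyEq (h.mono fun t ht => ht.eq_a i))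
  · have h1 := hasDerivAt_pi.1 hB i
    have h2 := he.add (hasDerivAt_pi.1 (hasDerivAt_mulVec Sᵀ hBU) i)
    exact h1.unique (h2.congr_of_eventuallyEq (h.mono fun t ht => ht.eq_b i))
  · have h1 := (hasDerivAt_pi.1 hU i).mul
      (hτ.add ((hasDerivAt_pi.1 hA i).mul (hasDerivAt_pi.1 hB i)))
    have h2 : HasDerivAt (fun _ : ℝ => (1 : ℝ)) 0 0 := hasDerivAt_const _ _
    exact h1.unique (h2.congr_of_eventuallyEq (h.mono fun t ht => ht.eq_u i))
  · exact (hasDerivAt_vecAvg hAU).unique ((hasDerivAt_vecAvg hBU).congr_of_eventuallyEq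
      (h.mono fun t ht => ht.avg_eq))

/-- The symmetry of the linearized Dyson equation: the `τ`-derivative of `⟨v₁ + v₂⟩` is the
`η`-derivative of `⟨u⟩`. -/
lemma vecAvg_deriv_symm {a b u α β υ α' β' υ' : Fin n → ℝ} {τ t : ℝ}
    (hu : ∀ i, u i ≠ 0)
    (h₁ : ∀ i, α i = 0 + (S *ᵥ (α * u + a * υ)) i)
    (h₂ : ∀ i, β i = 0 + (Sᵀ *ᵥ (β * u + b * υ)) i)
    (h₃ : ∀ i, υ i * (τ + a i * b i) + u i * (t + (α i * b i + a i * β i)) = 0)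
    (h₁' : ∀ i, α' i = 1 + (S *ᵥ (α' * u + a * υ')) i)
    (h₂' : ∀ i, β' i = 1 + (Sᵀ *ᵥ (β' * u + b * υ')) i)
    (h₃' : ∀ i, υ' i * (τ + a i * b i) + u i * (0 + (α' i * b i + a i * β' i)) = 0) :
    vecAvg (α * u + a * υ) + vecAvg (β * u + b * υ) = t * vecAvg υ' := by
  set f := α * u + a * υ with hf
  set k := β * u + b * υ with hk
  set f' := α' * u + a * υ' with hf'
  set k' := β' * u + b * υ' with hk'
  -- Each linearised system is tested against the solution of the other. Duality moves S across,
  -- leaving pointwise terms that the two linearised equations for u match up.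
  have e₁ : vecAvg f = vecAvg (f * β') - vecAvg (k' * α) := by
    have : f = f * β' - f * (Sᵀ *ᵥ k') := by
      ext i
      simp only [Pi.sub_apply, Pi.mul_apply]
      linear_combination -f i * h₂' i
    have h := vecAvg_mul_mulVec Sᵀ f k'
    rw [transpose_transpose] at h
    have h' : k' * (S *ᵥ f) = k' * α := by
      ext i; simp only [Pi.mul_apply, h₁ i, zero_add]
    conv_lhs => rw [this, vecAvg_sub, h, h']
  have e₂ : vecAvg k = vecAvg (k * α') - vecAvg (f' * β) := by
    have : k = k * α' - k * (S *ᵥ f') := by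
      ext i
      simp only [Pi.sub_apply, Pi.mul_apply]
      linear_combination -k i * h₁' i
    have h := vecAvg_mul_mulVec S k f'
    have h' : f' * (Sᵀ *ᵥ k) = f' * β := by
      ext i; simp only [Pi.mul_apply, h₂ i, zero_add]
    conv_lhs => rw [this, vecAvg_sub, h, h']
  rw [e₁, e₂, ← vecAvg_smul, ← vecAvg_sub, ← vecAvg_sub, ← vecAvg_add]
  congr 1
  ext i
  simp only [hf, hk, hf', hk', Pi.add_apply, Pi.sub_apply, Pi.mul_apply, Pi.smul_apply, smul_eq_mul]
  refine mul_left_cancel₀ (hu i) ?_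
  linear_combination υ i * h₃' i - υ' i * h₃ i

variable {sLow sUp : ℝ}

/-- `⟨v₁⟩` as a function of `η` and `z`. -/
def avgV (S : Matrix (Fin n) (Fin n) ℝ) (p : ℝ × ℂ) : ℝ :=
  vecAvg (dysonSolution S p.1 (‖p.2‖ ^ 2)).1

lemma IsFlat.contDiffAt_avgV (hL : 0 < sLow) (hU : sLow < sUp) (hn : 0 < n)
    (hS : IsFlat sLow sUp S) {η : ℝ} (hη : 0 < η) (z : ℂ) :
    ContDiffAt ℝ ω (avgV S) (η, z) :=
  contDiff_vecAvg.contDiffAt.comp (η, z) (hS.contDiffAt_dysonSolution hL hU hn hη z).fst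

lemma hasDerivAt_line {E : Type*} [NormedAddCommGroup E] [NormedSpace ℝ E] {F : Type*}
    [NormedAddCommGroup F] [NormedSpace ℝ F] {f : E → F} {p : E} (hf : DifferentiableAt ℝ f p)
    (w : E) : HasDerivAt (fun t : ℝ => f (p + t • w)) (fderiv ℝ f p w) 0 := by
  have h1 : HasDerivAt (fun t : ℝ => p + t • w) w 0 := by
    simpa using ((hasDerivAt_id (0 : ℝ)).smul_const w).const_add p
  have h2 : HasFDerivAt f (fderiv ℝ f p) (p + (0 : ℝ) • w) := by simpa using hf.hasFDerivAt
  exact h2.comp_hasDerivAt 0 h1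

lemma hasDerivAt_normSq_line (z h : ℂ) :
    HasDerivAt (fun t : ℝ => ‖z + t • h‖ ^ 2) (2 * (z.re * h.re + z.im * h.im)) 0 := by
  have : (fun t : ℝ => ‖z + t • h‖ ^ 2) = fun t : ℝ =>
      (z.re + t * h.re) * (z.re + t * h.re) + (z.im + t * h.im) * (z.im + t * h.im) := by
    ext t
    rw [Complex.sq_norm, Complex.normSq_apply]
    simp
  rw [this]
  have h1 : ∀ x y : ℝ, HasDerivAt (fun t : ℝ => x + t * y) y 0 := fun x y => by
    simpa using ((hasDerivAt_id (0 : ℝ)).mul_const y).const_add x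
  have := ((h1 z.re h.re).mul (h1 z.re h.re)).add ((h1 z.im h.im).mul (h1 z.im h.im))
  exact this.congr_deriv (by simp; ring)

/-- The symmetry identity with dτ = 2 Re(z̄h). The averages of v₁ and v₂ agree, so each carries
half: ∇⟨v₁⟩ = z ∂_η⟨u⟩. -/
lemma IsFlat.fderiv_avgV (hL : 0 < sLow) (hU : sLow < sUp) (hn : 0 < n)
    (hS : IsFlat sLow sUp S) {η : ℝ} (hη : 0 < η) (z h : ℂ) :
    fderiv ℝ (avgV S) (η, z) (0, h) =
      (z.re * h.re + z.im * h.im) * fderiv ℝ (avgU S) (η, z) (1, 0) := by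
  obtain ⟨A, B, U, hA, hB, hU', hev⟩ := hS.exists_branch_of_pos hL hU hn hη z
  have dA := hA.differentiableAt (by simp)
  have dB := hB.differentiableAt (by simp)
  have dU := hU'.differentiableAt (by simp)
  have hline : ∀ w : ℝ × ℂ, ∀ᶠ t : ℝ in nhds 0,
      IsDysonTriple S ((η, z) + t • w).1 (‖((η, z) + t • w).2‖ ^ 2) (A ((η, z) + t • w))
        (B ((η, z) + t • w)) (U ((η, z) + t • w)) ∧
      dysonSolution S ((η, z) + t • w).1 (‖((η, z) + t • w).2‖ ^ 2) =
        (B ((η, z) + t • w) * U ((η, z) + t • w), A ((η, z) + t • w) * U ((η, z) + t • w)) ∧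
      dysonU S ((η, z) + t • w).1 (‖((η, z) + t • w).2‖ ^ 2) = U ((η, z) + t • w) := fun w => by
    have : Filter.Tendsto (fun t : ℝ => (η, z) + t • w) (nhds 0) (nhds (η, z)) := by
      have : Continuous fun t : ℝ => (η, z) + t • w := by fun_prop
      simpa using this.tendsto 0
    exact this.eventually hev
  have hz0 : HasDerivAt (fun t : ℝ => η + t * (0 : ℝ)) 0 0 := by
    simpa using hasDerivAt_const (0 : ℝ) η
  have hz1 : HasDerivAt (fun t : ℝ => η + t * (1 : ℝ)) 1 0 := by
    simpa using (hasDerivAt_id (0 : ℝ)).const_add η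
  obtain ⟨g1, g2, g3, g4⟩ := IsDysonTriple.deriv_eq (hasDerivAt_line dA (0, h))
    (hasDerivAt_line dB (0, h)) (hasDerivAt_line dU (0, h)) hz0 (hasDerivAt_normSq_line z h)
    ((hline (0, h)).mono fun t ht => ht.1)
  obtain ⟨g1', g2', g3', -⟩ := IsDysonTriple.deriv_eq (hasDerivAt_line dA (1, 0))
    (hasDerivAt_line dB (1, 0)) (hasDerivAt_line dU (1, 0)) hz1 (hasDerivAt_normSq_line z 0)
    ((hline (1, 0)).mono fun t ht => ht.1)
  simp only [zero_smul, add_zero, Complex.zero_re, Complex.zero_im, mul_zero] at g1 g2 g3 g4 g1' g2' g3'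
  have key := vecAvg_deriv_symm (fun i => (hev.self_of_nhds.1.pos_u i).ne') g1 g2 g3 g1' g2' g3'
  have d1 : fderiv ℝ (avgV S) (η, z) (0, h) = vecAvg (fderiv ℝ B (η, z) (0, h) * U (η, z) +
      B (η, z) * fderiv ℝ U (η, z) (0, h)) := by
    have h1 := hasDerivAt_line ((hS.contDiffAt_avgV hL hU hn hη z).differentiableAt (by simp)) (0, h)
    have h2 := hasDerivAt_vecAvg ((hasDerivAt_line dB (0, h)).mul (hasDerivAt_line dU (0, h)))
    simp only [zero_smul, add_zero] at h2
    exact h1.unique (h2.congr_of_eventuallyEq ((hline (0, h)).mono fun t ht => by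
      simp only [avgV, ht.2.1]; rfl))
  have d2 : fderiv ℝ (avgU S) (η, z) (1, 0) = vecAvg (fderiv ℝ U (η, z) (1, 0)) := by
    have h1 := hasDerivAt_line ((hS.contDiffAt_avgU hL hU hn hη z).differentiableAt (by simp)) (1, 0)
    have h2 := hasDerivAt_vecAvg (hasDerivAt_line dU (1, 0))
    exact h1.unique (h2.congr_of_eventuallyEq ((hline (1, 0)).mono fun t ht => by
      simp only [avgU, ht.2.2]))
  rw [d1, d2]
  rw [g4] at key
  linarith

/-- The primitive in `η` of the Laplacian of `⟨v₁⟩`. -/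
def lapPrimitive (f : ℝ × ℂ → ℝ) (z : ℂ) (η : ℝ) : ℝ := 2 * f (η, z) + fderiv ℝ f (η, z) (0, z)

lemma contDiffAt_lapPrimitive {f : ℝ × ℂ → ℝ} {z : ℂ} {η : ℝ} (hf : ContDiffAt ℝ ω f (η, z)) :
    ContDiffAt ℝ ω (lapPrimitive f z) η := by
  have hg : ContDiffAt ℝ ω (fun s : ℝ => (s, z)) η := by fun_prop
  have h1 : ContDiffAt ℝ ω (fun s : ℝ => f (s, z)) η := ContDiffAt.comp η hf hg
  have h2 : ContDiffAt ℝ ω (fun s : ℝ => fderiv ℝ f (s, z)) η :=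
    ContDiffAt.comp (g := fderiv ℝ f) η (hf.fderiv_right (by simp)) hg
  exact (contDiffAt_const.mul h1).add (h2.clm_apply contDiffAt_const)

lemma lapPrimitive_congr {f g : ℝ × ℂ → ℝ} {z : ℂ} {η : ℝ} (h : f =ᶠ[nhds (η, z)] g) :
    lapPrimitive f z η = lapPrimitive g z η := by
  rw [lapPrimitive, lapPrimitive, h.eq_of_nhds, h.fderiv_eq]

/-- The divergence of z ∂_η⟨u⟩ in the plane is 2∂_η⟨u⟩ + z·∇∂_η⟨u⟩, and symmetry of second
derivatives lets ∂_η be pulled out. -/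
lemma IsFlat.hasDerivAt_lapPrimitive (hL : 0 < sLow) (hU : sLow < sUp) (hn : 0 < n)
    (hS : IsFlat sLow sUp S) {η : ℝ} (hη : 0 < η) (z : ℂ) :
    HasDerivAt (lapPrimitive (avgU S) z) (laplacianAvg S η z) η := by
  set f : ℝ × ℂ → ℝ := avgU S with hf
  have hfC : ∀ w, ContDiffAt ℝ ω f (η, w) := fun w => hS.contDiffAt_avgU hL hU hn hη w
  set v : ℂ → ℝ := fun w => avgV S (η, w) with hv
  have hvC : ∀ w, ContDiffAt ℝ ω v w := fun w =>
    (hS.contDiffAt_avgV hL hU hn hη w).comp (f := fun w : ℂ => (η, w)) w (by fun_prop)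
  have hfd : ContDiffAt ℝ ω (fderiv ℝ f) (η, z) := (hfC z).fderiv_right (by simp)
  have hfd2 := (hfd.differentiableAt (by simp)).hasFDerivAt
  set D2 := fderiv ℝ (fderiv ℝ f) (η, z) with hD2
  have hsymm : D2 (0, z) (1, 0) = D2 (1, 0) (0, z) :=
    (((hfC z).of_le le_top).isSymmSndFDerivAt (n := 2) (by simp)).eq (0, z) (1, 0)
  set ψ : ℂ → ℝ := fun w => fderiv ℝ f (η, w) (1, 0) with hψ
  have hin : HasFDerivAt (fun w : ℂ => (η, w)) (ContinuousLinearMap.inr ℝ ℝ ℂ) z :=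
    hasFDerivAt_prodMk_right η z
  have hψd : HasFDerivAt ψ ((D2.comp (ContinuousLinearMap.inr ℝ ℝ ℂ)).flip (1, 0)) z := by
    have h1 : HasFDerivAt (fun w : ℂ => fderiv ℝ f (η, w)) (D2.comp (ContinuousLinearMap.inr ℝ ℝ ℂ)) z :=
      HasFDerivAt.comp (g := fderiv ℝ f) z hfd2 hin
    have := h1.clm_apply (hasFDerivAt_const ((1 : ℝ), (0 : ℂ)) z)
    refine this.congr_fderiv ?_
    ext1 w
    simp
  have hvd : ∀ w h, fderiv ℝ v w h = (w.re * h.re + w.im * h.im) * ψ w := fun w h => by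
    rw [hψ, ← hS.fderiv_avgV hL hU hn hη w h]
    have h1 := ((hS.contDiffAt_avgV hL hU hn hη w).differentiableAt (by simp)).hasFDerivAt
    have h2 := h1.comp w (hasFDerivAt_prodMk_right η w)
    rw [show v = avgV S ∘ fun w => (η, w) from rfl, h2.fderiv]
    simp
  have hsecond : ∀ h, fderiv ℝ (fderiv ℝ v) z h h =
      (h.re * h.re + h.im * h.im) * ψ z + (z.re * h.re + z.im * h.im) * D2 (0, h) (1, 0) := by
    intro h
    have h1 : DifferentiableAt ℝ (fderiv ℝ v) z :=
      ((hvC z).fderiv_right (m := ω) (by simp)).differentiableAt (by simp)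
    have h2 : HasDerivAt (fun t : ℝ => fderiv ℝ v (z + t • h) h) (fderiv ℝ (fderiv ℝ v) z h h) 0 := by
      simpa using (hasDerivAt_line h1 h).clm_apply (hasDerivAt_const 0 h)
    have h3 : (fun t : ℝ => fderiv ℝ v (z + t • h) h) =
        fun t => ((z.re + t * h.re) * h.re + (z.im + t * h.im) * h.im) * ψ (z + t • h) := by
      ext t
      rw [hvd]
      simp
    rw [h3] at h2
    have h4 : ∀ x y : ℝ, HasDerivAt (fun t : ℝ => x + t * y) y 0 := fun x y => by
      simpa using ((hasDerivAt_id (0 : ℝ)).mul_const y).const_add x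
    have h5 := (((h4 z.re h.re).mul_const h.re).add ((h4 z.im h.im).mul_const h.im)).mul
      (hasDerivAt_line hψd.differentiableAt h)
    rw [h2.unique h5, hψd.fderiv]
    simp
  have hlap : laplacianAvg S η z = 2 * ψ z + D2 (1, 0) (0, z) := by
    have h1 : laplacianAvg S η z = Laplacian.laplacian v z := rfl
    rw [h1, InnerProductSpace.laplacian_eq_iteratedFDeriv_complexPlane]
    simp only [iteratedFDeriv_two_apply, Matrix.cons_val_zero, Matrix.cons_val_one, hsecond]
    rw [← hsymm]
    have h2 : ((0 : ℝ), z) = z.re • ((0 : ℝ), (1 : ℂ)) + z.im • ((0 : ℝ), Complex.I) := by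
      simp [Complex.re_add_im]
    rw [h2, map_add, map_smul, map_smul]
    simp
    ring
  rw [hlap]
  have hin' : HasFDerivAt (fun s : ℝ => (s, z)) (ContinuousLinearMap.inl ℝ ℝ ℂ) η :=
    hasFDerivAt_prodMk_left η z
  have k1 : HasDerivAt (fun s : ℝ => f (s, z)) (fderiv ℝ f (η, z) (1, 0)) η := by
    have := (((hfC z).differentiableAt (by simp)).hasFDerivAt.comp η hin').hasDerivAt
    exact this.congr_deriv (by simp)
  have k2 : HasDerivAt (fun s : ℝ => fderiv ℝ f (s, z)) (D2 (1, 0)) η := by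
    have := (HasFDerivAt.comp (g := fderiv ℝ f) η hfd2 hin').hasDerivAt
    exact this.congr_deriv (by simp)
  have k3 := (k1.const_mul 2).add (k2.clm_apply (hasDerivAt_const η ((0 : ℝ), z)))
  exact k3.congr_deriv (by simp [hψ])

end Differentiation

/-! ### Integrating the Laplacian over η -/

section Integration

open Filter Topology

/-- Integrability of a derivative from smooth expansions of the primitive at `0` and at `∞`. -/
lemma integrableOn_and_integral_of_expansions {H L H₀ M : ℝ → ℝ}
    (hder : ∀ η, 0 < η → HasDerivAt H (L η) η) (hcont : ContinuousOn L (Ioi 0))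
    (hH₀ : ContDiffAt ℝ ω H₀ 0) (heq : ∀ᶠ η in 𝓝[>] 0, H η = H₀ η)
    (hM : ContDiffAt ℝ ω M 0) (hM0 : M 0 = 0) (hinf : ∀ᶠ η in atTop, H η = M ((η ^ 2)⁻¹)) :
    IntegrableOn L (Ioi 0) ∧ ∫ η in Ioi 0, L η = -H₀ 0 := by
  have hd : ∀ᶠ η in 𝓝[>] (0 : ℝ), L η = deriv H₀ η := by
    have h2 := eventually_eventually_nhdsWithin.2 heq
    filter_upwards [h2, self_mem_nhdsWithin] with η hη hη0
    rw [nhdsWithin_eq_nhds.2 (Ioi_mem_nhds hη0)] at hη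
    rw [← (hder η hη0).deriv]
    exact EventuallyEq.deriv_eq hη
  have hlim0 : Tendsto L (𝓝[>] 0) (𝓝 (deriv H₀ 0)) := by
    have h1 : ContinuousAt (deriv H₀) 0 := by
      have : ContDiffAt ℝ ω (fun s => fderiv ℝ H₀ s 1) 0 :=
        (hH₀.fderiv_right (m := ω) (by simp)).clm_apply contDiffAt_const
      exact this.continuousAt
    exact (h1.tendsto.mono_left nhdsWithin_le_nhds).congr' (hd.mono fun η h => h.symm)
  have hinv : Tendsto (fun η : ℝ => (η ^ 2)⁻¹) atTop (𝓝 0) :=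
    tendsto_inv_atTop_zero.comp (tendsto_pow_atTop two_ne_zero)
  -- Differentiating M(η⁻²) even gives order η⁻³; the weaker rate suffices for integrability.
  have hLinf : L =O[atTop] fun η : ℝ => η ^ (-2 : ℝ) := by
    have h1 : ∀ᶠ η : ℝ in atTop, L η = fderiv ℝ M ((η ^ 2)⁻¹) 1 * (-(2 * η) / (η ^ 2) ^ 2) := by
      have h2 : ∀ᶠ η : ℝ in atTop, DifferentiableAt ℝ M ((η ^ 2)⁻¹) :=
        hinv.eventually ((hM.eventually (by simp)).mono fun x hx => hx.differentiableAt (by simp))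
      obtain ⟨r, hr⟩ := eventually_atTop.1 hinf
      filter_upwards [eventually_gt_atTop r, h2, eventually_gt_atTop 0] with η h3 h4 h5
      have h6 : HasDerivAt (fun η : ℝ => (η ^ 2)⁻¹) (-(2 * η) / (η ^ 2) ^ 2) η := by
        have := (hasDerivAt_pow 2 η).fun_inv (by positivity)
        simpa using this
      have h7 : HasDerivAt (fun η : ℝ => M ((η ^ 2)⁻¹))
          (fderiv ℝ M ((η ^ 2)⁻¹) 1 * (-(2 * η) / (η ^ 2) ^ 2)) η :=
        (h4.hasDerivAt (𝕜 := ℝ)).comp η h6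
      exact (hder η h5).unique (h7.congr_of_eventuallyEq
        ((lt_mem_nhds h3).mono fun s hs => hr s hs.le))
    have hMc : ContinuousAt (fun s => fderiv ℝ M s 1) 0 := by
      have : ContDiffAt ℝ ω (fun s => fderiv ℝ M s 1) 0 :=
        (hM.fderiv_right (m := ω) (by simp)).clm_apply contDiffAt_const
      exact this.continuousAt
    have h3 : ∀ᶠ η : ℝ in atTop, ‖fderiv ℝ M ((η ^ 2)⁻¹) 1‖ < ‖fderiv ℝ M 0 1‖ + 1 :=
      (hMc.norm.tendsto.comp hinv).eventually (gt_mem_nhds (lt_add_one _))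
    refine Asymptotics.IsBigO.of_bound ((‖fderiv ℝ M 0 1‖ + 1) * 2) ?_
    filter_upwards [h1, h3, eventually_ge_atTop 1] with η e1 e2 e3
    have hη : 0 < η := by linarith
    rw [e1, norm_mul, Real.norm_of_nonneg (Real.rpow_nonneg hη.le _),
      show (-2 : ℝ) = -(2 : ℕ) by norm_num, Real.rpow_neg hη.le, Real.rpow_natCast, mul_assoc]
    refine mul_le_mul e2.le ?_ (norm_nonneg _) (by positivity)
    have : ‖-(2 * η) / (η ^ 2) ^ 2‖ = 2 * (η ^ 2)⁻¹ * η⁻¹ := by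
      rw [norm_div, norm_neg, Real.norm_of_nonneg (by positivity), Real.norm_of_nonneg (by positivity)]
      field_simp
    rw [this]
    exact mul_le_of_le_one_right (by positivity) (inv_le_one_of_one_le₀ e3)
  have hIci : Ici (0 : ℝ) \ {0} = Ioi 0 := by
    ext x; simp [lt_iff_le_and_ne, eq_comm]
  have hint : IntegrableOn L (Ioi 0) := by
    -- Filling in the limit at 0 gives a function continuous on the closed half-line, so
    -- integrability is only a question at infinity.
    set L' : ℝ → ℝ := Function.update L 0 (deriv H₀ 0) with hL'
    have hne : ∀ η : ℝ, 0 < η → L' η = L η := fun η hη => by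
      rw [hL', Function.update_of_ne hη.ne']
    have hc : ContinuousOn L' (Ici 0) := by
      intro η hη
      rcases (mem_Ici.1 hη).eq_or_lt with rfl | hη
      · rw [hL', continuousWithinAt_update_same, hIci]
        exact hlim0
      · have h1 : ContinuousAt L η := hcont.continuousAt (Ioi_mem_nhds hη)
        refine ContinuousAt.continuousWithinAt (h1.congr ?_)
        filter_upwards [lt_mem_nhds hη] with s hs using (hne s hs).symm
    have h1 : IntegrableOn L' (Ici 0) := by
      refine (hc.locallyIntegrableOn measurableSet_Ici).integrableOn_of_isBigO_atTop
        (hLinf.congr' ?_ EventuallyEq.rfl) (integrableAtFilter_rpow_atTop_iff.2 (by norm_num))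
      filter_upwards [eventually_gt_atTop 0] with η hη using (hne η hη).symm
    exact (h1.mono_set Ioi_subset_Ici_self).congr_fun (fun η hη => hne η hη) measurableSet_Ioi
  refine ⟨hint, ?_⟩
  set H' : ℝ → ℝ := Function.update H 0 (H₀ 0) with hH'
  have hne : ∀ η : ℝ, 0 < η → H' η = H η := fun η hη => by
    rw [hH', Function.update_of_ne hη.ne']
  have h1 : ContinuousWithinAt H' (Ici 0) 0 := by
    rw [hH', continuousWithinAt_update_same, hIci]
    exact (hH₀.continuousAt.tendsto.mono_left nhdsWithin_le_nhds).congr'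
      (heq.mono fun η h => h.symm)
  have h2 : Tendsto H' atTop (𝓝 0) := by
    have h3 := hM.continuousAt.tendsto.comp hinv
    rw [hM0] at h3
    refine h3.congr' ?_
    filter_upwards [hinf, eventually_gt_atTop 0] with η e1 e2
    rw [hne η e2, e1, Function.comp]
  have h3 := integral_Ioi_of_hasDerivAt_of_tendsto h1 (fun η hη => (hder η hη).congr_of_eventuallyEq
    ((lt_mem_nhds hη).mono fun s hs => hne s hs)) hint h2
  rw [h3, hH', Function.update_self, zero_sub]

variable {n : ℕ} {S : Matrix (Fin n) (Fin n) ℝ} {sLow sUp : ℝ}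

/-- The expansion of `⟨u⟩` at `η = ∞`. -/
lemma IsFlat.exists_expansion_atTop (hL : 0 < sLow) (hU : sLow < sUp) (hn : 0 < n)
    (hS : IsFlat sLow sUp S) (z : ℂ) :
    ∃ Ξ : ℝ × ℂ → ℝ, ContDiffAt ℝ ω Ξ (0, z) ∧ ∀ᶠ p in nhds ((0, z) : ℝ × ℂ), 0 < p.1 →
      avgU S ((Real.sqrt p.1)⁻¹, p.2) = p.1 * Ξ p := by
  -- Writing a = ηã, b = ηb̃, u = η⁻²ũ and d = η⁻² turns the equations into ã = 1 + dS(ãũ), b̃ = 1 +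
  -- dSᵗ(b̃ũ), ũ(dτ + ãb̃) = 1. At d = 0 the solution is ã = b̃ = ũ = 1.
  obtain ⟨φ, h₁, h₂, h₃⟩ := BddFamily.exists_smooth_branch (ι := Unit) (N := fun _ => n) hL hU
    (fun _ => hn) (fun _ => S) (fun _ => hS) (fun _ => z) (Z := ‖z‖) (e₀ := 1) (d₀ := 0)
    (c := 1) (C := 1) (K := 3)
    (fun _ => le_rfl) one_pos (fun _ => 1) (fun _ => 1) (fun _ => 1)
    (fun _ => ⟨fun _ => one_pos, fun _ => one_pos, fun _ => one_pos, by simp, by simp, by simp, rfl⟩)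
    (fun _ _ => by simp) (by norm_num) (fun _ q => norm_le_linDyson_zero S _ q)
  let g : ℝ × ℂ → ℝ × ℝ × ℂ := fun p => (1, p.1, p.2 - z)
  have hg : ContDiff ℝ ω g := by fun_prop
  have hg0 : g (0, z) = (1, 0, 0) := by simp [g]
  have hφ : ContDiffAt ℝ ω (φ ∘ g) (0, z) := by
    refine ContDiffAt.comp _ ?_ hg.contDiffAt
    rw [hg0]; exact h₁
  refine ⟨fun p => BddFamily.avgAt () (φ (g p)).2.2,
    (BddFamily.avgAt ()).contDiff.contDiffAt.comp _ hφ.snd.snd, ?_⟩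
  have ht : Tendsto g (nhds (0, z)) (nhds (1, 0, 0)) := by
    have := hg.continuous.tendsto (0, z)
    rwa [hg0] at this
  filter_upwards [ht.eventually h₃] with p hp hp0
  have h := hp zero_le_one hp0 ()
  set r := Real.sqrt p.1
  have hr : 0 < r := Real.sqrt_pos.2 hp0
  have hr2 : p.1 = r ^ 2 := (Real.sq_sqrt hp0.le).symm
  set a := BddFamily.fiber () (φ (g p)).1
  set b := BddFamily.fiber () (φ (g p)).2.1
  set u := BddFamily.fiber () (φ (g p)).2.2
  have e₁ : ∀ f : Fin n → ℝ, (r⁻¹ • f) * (r ^ 2 • u) = r • (f * u) := fun f => by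
    ext i
    simp only [Pi.mul_apply, Pi.smul_apply, smul_eq_mul]
    field_simp
  have hres : IsDysonTriple S r⁻¹ (‖p.2‖ ^ 2) (r⁻¹ • a) (r⁻¹ • b) (r ^ 2 • u) := by
    refine IsDysonTriple.of_pos (inv_pos.2 hr)
      (fun i => mul_pos (inv_pos.2 hr) (h.pos_a i)) (fun i => mul_pos (inv_pos.2 hr) (h.pos_b i))
      (fun i => mul_pos (by positivity) (h.pos_u i)) (fun i => ?_) (fun i => ?_) (fun i => ?_)
    · have := h.eq_a i
      rw [e₁, mulVec_smul]
      simp only [g, smul_mulVec, Pi.smul_apply, smul_eq_mul] at this ⊢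
      rw [this, hr2]; field_simp
    · have := h.eq_b i
      rw [e₁, mulVec_smul]
      simp only [g, transpose_smul, smul_mulVec, Pi.smul_apply, smul_eq_mul] at this ⊢
      rw [this, hr2]; field_simp
    · have := h.eq_u i
      simp only [g, add_sub_cancel, Pi.smul_apply, smul_eq_mul] at this ⊢
      rw [← this, hr2]; field_simp
  rw [avgU, (hres.eq_dyson (hS.entry_nonneg hL) (inv_pos.2 hr) (by positivity)).2, vecAvg_smul, hr2]
  rfl

/-- The integral of the Laplacian in `η`. -/
lemma IsFlat.integral_laplacianAvg (hL : 0 < sLow) (hU : sLow < sUp) (hn : 0 < n)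
    (hS : IsFlat sLow sUp S) {z : ℂ} (hz : ‖z‖ ^ 2 < specRadius S) :
    IntegrableOn (fun η => laplacianAvg S η z) (Ioi 0) ∧
      ∫ η in Ioi (0 : ℝ), laplacianAvg S η z =
        -(2 * avgUZero S z + fderiv ℝ (avgUZero S) z z) := by
  obtain ⟨A, B, U, hA, hB, hU', -, hev, hev0⟩ := hS.exists_branch_zero hL hU hn hz
  obtain ⟨Ξ, hΞ, hΞev⟩ := hS.exists_expansion_atTop hL hU hn z
  set Ψ : ℝ × ℂ → ℝ := fun p => vecAvg (U p) with hΨdef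
  have hΨ : ContDiffAt ℝ ω Ψ (0, z) := contDiff_vecAvg.contDiffAt.comp _ hU'
  have hin : Tendsto (fun η : ℝ => ((η, z) : ℝ × ℂ)) (𝓝 0) (𝓝 (0, z)) :=
    (Continuous.prodMk_left z).tendsto 0
  have hder : ∀ η, 0 < η → HasDerivAt (lapPrimitive (avgU S) z) (laplacianAvg S η z) η :=
    fun η hη => hS.hasDerivAt_lapPrimitive hL hU hn hη z
  have hcont : ContinuousOn (fun η => laplacianAvg S η z) (Ioi 0) := by
    intro η hη
    have h1 : ContDiffAt ℝ ω (lapPrimitive (avgU S) z) η :=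
      contDiffAt_lapPrimitive (hS.contDiffAt_avgU hL hU hn hη z)
    have h2 : ContDiffAt ℝ ω (fun s => fderiv ℝ (lapPrimitive (avgU S) z) s 1) η :=
      (h1.fderiv_right (m := ω) (by simp)).clm_apply contDiffAt_const
    refine (h2.continuousAt.congr ?_).continuousWithinAt
    filter_upwards [lt_mem_nhds (mem_Ioi.1 hη)] with s hs
    exact (hder s hs).deriv
  -- `lapPrimitive` differentiates only in z, so the prefactor d = η⁻² of the expansion comes out,
  -- and the primitive vanishes at infinity.
  have hM : ContDiffAt ℝ ω (fun d : ℝ => d * lapPrimitive Ξ z d) 0 :=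
    contDiffAt_id.mul (contDiffAt_lapPrimitive hΞ)
  have hmain := integrableOn_and_integral_of_expansions hder hcont
    (contDiffAt_lapPrimitive hΨ) ?_ hM (by simp) ?_
  · refine ⟨hmain.1, hmain.2.trans ?_⟩
    have h1 : avgUZero S =ᶠ[𝓝 z] fun w => Ψ (0, w) := hev0.mono fun w hw => hw.2
    have h2 : HasFDerivAt (fun w => Ψ (0, w)) ((fderiv ℝ Ψ (0, z)).comp
        (ContinuousLinearMap.inr ℝ ℝ ℂ)) z :=
      (hΨ.differentiableAt (by simp)).hasFDerivAt.comp z (hasFDerivAt_prodMk_right 0 z)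
    rw [h1.eq_of_nhds, h1.fderiv_eq, h2.fderiv]
    simp [lapPrimitive]
  · filter_upwards [nhdsWithin_le_nhds (hin.eventually (eventually_eventually_nhds.2 hev)),
      self_mem_nhdsWithin] with η h1 h2
    refine lapPrimitive_congr ?_
    have h3 : ∀ᶠ p : ℝ × ℂ in 𝓝 (η, z), 0 < p.1 :=
      continuous_fst.continuousAt.eventually (lt_mem_nhds h2)
    filter_upwards [h1, h3] with p h4 h5 using h4 h5
  · have hinv : Tendsto (fun η : ℝ => (((η ^ 2)⁻¹, z) : ℝ × ℂ)) atTop (𝓝 (0, z)) :=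
      hin.comp (tendsto_inv_atTop_zero.comp (tendsto_pow_atTop two_ne_zero))
    filter_upwards [hinv.eventually (eventually_eventually_nhds.2 hΞev), eventually_gt_atTop 0,
      hinv.eventually (hΞ.eventually (by simp))] with η h1 h2 h3
    have hd : 0 < (η ^ 2)⁻¹ := by positivity
    have hsq : (Real.sqrt ((η ^ 2)⁻¹))⁻¹ = η := by
      rw [Real.sqrt_inv, Real.sqrt_sq h2.le, inv_inv]
    have hfix : ∀ᶠ w in 𝓝 z, avgU S (η, w) = (η ^ 2)⁻¹ * Ξ ((η ^ 2)⁻¹, w) := by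
      have h4 : Tendsto (fun w : ℂ => (((η ^ 2)⁻¹, w) : ℝ × ℂ)) (𝓝 z) (𝓝 ((η ^ 2)⁻¹, z)) :=
        (Continuous.prodMk_right _).tendsto z
      filter_upwards [h4.eventually h1] with w hw
      have := hw hd
      rwa [hsq] at this
    have k1 : HasFDerivAt (fun w => avgU S (η, w)) ((fderiv ℝ (avgU S) (η, z)).comp
        (ContinuousLinearMap.inr ℝ ℝ ℂ)) z :=
      ((hS.contDiffAt_avgU hL hU hn h2 z).differentiableAt (by simp)).hasFDerivAt.comp z
        (hasFDerivAt_prodMk_right η z)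
    have k2 : HasFDerivAt (fun w => Ξ ((η ^ 2)⁻¹, w)) ((fderiv ℝ Ξ ((η ^ 2)⁻¹, z)).comp
        (ContinuousLinearMap.inr ℝ ℝ ℂ)) z :=
      (h3.differentiableAt (by simp)).hasFDerivAt.comp z (hasFDerivAt_prodMk_right _ z)
    have k3 := k1.unique ((k2.const_mul _).congr_of_eventuallyEq hfix)
    have k4 := congrArg (fun L : ℂ →L[ℝ] ℝ => L z) k3
    simp at k4
    rw [lapPrimitive, lapPrimitive, hfix.self_of_nhds, k4]
    ring

/-- Only the boundary term at η = 0 survives the integration: 2πσ is the divergence of z⟨u₀⟩.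
Smoothness, bounds and total mass are all derived from this form. -/
lemma IsFlat.densityOfStates_eq (hL : 0 < sLow) (hU : sLow < sUp) (hn : 0 < n)
    (hS : IsFlat sLow sUp S) {z : ℂ} (hz : ‖z‖ ^ 2 < specRadius S) :
    densityOfStates S z =
      1 / (2 * Real.pi) * (2 * avgUZero S z + fderiv ℝ (avgUZero S) z z) := by
  rw [densityOfStates, if_pos hz, (hS.integral_laplacianAvg hL hU hn hz).2]
  ring

end Integration

/-! ### Two-sided bounds and smoothness of the density -/

section DensityBounds

open Filter Topology

variable {n : ℕ} {S : Matrix (Fin n) (Fin n) ℝ} {sLow sUp τ : ℝ} {a b u : Fin n → ℝ}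

/-- At η = 0 one has S(au) = a and Sᵗ(bu) = b, so q ↦ S(auq)/a is a Markov operator with invariant
weight abu, hence a contraction in the weighted L² norm. -/
lemma vecAvg_mulVec_sq_le (hS : ∀ i j, 0 ≤ S i j) (h : IsDysonTriple S 0 τ a b u)
    (q : Fin n → ℝ) :
    vecAvg (fun i => b i * u i / a i * (S *ᵥ (a * u * q)) i ^ 2) ≤
      vecAvg (fun i => a i * b i * u i * q i ^ 2) := by
  have h1 : ∀ i, (S *ᵥ (a * u * q)) i ^ 2 ≤ a i * (S *ᵥ (a * u * q ^ 2)) i := fun i => by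
    have h2 := h.eq_a i
    rw [zero_add] at h2
    conv_rhs => rw [h2]
    simp only [mulVec, dotProduct, Pi.mul_apply, Pi.pow_apply]
    refine Finset.sum_sq_le_sum_mul_sum_of_sq_le_mul _ (fun j _ => ?_) (fun j _ => ?_)
      (fun j _ => le_of_eq ?_)
    · exact mul_nonneg (hS i j) (mul_pos (h.pos_a j) (h.pos_u j)).le
    · exact mul_nonneg (hS i j) (mul_nonneg (mul_pos (h.pos_a j) (h.pos_u j)).le (sq_nonneg _))
    · ring
  calc vecAvg (fun i => b i * u i / a i * (S *ᵥ (a * u * q)) i ^ 2)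
      ≤ vecAvg (b * u * (S *ᵥ (a * u * q ^ 2))) := vecAvg_mono fun i => by
        have ha := h.pos_a i
        have hb := h.pos_b i
        have hu := h.pos_u i
        simp only [Pi.mul_apply]
        calc b i * u i / a i * (S *ᵥ (a * u * q)) i ^ 2
            ≤ b i * u i / a i * (a i * (S *ᵥ (a * u * q ^ 2)) i) :=
              mul_le_mul_of_nonneg_left (h1 i) (by positivity)
          _ = b i * u i * (S *ᵥ (a * u * q ^ 2)) i := by field_simp
    _ = vecAvg (a * u * q ^ 2 * (Sᵀ *ᵥ (b * u))) := vecAvg_mul_mulVec _ _ _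
    _ = _ := by
      congr 1; ext i
      have h2 := h.eq_b i
      rw [zero_add] at h2
      simp only [Pi.mul_apply, Pi.pow_apply, ← h2]
      ring

/-- The energy estimate behind the two-sided bounds on the density. -/
lemma IsDysonTriple.energy_estimate (h : IsDysonTriple S 0 τ a b u) (hS : ∀ i j, 0 ≤ S i j)
    (hτ : 0 < τ) {X Y s : Fin n → ℝ} (hs : s = X + Y)
    (hX : ∀ i, a i * X i = 2 * a i + (S *ᵥ (a * u * (X - a * b * u * s))) i)
    (hY : ∀ i, b i * Y i = 2 * b i + (Sᵀ *ᵥ (b * u * (Y - a * b * u * s))) i) :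
    vecAvg (fun i => (a i * b i * u i) ^ 2 * s i) = 2 * vecAvg (a * b * u) ∧
    vecAvg (fun i => (a i * b i * u i) ^ 2 * u i * s i ^ 2) ≤
      2 * vecAvg (fun i => a i * b i * u i * u i * s i) := by
  have hmean : vecAvg (fun i => (a i * b i * u i) ^ 2 * s i) = 2 * vecAvg (a * b * u) := by
    have e1 : vecAvg (b * u * (a * X)) = 2 * vecAvg (a * b * u) +
        vecAvg (b * u * (S *ᵥ (a * u * (X - a * b * u * s)))) := by
      rw [← vecAvg_smul, ← vecAvg_add]; congr 1; ext i
      simp only [Pi.mul_apply, Pi.add_apply, Pi.smul_apply, smul_eq_mul]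
      linear_combination b i * u i * hX i
    have e2 : a * u * (X - a * b * u * s) * (Sᵀ *ᵥ (b * u)) =
        b * u * (a * X) - fun i => (a i * b i * u i) ^ 2 * s i := by
      ext i
      have h2 := h.eq_b i
      rw [zero_add] at h2
      simp only [Pi.mul_apply, Pi.sub_apply, ← h2]
      ring
    rw [vecAvg_mul_mulVec, e2, vecAvg_sub] at e1
    linarith
  refine ⟨hmean, ?_⟩
  have j1 := vecAvg_mulVec_sq_le hS h (X - a * b * u * s)
  have j2 := vecAvg_mulVec_sq_le (S := Sᵀ) (fun i j => hS j i) h.swap (Y - a * b * u * s)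
  have k1 : (fun i => b i * u i / a i * (S *ᵥ (a * u * (X - a * b * u * s))) i ^ 2) =
      fun i => a i * b i * u i * (X i - 2) ^ 2 := by
    ext i
    have ha := (h.pos_a i).ne'
    rw [show (S *ᵥ (a * u * (X - a * b * u * s))) i = a i * (X i - 2) by linarith [hX i]]
    field_simp
  have k2 : (fun i => a i * u i / b i * (Sᵀ *ᵥ (b * u * (Y - a * b * u * s))) i ^ 2) =
      fun i => a i * b i * u i * (Y i - 2) ^ 2 := by
    ext i
    have hb := (h.pos_b i).ne'
    rw [show (Sᵀ *ᵥ (b * u * (Y - a * b * u * s))) i = b i * (Y i - 2) by linarith [hY i]]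
    field_simp
  rw [k1] at j1
  rw [k2] at j2
  -- The difference of the two sides of the summed contraction estimates, rewritten with τu = 1 -
  -- abu. The terms without a factor τ cancel on average by `hmean`; dividing by 2τ then leaves the
  -- claim.
  have l1 : (fun i => a i * b i * u i * (X i - 2) ^ 2) + (fun i => a i * b i * u i * (Y i - 2) ^ 2) -
      ((fun i => a i * b i * u i * (X - a * b * u * s) i ^ 2) +
        fun i => b i * a i * u i * (Y - a * b * u * s) i ^ 2) =
      (2 * τ) • (fun i => (a i * b i * u i) ^ 2 * u i * s i ^ 2) -
      (4 * τ) • (fun i => a i * b i * u i * u i * s i) -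
      (4 : ℝ) • (fun i => (a i * b i * u i) ^ 2 * s i) + (8 : ℝ) • (a * b * u) := by
    ext i
    simp only [Pi.add_apply, Pi.sub_apply, Pi.mul_apply, Pi.smul_apply, smul_eq_mul, hs]
    have e := h.eq_u i
    set p := a i * b i * u i with hp
    have e' : τ * u i = 1 - p := by rw [hp]; linarith
    rw [show b i * a i * u i = p by rw [hp]; ring]
    linear_combination (4 * p * (X i + Y i) - 2 * p ^ 2 * (X i + Y i) ^ 2) * e'
  have l2 := congrArg vecAvg l1
  rw [vecAvg_sub, vecAvg_add, vecAvg_add, vecAvg_add, vecAvg_sub, vecAvg_sub, vecAvg_smul,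
    vecAvg_smul, vecAvg_smul, vecAvg_smul, hmean] at l2
  refine le_of_mul_le_mul_left (a := 2 * τ) ?_ (by positivity)
  linarith

/-- At η = 0 both a and b lie between multiples of ⟨au⟩, which cancels in the ratio. The comparison
thus holds uniformly up to the spectral edge, without a gap condition. -/
lemma IsDysonTriple.ab_le (h : IsDysonTriple S 0 τ a b u) (hS : IsFlat sLow sUp S)
    (hL : 0 < sLow) (hU : sLow < sUp) (hn : 0 < n) (i j : Fin n) :
    sLow ^ 2 * (a i * b i) ≤ sUp ^ 2 * (a j * b j) := by
  have hm := h.avg_pos hn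
  have hUp : 0 < sUp := hL.trans hU
  have ha1 : sLow * a i ≤ sUp * a j := by
    have h1 := (h.a_mem hS i).2
    have h2 := (h.a_mem hS j).1
    nlinarith
  have hb1 : sLow * b i ≤ sUp * b j := by
    have h1 := (h.b_mem hS i).2
    have h2 := (h.b_mem hS j).1
    nlinarith
  have := mul_le_mul ha1 hb1 (mul_pos hL (h.pos_b i)).le (mul_pos hUp (h.pos_a j)).le
  nlinarith

lemma IsDysonTriple.u_le (h : IsDysonTriple S 0 τ a b u) (hS : IsFlat sLow sUp S)
    (hL : 0 < sLow) (hU : sLow < sUp) (hn : 0 < n) (hτ : 0 ≤ τ) (i j : Fin n) :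
    sLow ^ 2 * u i ≤ sUp ^ 2 * u j := by
  have h1 := h.ab_le hS hL hU hn j i
  have e1 := h.eq_u i
  have e2 := h.eq_u j
  have p1 := h.pos_u i
  have p2 := h.pos_u j
  have h2 : sLow ^ 2 * τ ≤ sUp ^ 2 * τ :=
    mul_le_mul_of_nonneg_right (pow_le_pow_left₀ hL.le hU.le 2) hτ
  have h3 : sLow ^ 2 * (τ + a j * b j) ≤ sUp ^ 2 * (τ + a i * b i) := by linarith
  calc sLow ^ 2 * u i = u i * u j * (sLow ^ 2 * (τ + a j * b j)) := by
        linear_combination -sLow ^ 2 * u i * e2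
    _ ≤ u i * u j * (sUp ^ 2 * (τ + a i * b i)) := mul_le_mul_of_nonneg_left h3 (by positivity)
    _ = sUp ^ 2 * u j := by linear_combination sUp ^ 2 * u j * e1

lemma IsDysonTriple.abu_le (h : IsDysonTriple S 0 τ a b u) (hS : IsFlat sLow sUp S)
    (hL : 0 < sLow) (hU : sLow < sUp) (hn : 0 < n) (hτ : 0 ≤ τ) (i j : Fin n) :
    sLow ^ 2 * (a i * b i * u i) ≤ sUp ^ 2 * (a j * b j * u j) := by
  have h1 := h.ab_le hS hL hU hn i j
  have e1 := h.eq_u i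
  have e2 := h.eq_u j
  have p1 := h.pos_u i
  have p2 := h.pos_u j
  have q1 := mul_pos (h.pos_a i) (h.pos_b i)
  have q2 := mul_pos (h.pos_a j) (h.pos_b j)
  have h2 : sLow ^ 2 ≤ sUp ^ 2 := pow_le_pow_left₀ hL.le hU.le 2
  have h3 : sLow ^ 2 * (a i * b i * (τ + a j * b j)) ≤ sUp ^ 2 * (a j * b j * (τ + a i * b i)) := by
    have h4 := mul_le_mul_of_nonneg_right h1 hτ
    have h5 := mul_le_mul_of_nonneg_right h2 (mul_pos q1 q2).le
    nlinarith
  calc sLow ^ 2 * (a i * b i * u i) = u i * u j * (sLow ^ 2 * (a i * b i * (τ + a j * b j))) := by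
        linear_combination -sLow ^ 2 * (a i * b i * u i) * e2
    _ ≤ u i * u j * (sUp ^ 2 * (a j * b j * (τ + a i * b i))) :=
        mul_le_mul_of_nonneg_left h3 (by positivity)
    _ = sUp ^ 2 * (a j * b j * u j) := by linear_combination sUp ^ 2 * (a j * b j * u j) * e1

/-- At the minimum of a, a ≥ sLow⟨au⟩ ≥ sLow a⟨u⟩; at the maximum the reverse chain holds with sUp.
-/
lemma IsDysonTriple.avg_u_mem (h : IsDysonTriple S 0 τ a b u) (hS : IsFlat sLow sUp S)
    (hn : 0 < n) (hL : 0 < sLow) (hU : sLow < sUp) :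
    sLow * vecAvg u ≤ 1 ∧ 1 ≤ sUp * vecAvg u := by
  have : Nonempty (Fin n) := ⟨⟨0, hn⟩⟩
  constructor
  · obtain ⟨i, hi⟩ := Finite.exists_min a
    have h1 := (h.a_mem hS i).1
    have h2 : a i * vecAvg u ≤ vecAvg (a * u) := by
      rw [← vecAvg_smul]
      exact vecAvg_mono fun j => mul_le_mul_of_nonneg_right (hi j) (h.pos_u j).le
    refine le_of_mul_le_mul_left (a := a i) ?_ (h.pos_a i)
    nlinarith
  · obtain ⟨i, hi⟩ := Finite.exists_max a
    have h1 := (h.a_mem hS i).2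
    have h2 : vecAvg (a * u) ≤ a i * vecAvg u := by
      rw [← vecAvg_smul]
      exact vecAvg_mono fun j => mul_le_mul_of_nonneg_right (hi j) (h.pos_u j).le
    refine le_of_mul_le_mul_left (a := a i) ?_ (h.pos_a i)
    have := mul_le_mul_of_nonneg_left h2 (hL.trans hU).le
    linarith

/-- Two-sided bounds on `2 π σ = ⟨2 u + ∂u⟩`, where `∂` is the radial derivative. -/
lemma IsDysonTriple.density_bounds (h : IsDysonTriple S 0 τ a b u) (hS : IsFlat sLow sUp S)
    (hn : 0 < n) (hL : 0 < sLow) (hU : sLow < sUp) (hτ : 0 < τ) {α β υ : Fin n → ℝ}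
    (h₁ : ∀ i, α i = 0 + (S *ᵥ (α * u + a * υ)) i)
    (h₂ : ∀ i, β i = 0 + (Sᵀ *ᵥ (β * u + b * υ)) i)
    (h₃ : ∀ i, υ i * (τ + a i * b i) + u i * (2 * τ + (α i * b i + a i * β i)) = 0) :
    2 * (sLow ^ 4 / sUp ^ 5) ≤ 2 * vecAvg u + vecAvg υ ∧
      2 * vecAvg u + vecAvg υ ≤ 2 * (1 / sLow) := by
  have hUp : 0 < sUp := hL.trans hU
  -- The shift by 1 is chosen so that 2u + υ = abu·u·s holds with no remainder, which makes the
  -- density a linear functional of s.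
  set X : Fin n → ℝ := fun i => 1 - α i / a i with hX
  set Y : Fin n → ℝ := fun i => 1 - β i / b i with hY
  set s := X + Y with hs
  have hα : ∀ i, α i = a i * (1 - X i) := fun i => by
    have := (h.pos_a i).ne'
    simp only [hX]; field_simp; ring
  have hβ : ∀ i, β i = b i * (1 - Y i) := fun i => by
    have := (h.pos_b i).ne'
    simp only [hY]; field_simp; ring
  have hυ : ∀ i, υ i = u i * (a i * b i * u i * s i - 2) := fun i => by
    have e := h₃ i
    have e' := h.eq_u i
    rw [hα i, hβ i] at e
    simp only [hs, Pi.add_apply]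
    linear_combination u i * e - (υ i + 2 * u i) * e'
  have eX : ∀ i, a i * X i = 2 * a i + (S *ᵥ (a * u * (X - a * b * u * s))) i := fun i => by
    have e := h₁ i
    have e' := h.eq_a i
    have : α * u + a * υ = -(a * u) - a * u * (X - a * b * u * s) := by
      ext j
      simp only [Pi.add_apply, Pi.mul_apply, Pi.neg_apply, Pi.sub_apply, hα j, hυ j]
      ring
    rw [this, mulVec_sub, mulVec_neg, Pi.sub_apply, Pi.neg_apply, hα i] at e
    linarith
  have eY : ∀ i, b i * Y i = 2 * b i + (Sᵀ *ᵥ (b * u * (Y - a * b * u * s))) i := fun i => by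
    have e := h₂ i
    have e' := h.eq_b i
    have : β * u + b * υ = -(b * u) - b * u * (Y - a * b * u * s) := by
      ext j
      simp only [Pi.add_apply, Pi.mul_apply, Pi.neg_apply, Pi.sub_apply, hβ j, hυ j]
      ring
    rw [this, mulVec_sub, mulVec_neg, Pi.sub_apply, Pi.neg_apply, hβ i] at e
    linarith
  obtain ⟨m1, m2⟩ := h.energy_estimate (hS.entry_nonneg hL) hτ hs eX eY
  set Q := vecAvg (fun i => a i * b i * u i * u i * s i) with hQ
  set W := vecAvg (fun i => (a i * b i * u i) ^ 2 * u i * s i ^ 2) with hW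
  have hQeq : 2 * vecAvg u + vecAvg υ = Q := by
    rw [← vecAvg_smul, ← vecAvg_add, hQ]
    congr 1; ext i
    simp only [Pi.add_apply, Pi.smul_apply, smul_eq_mul, hυ i]
    ring
  rw [hQeq]
  have hp : ∀ i, 0 < a i * b i * u i := fun i =>
    mul_pos (mul_pos (h.pos_a i) (h.pos_b i)) (h.pos_u i)
  have hW0 : 0 ≤ W := vecAvg_nonneg fun i => by
    have := h.pos_u i
    positivity
  have hQ0 : 0 ≤ Q := by linarith
  have hu := h.avg_u_mem hS hn hL hU
  have hu0 := vecAvg_pos hn h.pos_u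
  constructor
  · set P := vecAvg (a * b * u) with hP
    have hP0 : 0 < P := vecAvg_pos hn hp
    have hpP : ∀ i, sLow ^ 2 * (a i * b i * u i) ≤ sUp ^ 2 * P := fun i => by
      have := le_vecAvg hn fun j => h.abu_le hS hL hU hn hτ.le i j
      refine this.trans_eq ?_
      rw [hP, ← vecAvg_smul]; rfl
    have hui : ∀ i, sLow ^ 2 ≤ sUp ^ 3 * u i := fun i => by
      have h1 := vecAvg_le hn fun j => h.u_le hS hL hU hn hτ.le j i
      have h2 : vecAvg (fun j => sLow ^ 2 * u j) = sLow ^ 2 * vecAvg u := by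
        rw [← vecAvg_smul]; rfl
      rw [h2] at h1
      have h3 := mul_le_mul_of_nonneg_left hu.2 (sq_nonneg sLow)
      have h4 := mul_le_mul_of_nonneg_left h1 hUp.le
      linarith
    -- Cauchy–Schwarz with weight (abu)²/u, combined with W ≤ 2Q, bounds Q from below. Flatness
    -- makes the average of the weight at most a multiple of P², so P cancels however small it is
    -- near the edge.
    have c1 : (2 * P) ^ 2 ≤ W * vecAvg (fun i => (a i * b i * u i) ^ 2 / u i) := by
      have := vecAvg_sq_le (fun i => (a i * b i * u i) ^ 2 * s i)
        (fun i => (a i * b i * u i) ^ 2 / u i) (fun i => div_pos (pow_pos (hp i) 2) (h.pos_u i))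
      rw [m1] at this
      convert this using 2
      rw [hW]
      congr 1; ext i
      have h1 := (h.pos_a i).ne'
      have h2 := (h.pos_b i).ne'
      have h3 := (h.pos_u i).ne'
      field_simp
    have c2 : vecAvg (fun i => (a i * b i * u i) ^ 2 / u i) ≤ sUp ^ 5 / sLow ^ 4 * P ^ 2 := by
      calc vecAvg (fun i => (a i * b i * u i) ^ 2 / u i)
          ≤ vecAvg ((sUp ^ 5 / sLow ^ 4 * P) • (a * b * u)) := vecAvg_mono fun i => by
            simp only [Pi.smul_apply, Pi.mul_apply, smul_eq_mul]
            have h5 := mul_le_mul (hpP i) (hui i) (by positivity) (by positivity)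
            have h6 : a i * b i * u i ≤ sUp ^ 5 / sLow ^ 4 * P * u i := by
              rw [div_mul_eq_mul_div, div_mul_eq_mul_div, le_div_iff₀ (by positivity)]
              linarith
            rw [div_le_iff₀ (h.pos_u i)]
            calc (a i * b i * u i) ^ 2 = a i * b i * u i * (a i * b i * u i) := sq _
              _ ≤ sUp ^ 5 / sLow ^ 4 * P * u i * (a i * b i * u i) :=
                mul_le_mul_of_nonneg_right h6 (hp i).le
              _ = _ := by ring
        _ = _ := by rw [vecAvg_smul]; ring
    have c3 : 4 * P ^ 2 ≤ 2 * Q * (sUp ^ 5 / sLow ^ 4 * P ^ 2) := by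
      calc 4 * P ^ 2 = (2 * P) ^ 2 := by ring
        _ ≤ W * vecAvg (fun i => (a i * b i * u i) ^ 2 / u i) := c1
        _ ≤ 2 * Q * (sUp ^ 5 / sLow ^ 4 * P ^ 2) := mul_le_mul m2 c2
          (vecAvg_nonneg fun i => by have := h.pos_u i; positivity) (by linarith)
    have c4 : 4 ≤ 2 * Q * (sUp ^ 5 / sLow ^ 4) := by
      refine le_of_mul_le_mul_right (a := P ^ 2) ?_ (by positivity)
      linarith
    have c5 : sUp ^ 5 / sLow ^ 4 * (sLow ^ 4 / sUp ^ 5) = 1 := by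
      field_simp
    have c6 := mul_le_mul_of_nonneg_right c4 (by positivity : 0 ≤ sLow ^ 4 / sUp ^ 5)
    rw [mul_assoc, c5] at c6
    linarith
  -- With weight u instead, Q² ≤ W⟨u⟩ ≤ 2Q⟨u⟩.
  · have c1 : Q ^ 2 ≤ W * vecAvg u := by
      have := vecAvg_sq_le (fun i => a i * b i * u i * u i * s i) u h.pos_u
      convert this using 2
      rw [hW]
      congr 1; ext i
      have h3 := (h.pos_u i).ne'
      field_simp
    have c2 : Q * Q ≤ Q * (2 * vecAvg u) := by
      have := mul_le_mul_of_nonneg_right m2 hu0.le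
      nlinarith
    have c3 : vecAvg u ≤ 1 / sLow := by rw [le_div_iff₀ hL]; linarith
    rcases hQ0.eq_or_lt with h0 | h0
    · rw [← h0]; positivity
    · have := le_of_mul_le_mul_left c2 h0
      linarith

lemma IsFlat.contDiffAt_avgUZero (hL : 0 < sLow) (hU : sLow < sUp) (hn : 0 < n)
    (hS : IsFlat sLow sUp S) {z : ℂ} (hz : ‖z‖ ^ 2 < specRadius S) :
    ContDiffAt ℝ ω (avgUZero S) z := by
  obtain ⟨A, B, U, hA, hB, hU', -, -, hev0⟩ := hS.exists_branch_zero hL hU hn hz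
  have h1 : ContDiffAt ℝ ω (fun w : ℂ => vecAvg (U (0, w))) z :=
    contDiff_vecAvg.contDiffAt.comp z (hU'.comp z (by fun_prop))
  exact h1.congr_of_eventuallyEq (hev0.mono fun w hw => hw.2)

lemma eventually_mem_disk {ρ : ℝ} {z : ℂ} (hz : ‖z‖ ^ 2 < ρ) : ∀ᶠ w in 𝓝 z, ‖w‖ ^ 2 < ρ :=
  (continuous_norm.pow 2).continuousAt.eventually (gt_mem_nhds hz)

lemma IsFlat.densityOfStates_eventuallyEq (hL : 0 < sLow) (hU : sLow < sUp) (hn : 0 < n)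
    (hS : IsFlat sLow sUp S) {z : ℂ} (hz : ‖z‖ ^ 2 < specRadius S) :
    densityOfStates S =ᶠ[𝓝 z] fun w =>
      1 / (2 * Real.pi) * (2 * avgUZero S w + fderiv ℝ (avgUZero S) w w) :=
  (eventually_mem_disk hz).mono fun _ hw => hS.densityOfStates_eq hL hU hn hw

lemma IsFlat.contDiffAt_densityOfStates (hL : 0 < sLow) (hU : sLow < sUp) (hn : 0 < n)
    (hS : IsFlat sLow sUp S) {z : ℂ} (hz : ‖z‖ ^ 2 < specRadius S) :
    ContDiffAt ℝ ω (densityOfStates S) z := by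
  have h := hS.contDiffAt_avgUZero hL hU hn hz
  refine ContDiffAt.congr_of_eventuallyEq ?_ (hS.densityOfStates_eventuallyEq hL hU hn hz)
  exact contDiffAt_const.mul ((contDiffAt_const.mul h).add
    ((h.fderiv_right (m := ω) (by simp)).clm_apply contDiffAt_id))

lemma IsFlat.densityOfStates_mem (hL : 0 < sLow) (hU : sLow < sUp) (hn : 0 < n)
    (hS : IsFlat sLow sUp S) {z : ℂ} (hz : ‖z‖ ^ 2 < specRadius S) :
    densityOfStates S z ∈ Icc (1 / Real.pi * (sLow ^ 4 / sUp ^ 5)) (1 / Real.pi * (1 / sLow)) := by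
  have hne : ∀ z : ℂ, z ≠ 0 → ‖z‖ ^ 2 < specRadius S → densityOfStates S z ∈
      Icc (1 / Real.pi * (sLow ^ 4 / sUp ^ 5)) (1 / Real.pi * (1 / sLow)) := by
    intro z hz0 hz
    obtain ⟨A, B, U, hA, hB, hU', -, -, hev0⟩ := hS.exists_branch_zero hL hU hn hz
    have hin : HasFDerivAt (fun w : ℂ => ((0 : ℝ), w)) (ContinuousLinearMap.inr ℝ ℝ ℂ) z :=
      hasFDerivAt_prodMk_right 0 z
    have dA : DifferentiableAt ℝ (fun w => A (0, w)) z :=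
      (hA.differentiableAt (by simp)).comp z hin.differentiableAt
    have dB : DifferentiableAt ℝ (fun w => B (0, w)) z :=
      (hB.differentiableAt (by simp)).comp z hin.differentiableAt
    have dU : DifferentiableAt ℝ (fun w => U (0, w)) z :=
      (hU'.differentiableAt (by simp)).comp z hin.differentiableAt
    have hline : ∀ᶠ t : ℝ in 𝓝 0, IsDysonTriple S 0 (‖z + t • z‖ ^ 2) (A (0, z + t • z))
        (B (0, z + t • z)) (U (0, z + t • z)) ∧
        avgUZero S (z + t • z) = vecAvg (U (0, z + t • z)) := by
      have : Tendsto (fun t : ℝ => z + t • z) (𝓝 0) (𝓝 z) := by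
        have : Continuous fun t : ℝ => z + t • z := by fun_prop
        simpa using this.tendsto 0
      exact this.eventually hev0
    obtain ⟨g1, g2, g3, -⟩ := IsDysonTriple.deriv_eq (hasDerivAt_line dA z)
      (hasDerivAt_line dB z) (hasDerivAt_line dU z) (hasDerivAt_const (0 : ℝ) (0 : ℝ))
      (hasDerivAt_normSq_line z z) (hline.mono fun t ht => ht.1)
    have hτ : 2 * (z.re * z.re + z.im * z.im) = 2 * ‖z‖ ^ 2 := by
      rw [Complex.sq_norm, Complex.normSq_apply]
    simp only [zero_smul, add_zero, hτ] at g1 g2 g3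
    have hb := hev0.self_of_nhds.1.density_bounds hS hn hL hU (by positivity) g1 g2 g3
    have hd : fderiv ℝ (avgUZero S) z z = vecAvg (fderiv ℝ (fun w => U (0, w)) z z) := by
      have h1 := hasDerivAt_line ((hS.contDiffAt_avgUZero hL hU hn hz).differentiableAt (by simp)) z
      have h2 := hasDerivAt_vecAvg (hasDerivAt_line dU z)
      exact h1.unique (h2.congr_of_eventuallyEq (hline.mono fun t ht => ht.2))
    rw [hS.densityOfStates_eq hL hU hn hz, hev0.self_of_nhds.2, hd]
    have hπ : 0 ≤ 1 / (2 * Real.pi) := by positivity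
    have e : ∀ x : ℝ, 1 / Real.pi * x = 1 / (2 * Real.pi) * (2 * x) := fun x => by
      field_simp
    rw [e, e]
    exact ⟨mul_le_mul_of_nonneg_left hb.1 hπ, mul_le_mul_of_nonneg_left hb.2 hπ⟩
  have hc := (hS.contDiffAt_densityOfStates hL hU hn hz).continuousAt
  -- The energy estimate divides by τ = |z|², so the origin is reached by continuity.
  rcases eq_or_ne z 0 with rfl | hz0
  · refine isClosed_Icc.mem_of_tendsto (hc.tendsto.mono_left
      (nhdsWithin_le_nhds (s := {(0 : ℂ)}ᶜ))) ?_
    filter_upwards [self_mem_nhdsWithin, nhdsWithin_le_nhds (eventually_mem_disk hz)] with w h1 h2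
    exact hne w h1 h2
  · exact hne z hz0 hz

end DensityBounds

/-! ### Derivative bounds uniform in the dimension and the matrix -/

section UniformDerivativeBounds

open Filter Topology BddFamily

variable {sLow sUp : ℝ}

/-- One smooth function of the common displacement h encodes ⟨u₀⟩ near z i for all indices. The gap
γ gives uniform bounds on the base solutions, hence a common inverse bound and neighbourhood. -/
lemma exists_smooth_avgUZero_family {ι : Type} {N : ι → ℕ} (hL : 0 < sLow) (hU : sLow < sUp)
    (hN : ∀ i, 0 < N i) (S : ∀ i, Matrix (Fin (N i)) (Fin (N i)) ℝ)
    (hS : ∀ i, IsFlat sLow sUp (S i)) (z : ι → ℂ) {γ : ℝ} (hγ : 0 < γ)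
    (hz : ∀ i, ‖z i‖ ^ 2 + γ ≤ specRadius (S i)) :
    ∃ U : ℂ → BddFamily N, ContDiffAt ℝ ω U 0 ∧
      ∀ᶠ h in 𝓝 0, ∀ i, avgUZero (S i) (z i + h) = avgAt i (U h) := by
  have hZ : ∀ i, ‖z i‖ ≤ Real.sqrt sUp := fun i => by
    refine Real.le_sqrt_of_sq_le ?_
    have := ((hS i).specRadius_mem hL (hN i)).2
    linarith [hz i]
  choose a b u hbase using fun i => exists_isDysonTriple_zero hL hU (hS i) (hN i)
    (sq_nonneg ‖z i‖) (by linarith [hz i])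
  obtain ⟨c, C, η₁, hc, hη₁, hbd⟩ := exists_uniform_bounds hL hU hγ
  have hbd' : ∀ i k, a i k ∈ Icc c (max C 1) ∧ b i k ∈ Icc c (max C 1) ∧
      u i k ∈ Icc c (max C 1) := fun i k => by
    have := hbd (N i) (S i) (hN i) (hS i) 0 _ _ _ _ le_rfl hη₁.le (sq_nonneg _) (hz i) (hbase i) k
    have hC : C ≤ max C 1 := le_max_left _ _
    exact ⟨Icc_subset_Icc_right hC this.1, Icc_subset_Icc_right hC this.2.1,
      Icc_subset_Icc_right hC this.2.2⟩
  obtain ⟨K, hK, hstab⟩ := exists_linDyson_bound hL hU hc (lt_max_of_lt_right one_pos : 0 < max C 1)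
  obtain ⟨φ, h₁, h₂, h₃⟩ := BddFamily.exists_smooth_branch hL hU hN S hS z (e₀ := 0) (d₀ := 1)
    hZ hc a b u (fun i => by simpa using hbase i) hbd' hK (fun i q => by
      simpa using hstab (N i) (S i) (hN i) (hS i) 0 _ _ _ _ le_rfl (sq_nonneg _) (hbase i)
        (hbd' i) q)
  have hg : ContDiff ℝ ω (fun h : ℂ => ((0, 1, h) : ℝ × ℝ × ℂ)) := by fun_prop
  refine ⟨fun h => (φ (0, 1, h)).2.2, (h₁.comp (0 : ℂ) hg.contDiffAt).snd.snd, ?_⟩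
  have hcont : ∀ᶠ p in 𝓝 ((0, 1, 0) : ℝ × ℝ × ℂ), ContinuousAt φ p :=
    (h₁.eventually (by simp)).mono fun p hp => hp.continuousAt
  have ht := hg.continuous.tendsto 0
  filter_upwards [ht.eventually (eventually_eventually_nhds.2 h₃), ht.eventually hcont]
    with h hh₁ hh₂ i
  have hline : Tendsto (fun η : ℝ => ((η, 1, h) : ℝ × ℝ × ℂ)) (𝓝[>] 0) (𝓝 (0, 1, h)) :=
    ((Continuous.prodMk_left _).tendsto 0).mono_left nhdsWithin_le_nhds
  have hφ := hh₂.tendsto.comp hline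
  have hlim : Tendsto (fun η : ℝ => fiberL i (φ (η, 1, h)).2.2) (𝓝[>] 0)
      (𝓝 (fiberL i (φ (0, 1, h)).2.2)) :=
    ((fiberL i).continuous.comp continuous_snd.snd).continuousAt.tendsto.comp hφ
  refine tendsto_avgU_of_triple ((hS i).entry_nonneg hL) ?_ hlim
  filter_upwards [hline.eventually hh₁, self_mem_nhdsWithin] with η k₁ k₂
  have := k₁ (le_of_lt k₂) one_pos i
  rw [one_smul, one_mul] at this
  exact ⟨_, _, this⟩

/-- The radial derivative is written in the two real coordinates, whose families are bounded because
|z|² ≤ ρ ≤ sUp. The neighbourhood of h = 0 may depend on the index, since only germs at 0 are used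
afterwards. -/
lemma exists_smooth_density_family {ι : Type} {N : ι → ℕ} (hL : 0 < sLow) (hU : sLow < sUp)
    (hN : ∀ i, 0 < N i) (S : ∀ i, Matrix (Fin (N i)) (Fin (N i)) ℝ)
    (hS : ∀ i, IsFlat sLow sUp (S i)) (z : ι → ℂ) {γ : ℝ} (hγ : 0 < γ)
    (hz : ∀ i, ‖z i‖ ^ 2 + γ ≤ specRadius (S i)) :
    ∃ W : ℂ → BddFamily N, ContDiffAt ℝ ω W 0 ∧
      ∀ i, ∀ᶠ h in 𝓝 0, densityOfStates (S i) (z i + h) = avgAt i (W h) := by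
  obtain ⟨U, hUs, hev⟩ := exists_smooth_avgUZero_family hL hU hN S hS z hγ hz
  have hZ : ∀ i, ‖z i‖ ≤ Real.sqrt sUp := fun i => by
    refine Real.le_sqrt_of_sq_le ?_
    have := ((hS i).specRadius_mem hL (hN i)).2
    linarith [hz i]
  set x₀ : BddFamily N := mk (fun i _ => (z i).re) _
    fun i _ => (Complex.abs_re_le_norm _).trans (hZ i) with hx₀
  set y₀ : BddFamily N := mk (fun i _ => (z i).im) _
    fun i _ => (Complex.abs_im_le_norm _).trans (hZ i) with hy₀
  have hU' := hUs.fderiv_right (m := ω) (by simp)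
  refine ⟨fun h => (1 / (2 * Real.pi)) • ((2 : ℝ) • U h +
    ((x₀ + Complex.reCLM h • 1) * fderiv ℝ U h 1 +
      (y₀ + Complex.imCLM h • 1) * fderiv ℝ U h Complex.I)), ?_, fun i => ?_⟩
  · have h1 : ContDiffAt ℝ ω (fun h => fderiv ℝ U h 1) 0 := hU'.clm_apply contDiffAt_const
    have h2 : ContDiffAt ℝ ω (fun h => fderiv ℝ U h Complex.I) 0 := hU'.clm_apply contDiffAt_const
    fun_prop
  · have hd : ∀ᶠ h in 𝓝 (0 : ℂ), DifferentiableAt ℝ U h :=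
      (hUs.eventually (by simp)).mono fun h hh => hh.differentiableAt (by simp)
    have hdisk : ∀ᶠ h in 𝓝 (0 : ℂ), ‖z i + h‖ ^ 2 < specRadius (S i) := by
      have : Tendsto (fun h => z i + h) (𝓝 0) (𝓝 (z i)) := by
        simpa using (continuous_const_add (z i)).tendsto 0
      exact this.eventually (eventually_mem_disk (by linarith [hz i]))
    filter_upwards [eventually_eventually_nhds.2 hev, hd, hdisk] with h k₁ k₂ k₃
    have e₁ : ∀ v, fderiv ℝ (avgUZero (S i)) (z i + h) v = avgAt i (fderiv ℝ U h v) := fun v => by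
      rw [← fderiv_comp_add_left, Filter.EventuallyEq.fderiv_eq (k₁.mono fun w hw => hw i)]
      exact congrArg (fun L => L v) ((avgAt i).hasFDerivAt.comp h k₂.hasFDerivAt).fderiv
    have e₂ : ∀ (x : ι → ℝ) (X : ℝ) hX (t : ℝ) (f : BddFamily N),
        avgAt i ((mk (fun i _ => x i) X hX + t • 1) * f) = (x i + t) * avgAt i f :=
        fun x X hX t f => by
      rw [avgAt_apply, avgAt_apply, ← vecAvg_smul]
      congr 1; ext k
      simp
    rw [(hS i).densityOfStates_eq hL hU (hN i) k₃, k₁.self_of_nhds i, e₁]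
    have e₃ : z i + h = ((z i).re + h.re) • (1 : ℂ) + ((z i).im + h.im) • Complex.I := by
      apply Complex.ext <;> simp
    conv_lhs => rw [e₃]
    simp only [map_add, map_smul, smul_eq_mul, hx₀, hy₀, e₂, Complex.reCLM_apply,
      Complex.imCLM_apply]

/-- The derivatives of the density are bounded away from the spectral edge, uniformly in the
variance matrix. -/
theorem exists_iteratedFDeriv_densityOfStates_bound (hL : 0 < sLow) (hU : sLow < sUp) {ε : ℝ}
    (hε : 0 < ε) (k : ℕ) : ∃ C : ℝ,
      ∀ (n : ℕ) (S : Matrix (Fin n) (Fin n) ℝ), 0 < n → IsFlat sLow sUp S →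
        ∀ z ∈ Metric.ball (0 : ℂ) (Real.sqrt (specRadius S) - ε),
          ‖iteratedFDeriv ℝ k (densityOfStates S) z‖ ≤ C := by
  let ι : Type := {q : Σ n, Matrix (Fin n) (Fin n) ℝ × ℂ // 0 < q.1 ∧ IsFlat sLow sUp q.2.1 ∧
    q.2.2 ∈ Metric.ball (0 : ℂ) (Real.sqrt (specRadius q.2.1) - ε)}
  -- For z in the smaller disk ε < √ρ, so ρ - |z|² ≥ ε(2√ρ - ε) ≥ ε√ρ ≥ ε√sLow.
  have hγ : 0 < ε * Real.sqrt sLow := mul_pos hε (Real.sqrt_pos.2 hL)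
  obtain ⟨W, hW, hσ⟩ := exists_smooth_density_family (ι := ι) (N := fun i => i.1.1) hL hU
    (fun i => i.2.1) (fun i => i.1.2.1) (fun i => i.2.2.1) (fun i => i.1.2.2) hγ (fun i => by
      have hz := mem_ball_zero_iff.1 i.2.2.2
      have hρ := (i.2.2.1.specRadius_mem hL i.2.1).1
      have h0 := norm_nonneg i.1.2.2
      have h1 := Real.sqrt_le_sqrt hρ
      have h2 := Real.sq_sqrt (hL.le.trans hρ)
      have h3 : ‖i.1.2.2‖ ^ 2 ≤ (Real.sqrt (specRadius i.1.2.1) - ε) ^ 2 :=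
        pow_le_pow_left₀ h0 hz.le 2
      nlinarith)
  refine ⟨‖iteratedFDeriv ℝ k W 0‖, fun n S hn hS z hz => ?_⟩
  let i : ι := ⟨⟨n, S, z⟩, hn, hS, hz⟩
  have hi : (fun h => densityOfStates S (z + h)) =ᶠ[𝓝 0] (avgAt i) ∘ W := hσ i
  have e : iteratedFDeriv ℝ k (densityOfStates S) z =
      iteratedFDeriv ℝ k ((avgAt i) ∘ W) 0 := by
    rw [← (hi.iteratedFDeriv ℝ k).self_of_nhds, iteratedFDeriv_comp_add_left, add_zero]
  rw [e]
  calc _ ≤ ‖avgAt i‖ * ‖iteratedFDeriv ℝ k W 0‖ :=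
        ContinuousLinearMap.norm_iteratedFDeriv_comp_left _ hW (by simp)
    _ ≤ 1 * ‖iteratedFDeriv ℝ k W 0‖ :=
        mul_le_mul_of_nonneg_right (norm_avgAt_le i) (norm_nonneg _)
    _ = _ := one_mul _

end UniformDerivativeBounds

/-! ### Rotational symmetry, total mass and support -/

section ProbabilityDensity

open Filter Topology

variable {n : ℕ} {S : Matrix (Fin n) (Fin n) ℝ} {sLow sUp : ℝ}

lemma densityOfStates_of_le {z : ℂ} (hz : specRadius S ≤ ‖z‖ ^ 2) : densityOfStates S z = 0 :=
  if_neg hz.not_gt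

lemma avgUZero_congr {z w : ℂ} (h : ‖z‖ = ‖w‖) : avgUZero S z = avgUZero S w := by
  simp only [avgUZero, avgU, h]

lemma IsFlat.densityOfStates_mul (hL : 0 < sLow) (hU : sLow < sUp) (hn : 0 < n)
    (hS : IsFlat sLow sUp S) {u : ℂ} (hu : ‖u‖ = 1) (z : ℂ) :
    densityOfStates S (u * z) = densityOfStates S z := by
  have hnorm : ‖u * z‖ = ‖z‖ := by rw [norm_mul, hu, one_mul]
  by_cases hz : ‖z‖ ^ 2 < specRadius S
  · have huz : ‖u * z‖ ^ 2 < specRadius S := by rwa [hnorm]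
    rw [hS.densityOfStates_eq hL hU hn hz, hS.densityOfStates_eq hL hU hn huz,
      avgUZero_congr hnorm]
    have h1 := hasDerivAt_line ((hS.contDiffAt_avgUZero hL hU hn hz).differentiableAt (by simp)) z
    have h2 := hasDerivAt_line
      ((hS.contDiffAt_avgUZero hL hU hn huz).differentiableAt (by simp)) (u * z)
    have h3 : (fun t : ℝ => avgUZero S (u * z + t • (u * z))) =
        fun t : ℝ => avgUZero S (z + t • z) := funext fun t => avgUZero_congr (by
      rw [← mul_smul_comm, ← mul_add, norm_mul, hu, one_mul])
    rw [h3] at h2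
    rw [h2.unique h1]
  · rw [densityOfStates_of_le (not_lt.1 hz), densityOfStates_of_le]
    rw [hnorm]; exact not_lt.1 hz

lemma IsFlat.densityOfStates_eq_norm (hL : 0 < sLow) (hU : sLow < sUp) (hn : 0 < n)
    (hS : IsFlat sLow sUp S) (z : ℂ) : densityOfStates S z = densityOfStates S (‖z‖ : ℂ) := by
  rcases eq_or_ne z 0 with rfl | hz
  · simp
  · have hz' : (‖z‖ : ℂ) ≠ 0 := by simpa using hz
    rw [← hS.densityOfStates_mul hL hU hn (u := z / ‖z‖) (by simp [hz]) ‖z‖,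
      div_mul_cancel₀ _ hz']

lemma IsFlat.measurable_densityOfStates (hL : 0 < sLow) (hU : sLow < sUp) (hn : 0 < n)
    (hS : IsFlat sLow sUp S) : Measurable (densityOfStates S) := by
  classical
  have hc : ContinuousOn (densityOfStates S) {z | ‖z‖ ^ 2 < specRadius S} := fun z hz =>
    (hS.contDiffAt_densityOfStates hL hU hn hz).continuousAt.continuousWithinAt
  have hm : MeasurableSet {z : ℂ | ‖z‖ ^ 2 < specRadius S} :=
    (isOpen_lt (by fun_prop) continuous_const).measurableSet
  have := hc.measurable_piecewise (g := fun _ => 0) continuousOn_const hm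
  convert this using 1
  ext z
  by_cases hz : ‖z‖ ^ 2 < specRadius S
  · exact (piecewise_eq_of_mem {z : ℂ | ‖z‖ ^ 2 < specRadius S} _ _ hz).symm
  · rw [piecewise_eq_of_notMem {z : ℂ | ‖z‖ ^ 2 < specRadius S} _ _ hz,
      densityOfStates_of_le (not_lt.1 hz)]

lemma IsFlat.densityOfStates_nonneg (hL : 0 < sLow) (hU : sLow < sUp) (hn : 0 < n)
    (hS : IsFlat sLow sUp S) (z : ℂ) : 0 ≤ densityOfStates S z := by
  have hUp := hL.trans hU
  by_cases hz : ‖z‖ ^ 2 < specRadius S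
  · exact le_trans (by positivity) (hS.densityOfStates_mem hL hU hn hz).1
  · exact (densityOfStates_of_le (not_lt.1 hz)).ge

lemma IsFlat.densityOfStates_le (hL : 0 < sLow) (hU : sLow < sUp) (hn : 0 < n)
    (hS : IsFlat sLow sUp S) (z : ℂ) : densityOfStates S z ≤ 1 / Real.pi * (1 / sLow) := by
  by_cases hz : ‖z‖ ^ 2 < specRadius S
  · exact (hS.densityOfStates_mem hL hU hn hz).2
  · rw [densityOfStates_of_le (not_lt.1 hz)]; positivity

lemma IsFlat.integrable_densityOfStates (hL : 0 < sLow) (hU : sLow < sUp) (hn : 0 < n)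
    (hS : IsFlat sLow sUp S) : Integrable (densityOfStates S) := by
  have hsupp : Function.support (densityOfStates S) ⊆
      Metric.ball (0 : ℂ) (Real.sqrt (specRadius S)) := fun z hz => by
    rw [mem_ball_sqrt_iff]
    by_contra h
    exact hz (densityOfStates_of_le (not_lt.1 h))
  rw [← integrableOn_iff_integrable_of_support_subset hsupp]
  refine Measure.integrableOn_of_bounded (M := 1 / Real.pi * (1 / sLow))
    measure_ball_lt_top.ne (hS.measurable_densityOfStates hL hU hn).aestronglyMeasurable
    (ae_of_all _ fun z => ?_)
  rw [Real.norm_of_nonneg (hS.densityOfStates_nonneg hL hU hn z)]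
  exact hS.densityOfStates_le hL hU hn z

/-- Averaging u(τ + ab) = 1 gives τ⟨u⟩ = 1 - ⟨abu⟩. At an index with ρu ≥ 1 one has abu ≤ 1 - τ/ρ,
and `IsDysonTriple.abu_le` spreads this to all components. -/
lemma IsFlat.sq_mul_avgUZero_mem (hL : 0 < sLow) (hU : sLow < sUp) (hn : 0 < n)
    (hS : IsFlat sLow sUp S) {z : ℂ} (hz : ‖z‖ ^ 2 < specRadius S) :
    ‖z‖ ^ 2 * avgUZero S z ∈
      Icc (1 - sUp ^ 2 / sLow ^ 2 * (1 - ‖z‖ ^ 2 / specRadius S)) 1 := by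
  obtain ⟨A, B, U, -, -, -, -, -, hev⟩ := hS.exists_branch_zero hL hU hn hz
  obtain ⟨h, havg⟩ := hev.self_of_nhds
  set a := A (0, z)
  set b := B (0, z)
  set u := U (0, z)
  set τ := ‖z‖ ^ 2 with hτ
  have hτ0 : 0 ≤ τ := sq_nonneg _
  have hρ : 0 < specRadius S := hτ0.trans_lt hz
  have e : τ * vecAvg u = 1 - vecAvg (a * b * u) := by
    have h1 : τ • u + a * b * u = fun _ => 1 := by
      ext i
      simp only [Pi.add_apply, Pi.smul_apply, Pi.mul_apply, smul_eq_mul]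
      linarith [h.eq_u i]
    have h2 := congrArg vecAvg h1
    rw [vecAvg_add, vecAvg_smul, vecAvg_const hn] at h2
    linarith
  rw [havg, e]
  have hp : 0 ≤ vecAvg (a * b * u) := vecAvg_nonneg fun i =>
    (mul_pos (mul_pos (h.pos_a i) (h.pos_b i)) (h.pos_u i)).le
  refine ⟨?_, by linarith⟩
  obtain ⟨i, hi⟩ := h.exists_le_specRadius_mul_u hS hL hn
  have h1 : a i * b i * u i ≤ 1 - τ / specRadius S := by
    have : τ / specRadius S ≤ τ * u i := by
      rw [div_le_iff₀ hρ]
      nlinarith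
    linarith [h.eq_u i]
  have h2 : vecAvg (a * b * u) ≤ sUp ^ 2 / sLow ^ 2 * (1 - τ / specRadius S) := by
    refine vecAvg_le hn fun j => ?_
    have h3 := h.abu_le hS hL hU hn hτ0 j i
    rw [div_mul_eq_mul_div, le_div_iff₀ (by positivity)]
    simp only [Pi.mul_apply]
    nlinarith [mul_le_mul_of_nonneg_left h1 (sq_nonneg sUp)]
  linarith

lemma IsFlat.hasDerivAt_sq_mul_avgUZero (hL : 0 < sLow) (hU : sLow < sUp) (hn : 0 < n)
    (hS : IsFlat sLow sUp S) {r : ℝ} (hr0 : 0 < r) (hr : r < Real.sqrt (specRadius S)) :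
    HasDerivAt (fun r : ℝ => r ^ 2 * avgUZero S (r : ℂ))
      (2 * Real.pi * (r * densityOfStates S (r : ℂ))) r := by
  have hz : ‖(r : ℂ)‖ ^ 2 < specRadius S := by
    rw [← mem_ball_sqrt_iff, mem_ball_zero_iff, Complex.norm_real, Real.norm_of_nonneg hr0.le]
    exact hr
  have h1 := ((hS.contDiffAt_avgUZero hL hU hn hz).differentiableAt (by simp)).hasFDerivAt
  have h2 : HasDerivAt (fun r : ℝ => (r : ℂ)) 1 r := Complex.ofRealCLM.hasDerivAt
  have h3 := h1.comp_hasDerivAt r h2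
  have h4 : fderiv ℝ (avgUZero S) (r : ℂ) (r : ℂ) = r * fderiv ℝ (avgUZero S) (r : ℂ) 1 := by
    rw [← smul_eq_mul, ← map_smul, Complex.real_smul, mul_one]
  refine ((hasDerivAt_pow 2 r).mul h3).congr_deriv ?_
  rw [hS.densityOfStates_eq hL hU hn hz, h4]
  have := Real.pi_pos.ne'
  field_simp
  simp
  ring

/-- In polar coordinates the mass is the increment of r²⟨u₀⟩ between 0 and √ρ; the limits are 0 by
continuity and 1 by the squeeze at the edge. -/
lemma IsFlat.integral_densityOfStates (hL : 0 < sLow) (hU : sLow < sUp) (hn : 0 < n)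
    (hS : IsFlat sLow sUp S) : ∫ z, densityOfStates S z = 1 := by
  have hρ : 0 < specRadius S := hL.trans_le (hS.specRadius_mem hL hn).1
  set R := Real.sqrt (specRadius S) with hR
  have hR0 : 0 < R := Real.sqrt_pos.2 hρ
  have hR2 : R ^ 2 = specRadius S := Real.sq_sqrt hρ.le
  have hint : IntervalIntegrable (fun r : ℝ => 2 * Real.pi * (r * densityOfStates S (r : ℂ)))
      volume 0 R := by
    rw [intervalIntegrable_iff_integrableOn_Ioo_of_le hR0.le]
    refine Measure.integrableOn_of_bounded (M := 2 * Real.pi * (R * (1 / Real.pi * (1 / sLow))))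
      measure_Ioo_lt_top.ne (Measurable.aestronglyMeasurable ?_) ?_
    · exact (measurable_id.mul ((hS.measurable_densityOfStates hL hU hn).comp
        Complex.measurable_ofReal)).const_mul _
    · filter_upwards [ae_restrict_mem measurableSet_Ioo] with r hr
      have h0 := hS.densityOfStates_nonneg hL hU hn (r : ℂ)
      have h1 := hS.densityOfStates_le hL hU hn (r : ℂ)
      have h2 := hr.1.le
      rw [Real.norm_of_nonneg (by positivity)]
      have := hr.2.le
      gcongr
  have hlim0 : Tendsto (fun r : ℝ => r ^ 2 * avgUZero S (r : ℂ)) (𝓝[>] 0) (𝓝 0) := by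
    have h1 : ContinuousAt (avgUZero S) ((0 : ℝ) : ℂ) :=
      (hS.contDiffAt_avgUZero hL hU hn (by simpa using hρ)).continuousAt
    have h2 : ContinuousAt (fun r : ℝ => r ^ 2 * avgUZero S (r : ℂ)) 0 :=
      (continuousAt_id.pow 2).mul
        (ContinuousAt.comp (f := fun r : ℝ => (r : ℂ)) h1 Complex.continuous_ofReal.continuousAt)
    have h3 := h2.tendsto
    rw [zero_pow two_ne_zero, zero_mul] at h3
    exact h3.mono_left nhdsWithin_le_nhds
  have hlimR : Tendsto (fun r : ℝ => r ^ 2 * avgUZero S (r : ℂ)) (𝓝[<] R) (𝓝 1) := by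
    have hmem : ∀ᶠ r : ℝ in 𝓝[<] R, r ^ 2 * avgUZero S (r : ℂ) ∈
        Icc (1 - sUp ^ 2 / sLow ^ 2 * (1 - r ^ 2 / specRadius S)) 1 := by
      filter_upwards [self_mem_nhdsWithin, nhdsWithin_le_nhds (lt_mem_nhds hR0)] with r h1 h2
      have h3 : ‖(r : ℂ)‖ = r := by rw [Complex.norm_real, Real.norm_of_nonneg h2.le]
      have h4 : ‖(r : ℂ)‖ ^ 2 < specRadius S := by
        rw [← mem_ball_sqrt_iff, mem_ball_zero_iff, h3]; exact h1
      simpa only [h3] using hS.sq_mul_avgUZero_mem hL hU hn h4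
    refine tendsto_of_tendsto_of_tendsto_of_le_of_le' ?_ tendsto_const_nhds
      (hmem.mono fun r hr => hr.1) (hmem.mono fun r hr => hr.2)
    have hc : Continuous fun r : ℝ => 1 - sUp ^ 2 / sLow ^ 2 * (1 - r ^ 2 / specRadius S) := by
      fun_prop
    have := (hc.tendsto R).mono_left (nhdsWithin_le_nhds (s := Iio R))
    rwa [hR2, div_self hρ.ne', sub_self, mul_zero, sub_zero] at this
  have hftc := intervalIntegral.integral_eq_sub_of_hasDerivAt_of_tendsto hR0
    (fun r hr => hS.hasDerivAt_sq_mul_avgUZero hL hU hn hr.1 hr.2) hint hlim0 hlimR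
  rw [intervalIntegral.integral_const_mul, intervalIntegral.integral_of_le hR0.le,
    integral_Ioc_eq_integral_Ioo, sub_zero] at hftc
  have hpolar := integral_fun_norm_addHaar (volume : Measure ℂ) fun r => densityOfStates S (r : ℂ)
  simp only [← hS.densityOfStates_eq_norm hL hU hn] at hpolar
  have hball : (volume : Measure ℂ).real (Metric.ball 0 1) = Real.pi := by
    simp [Measure.real, Complex.volume_ball]
  have hset : ∫ r in Ioi (0 : ℝ), r ^ (2 - 1) • densityOfStates S (r : ℂ) =
      ∫ r in Ioo 0 R, r * densityOfStates S (r : ℂ) := by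
    simp only [Nat.add_one_sub_one, pow_one, smul_eq_mul]
    refine setIntegral_eq_of_subset_of_forall_sdiff_eq_zero measurableSet_Ioi
      Ioo_subset_Ioi_self fun r hr => ?_
    have h1 : R ≤ r := not_lt.1 fun h => hr.2 ⟨hr.1, h⟩
    rw [densityOfStates_of_le, mul_zero]
    rw [Complex.norm_real, Real.norm_of_nonneg (le_of_lt hr.1), ← hR2]
    exact pow_le_pow_left₀ hR0.le h1 2
  rw [hpolar, Complex.finrank_real_complex, hball, hset, ← hftc]
  simp [nsmul_eq_mul, mul_assoc]

theorem IsFlat.isRotSymmProbDensity (hL : 0 < sLow) (hU : sLow < sUp) (hn : 0 < n)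
    (hS : IsFlat sLow sUp S) : IsRotSymmProbDensity (densityOfStates S) where
  measurable := hS.measurable_densityOfStates hL hU hn
  nonneg := hS.densityOfStates_nonneg hL hU hn
  integrable := hS.integrable_densityOfStates hL hU hn
  integral_eq_one := hS.integral_densityOfStates hL hU hn
  rot_symm := fun _ z hu => hS.densityOfStates_mul hL hU hn hu z

lemma IsFlat.tsupport_densityOfStates (hL : 0 < sLow) (hU : sLow < sUp) (hn : 0 < n)
    (hS : IsFlat sLow sUp S) :
    tsupport (densityOfStates S) = Metric.closedBall (0 : ℂ) (Real.sqrt (specRadius S)) := by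
  have hρ : 0 < specRadius S := hL.trans_le (hS.specRadius_mem hL hn).1
  have hUp := hL.trans hU
  have hsupp : Function.support (densityOfStates S) =
      Metric.ball (0 : ℂ) (Real.sqrt (specRadius S)) := by
    ext z
    rw [mem_ball_sqrt_iff, Function.mem_support]
    constructor
    · intro h
      by_contra hz
      exact h (densityOfStates_of_le (not_lt.1 hz))
    · intro hz
      exact (lt_of_lt_of_le (by positivity) (hS.densityOfStates_mem hL hU hn hz).1).ne'
  rw [tsupport, hsupp, closure_ball _ (Real.sqrt_pos.2 hρ).ne']

end ProbabilityDensity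

end

/-! ### Assembly of the proposition -/

theorem proposition2p2 (sLow sUp : ℝ) (hLow : 0 < sLow) (hUp : sLow < sUp) :
    -- statements for each fixed dimension and variance matrix
    (∀ (n : ℕ) (S : Matrix (Fin n) (Fin n) ℝ), 0 < n → IsFlat sLow sUp S →
      -- the solution of the Dyson equation exists and is unique
      (∀ η τ : ℝ, 0 < η → 0 ≤ τ → IsDysonSolution S η τ (dysonSolution S η τ) ∧
        ∀ v, IsDysonSolution S η τ v → v = dysonSolution S η τ) ∧
      -- (i)
      ContDiffOn ℝ ∞ (fun p : ℝ × ℂ => dysonSolution S p.1 (‖p.2‖ ^ 2))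
        (Ioi (0 : ℝ) ×ˢ (univ : Set ℂ)) ∧
      (∀ z ∈ Metric.ball (0 : ℂ) (Real.sqrt (specRadius S)),
        IntegrableOn (fun η : ℝ => laplacianAvg S η z) (Ioi 0) volume) ∧
      -- (ii)
      IsRotSymmProbDensity (densityOfStates S) ∧
      -- (iii), smoothness and support
      ContDiffOn ℝ ∞ (densityOfStates S) (Metric.ball (0 : ℂ) (Real.sqrt (specRadius S))) ∧
      tsupport (densityOfStates S) = Metric.closedBall (0 : ℂ) (Real.sqrt (specRadius S))) ∧
    -- (iii), bounds on the derivatives, uniform in the dimension and the variance matrix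
    (∀ ε : ℝ, 0 < ε → ∀ k : ℕ, ∃ C : ℝ,
      ∀ (n : ℕ) (S : Matrix (Fin n) (Fin n) ℝ), 0 < n → IsFlat sLow sUp S →
        ∀ z ∈ Metric.ball (0 : ℂ) (Real.sqrt (specRadius S) - ε),
          ‖iteratedFDeriv ℝ k (densityOfStates S) z‖ ≤ C) ∧
    -- (iii), upper and lower bound on the density
    (∃ c₁ c₂ : ℝ, 0 < c₂ ∧ c₂ < c₁ ∧
      ∀ (n : ℕ) (S : Matrix (Fin n) (Fin n) ℝ), 0 < n → IsFlat sLow sUp S →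
        ∀ z ∈ Metric.ball (0 : ℂ) (Real.sqrt (specRadius S)),
          c₂ ≤ densityOfStates S z ∧ densityOfStates S z ≤ c₁) := by

  have hUp0 : 0 < sUp := hLow.trans hUp
  refine ⟨fun n S hn hS => ⟨fun η τ hη hτ => ?_, fun p hp => ?_, fun z hz => ?_, ?_, fun z hz => ?_,
    ?_⟩, fun ε hε k => exists_iteratedFDeriv_densityOfStates_bound hLow hUp hε k,
    1 / Real.pi * (1 / sLow), 1 / Real.pi * (sLow ^ 4 / sUp ^ 5), by positivity, ?_,
    fun n S hn hS z hz => ?_⟩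
  · have h := isDysonSolution_dysonSolution (hS.entry_nonneg hLow) hη hτ
    exact ⟨h, fun v hv => hv.unique (hS.entry_nonneg hLow) hη hτ h⟩
  · exact ((hS.contDiffAt_dysonSolution hLow hUp hn hp.1 p.2).of_le (by simp)).contDiffWithinAt
  · exact (hS.integral_laplacianAvg hLow hUp hn (mem_ball_sqrt_iff.1 hz)).1
  · exact hS.isRotSymmProbDensity hLow hUp hn
  · exact ((hS.contDiffAt_densityOfStates hLow hUp hn (mem_ball_sqrt_iff.1 hz)).of_le
      (by simp)).contDiffWithinAt
  · exact hS.tsupport_densityOfStates hLow hUp hn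
  -- The strict order of the two constants amounts to sLow⁵ < sUp⁵.
  · refine mul_lt_mul_of_pos_left ?_ (by positivity)
    rw [div_lt_div_iff₀ (by positivity) hLow, one_mul, ← pow_succ]
    exact pow_lt_pow_left₀ hUp hLow.le (by norm_num)
  · exact hS.densityOfStates_mem hLow hUp hn (mem_ball_sqrt_iff.1 hz)
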